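/- Let $\alpha>0$ and $0<R_1<R_2<\infty$. Identify $\mathbb R^2$ with $\mathbb C$ and put $\rho(r,\theta)=(r\cos\theta,r\sin\theta)$. Let $\bar C_u=[R_1,R_2]\times\mathbb R$ carry the intrinsic distance of the flat metric $dr^2+r^2d\theta^2$, i.e. $d(p,q)$ is the infimum of the lengths of the planar curves $\rho\circ\gamma$ over all continuous paths $\gamma$ in $\bar C_u$ from $p$ to $q$. Let $\bar C$ be the quotient of $\bar C_u$ by $(r,\theta)\mapsto(r,\theta+2\pi/\alpha)$, let $C$ be its interior ($R_1<r<R_2$) and $\partial C$ its boundary ($r\in\{R_1,R_2\}$); maps on $\bar C$ are the maps on $\bar C_u$ that are $2\pi/\alpha$-periodic in $\theta$. For a Lipschitz map $u:\bar C\to\mathbb R^2$ and $x\in C$ let $\mathrm Lu(x)=\inf_{\delta>0}\operatorname{Lip}(u,C\cap B_\delta(x))$, where $\operatorname{Lip}(u,V)$ is the least Lipschitz constant of $u$ on $V$. A Lipschitz map $v:\bar C\to\mathbb R^2$ is *tighter* than $u$ if $v=u$ on $\partial C$ and $$\sup\{\mathrm Lu(x):x\in C,\ \mathrm Lv(x)<\mathrm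 Lu(x)\}>\sup\{\mathrm Lv(x):x\in C,\ \mathrm Lv(x)>\mathrm Lu(x)\}$$ (with $\sup\emptyset=0$). A map $u:\bar C\to\mathbb R^2$ is *tight* if it is Lipschitz and there is no Lipschitz map $\bar C\to\mathbb R^2$ that is tighter than $u$. **Proposition.** Let $\varphi:[R_1,R_2]\to[0,\infty)$ be a function and let $u(r,\theta)=\rho(\varphi(r),\alpha\theta)$. Then $u$ is tight if and only if either one of the following holds: (a) there are $k,k_0\in\mathbb R$ with $\varphi(r)=kr+k_0$ on $[R_1,R_2]$ and $|k|>\alpha(kr+k_0)/r$ for every $r\in(R_1,R_2)$; (b) there are $k\in\mathbb R$ and $\beta\in\{\alpha,-\alpha\}$ with $\varphi(r)=kr^{\beta}$ on $[R_1,R_2]$, and $k=0$ or $\beta\notin(0,1)$; or neither (a) nor (b) holds and there is some $\tilde R\in(R_1,R_2)$ such that one of the following is true, for some constants $k_1,k_2>0$: 1. $\alpha\ge1$, $\varphi(r)=k_1r^{-\alpha}$ on $[R_1,\tilde R]$ and $\varphi(r)=k_2r^{\alpha}$ on $[\tilde R,R_2]$; 2. $\alpha\ge1$, $\varphi(r)=k_1r^{-\alpha}$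 on $[R_1,\tilde R]$, and $\varphi$ is a decreasing affine function on $[\tilde R,R_2]$ whose slope equals the derivative of $k_1r^{-\alpha}$ at $\tilde R$; 3. $\alpha\ge1$, $\varphi$ is an increasing affine function on $[R_1,\tilde R]$, $\varphi(r)=k_2r^{\alpha}$ on $[\tilde R,R_2]$, and the slope of the affine function equals the derivative of $k_2r^{\alpha}$ at $\tilde R$; 4. $\alpha\in(0,1)$, $\varphi(r)=k_1r^{-\alpha}$ on $[R_1,\tilde R]$, and $\varphi$ is an increasing affine function on $[\tilde R,R_2]$ whose slope is minus the derivative of $k_1r^{-\alpha}$ at $\tilde R$; 5. $\alpha\in(0,1)$, $\varphi(r)=k_1r^{-\alpha}$ on $[R_1,\tilde R]$, and $\varphi$ is a decreasing affine function on $[\tilde R,R_2]$ whose slope equals the derivative of $k_1r^{-\alpha}$ at $\tilde R$. (In 1–5 the two formulas agree at $\tilde R$, so $\varphi$ is continuous.) -/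

import Mathlib

open Set
open scoped NNReal ENNReal

noncomputable section

namespace RadialTight

/-- Polar coordinates `ρ(r, θ) = (r cos θ, r sin θ)`, with `ℝ²` identified with `ℂ`. -/
def polar (p : ℝ × ℝ) : ℂ := ⟨p.1 * Real.cos p.2, p.1 * Real.sin p.2⟩

/-- The universal cover `(R₁, R₂) × ℝ` of the open annulus, in polar coordinates. -/
def openCover (R₁ R₂ : ℝ) : Set (ℝ × ℝ) := {p | p.1 ∈ Ioo R₁ R₂}

/-- Its closure `[R₁, R₂] × ℝ`. -/
def closedCover (R₁ R₂ : ℝ) : Set (ℝ × ℝ) := {p | p.1 ∈ Icc R₁ R₂}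

/-- Its boundary: the two components `r = R₁` and `r = R₂`. -/
def coverBoundary (R₁ R₂ : ℝ) : Set (ℝ × ℝ) := {p | p.1 = R₁ ∨ p.1 = R₂}

/-- `γ` (restricted to `[0, 1]`) is a continuous path from `p` to `q` in the closed cover. -/
structure IsCoverPath (R₁ R₂ : ℝ) (p q : ℝ × ℝ) (γ : ℝ → ℝ × ℝ) : Prop where
  continuousOn : ContinuousOn γ (Icc 0 1)
  mapsTo : ∀ t ∈ Icc (0 : ℝ) 1, γ t ∈ closedCover R₁ R₂
  source : γ 0 = p
  target : γ 1 = q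

/-- The Riemannian (intrinsic) distance on the closed cover for the flat metric `dr² + r² dθ²`
that makes the covering map a local isometry: the infimum of the lengths of the paths joining
the two points, the length of a path being the length of its projection to the plane. -/
def coverEDist (R₁ R₂ : ℝ) (p q : ℝ × ℝ) : ℝ≥0∞ :=
  ⨅ (γ : ℝ → ℝ × ℝ) (_ : IsCoverPath R₁ R₂ p q γ), eVariationOn (fun t => polar (γ t)) (Icc 0 1)

/-- The least Lipschitz constant of `u` on `V`, for the distance of the cover. -/
def lipConst (R₁ R₂ : ℝ) (u : ℝ × ℝ → ℂ) (V : Set (ℝ × ℝ)) : ℝ≥0∞ :=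
  sInf {K : ℝ≥0∞ | ∀ p ∈ V, ∀ q ∈ V, edist (u p) (u q) ≤ K * coverEDist R₁ R₂ p q}

/-- The local Lipschitz constant `L u (p) = inf_{δ > 0} Lip (u, C ∩ B_δ(p))`. -/
def localLip (R₁ R₂ : ℝ) (u : ℝ × ℝ → ℂ) (p : ℝ × ℝ) : ℝ≥0∞ :=
  ⨅ (δ : ℝ≥0∞) (_ : 0 < δ), lipConst R₁ R₂ u (openCover R₁ R₂ ∩ {q | coverEDist R₁ R₂ p q < δ})

/-- The Lipschitz maps on the closure of `C`, the quotient of the cover by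
`(r, θ) ↦ (r, θ + 2π/α)`, viewed as periodic maps on the closed cover. Periodicity makes
Lipschitz continuity for the distance of the cover and for that of the quotient the same, with
the same constants. Values off the closed cover play no role. -/
structure IsPeriodicLipschitz (α R₁ R₂ : ℝ) (u : ℝ × ℝ → ℂ) : Prop where
  periodic : ∀ r ∈ Icc R₁ R₂, ∀ θ : ℝ, u (r, θ) = u (r, θ + 2 * Real.pi / α)
  lipschitz : ∃ K : ℝ≥0, ∀ p ∈ closedCover R₁ R₂, ∀ q ∈ closedCover R₁ R₂,
    edist (u p) (u q) ≤ K * coverEDist R₁ R₂ p q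

/-- `v` is tighter than `u`: they agree on the boundary and
`sup {L u : L v < L u} > sup {L v : L v > L u}`. (All values are nonnegative; the supremum of the
empty set is `0`.) -/
structure IsTighter (R₁ R₂ : ℝ) (v u : ℝ × ℝ → ℂ) : Prop where
  eqOn_boundary : ∀ p ∈ coverBoundary R₁ R₂, v p = u p
  sup_lt : sSup (localLip R₁ R₂ v ''
        {p ∈ openCover R₁ R₂ | localLip R₁ R₂ u p < localLip R₁ R₂ v p})
      < sSup (localLip R₁ R₂ u ''
        {p ∈ openCover R₁ R₂ | localLip R₁ R₂ v p < localLip R₁ R₂ u p})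

/-- `u` is a tight map on the closure of `C`: it is Lipschitz, and no Lipschitz map is tighter. -/
def IsTight (α R₁ R₂ : ℝ) (u : ℝ × ℝ → ℂ) : Prop :=
  IsPeriodicLipschitz α R₁ R₂ u ∧
    ¬ ∃ v : ℝ × ℝ → ℂ, IsPeriodicLipschitz α R₁ R₂ v ∧ IsTighter R₁ R₂ v u

/-- The map `u(r, θ) = ρ(φ(r), α θ)`. -/
def radialMap (α : ℝ) (φ : ℝ → ℝ) (p : ℝ × ℝ) : ℂ := polar (φ p.1, α * p.2)

/-- `φ(r) = k r + k₀` on `[a, b]`. -/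
def AffineOn (φ : ℝ → ℝ) (a b k k₀ : ℝ) : Prop := ∀ r ∈ Icc a b, φ r = k * r + k₀

/-- `φ(r) = k r ^ β` on `[a, b]`. -/
def PowerOn (φ : ℝ → ℝ) (a b k β : ℝ) : Prop := ∀ r ∈ Icc a b, φ r = k * r ^ β

/-- `φ` is affine on `[R₁, R₂]` and the radial direction is principal:
`|k| > α (k r + k₀) / r` on `(R₁, R₂)`. -/
def IsPrincipalAffine (α R₁ R₂ : ℝ) (φ : ℝ → ℝ) : Prop :=
  ∃ k k₀ : ℝ, AffineOn φ R₁ R₂ k k₀ ∧ ∀ r ∈ Ioo R₁ R₂, α * (k * r + k₀) / r < |k|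

/-- `φ(r) = k r ^ (± α)` on `[R₁, R₂]`, where `k = 0` or the exponent is not in `(0, 1)`. -/
def IsTightPower (α R₁ R₂ : ℝ) (φ : ℝ → ℝ) : Prop :=
  ∃ k β : ℝ, (β = α ∨ β = -α) ∧ (k = 0 ∨ β ∉ Ioo (0 : ℝ) 1) ∧ PowerOn φ R₁ R₂ k β

/-- `k₁ r ^ (-α)` followed by `k₂ r ^ α`, with `α ≥ 1`. -/
def GluePowers (α R₁ R R₂ : ℝ) (φ : ℝ → ℝ) : Prop :=
  1 ≤ α ∧ ∃ k₁ k₂ : ℝ, 0 < k₁ ∧ 0 < k₂ ∧ PowerOn φ R₁ R k₁ (-α) ∧ PowerOn φ R R₂ k₂ α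

/-- `k₁ r ^ (-α)` followed by a decreasing affine function, with matching slope at `R`. -/
def GluePowerDecreasing (α R₁ R R₂ : ℝ) (φ : ℝ → ℝ) : Prop :=
  ∃ k₁ m c : ℝ, 0 < k₁ ∧ m < 0 ∧ PowerOn φ R₁ R k₁ (-α) ∧ AffineOn φ R R₂ m c ∧
    HasDerivAt (fun r : ℝ => k₁ * r ^ (-α)) m R

/-- An increasing affine function followed by `k₂ r ^ α`, with matching slope at `R`. -/
def GlueIncreasingPower (α R₁ R R₂ : ℝ) (φ : ℝ → ℝ) : Prop :=
  ∃ k₂ m c : ℝ, 0 < k₂ ∧ 0 < m ∧ AffineOn φ R₁ R m c ∧ PowerOn φ R R₂ k₂ α ∧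
    HasDerivAt (fun r : ℝ => k₂ * r ^ α) m R

/-- `k₁ r ^ (-α)` followed by an increasing affine function, with opposite slope at `R`. -/
def GluePowerIncreasing (α R₁ R R₂ : ℝ) (φ : ℝ → ℝ) : Prop :=
  ∃ k₁ m c : ℝ, 0 < k₁ ∧ 0 < m ∧ PowerOn φ R₁ R k₁ (-α) ∧ AffineOn φ R R₂ m c ∧
    HasDerivAt (fun r : ℝ => k₁ * r ^ (-α)) (-m) R

end RadialTight

end

/-!
The local Lipschitz constant of `u(r, θ) = ρ(φ(r), α θ)` at radius `r` is the larger of its radial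
stretch, the local Lipschitz constant of `φ` at `r`, and its tangential stretch `α φ(r) / r`.

*The listed maps are tight.* They consist of at most three parts: `k₁ r ^ (-α)`, then an affine part
where the radial direction dominates, then `k₂ r ^ α` with `α ≥ 1` (`IsTightProfile`). Suppose that
`v` is tighter than `u`, and let `S` be the supremum of `L v` where `L v > L u`. Then
`L v ≤ max (L u, S)` everywhere, while `L v < L u` at some point where `L u > S`. On the power
parts `u` is conformal and its stretch does not decrease towards the boundary circle that is mapped
to the outer circle of the image annulus. A chord of the image with both ends on that outer circle is the
image of a curve along which the stretch of `u` integrates to the length of the chord. Since the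
local Lipschitz constant is an upper gradient (`norm_comp_curve_sub_le`), `v` must agree with `u` at
the midpoint of the chord as long as `L v ≤ L u` along the curve
(`IsPeriodicLipschitz.eq_of_localLip_le_power`). On the affine part radial segments play the same
role (`IsPeriodicLipschitz.eq_of_localLip_le_affine`). Hence `v = u` near every point where
`L u > S`, which contradicts `L v < L u` at one of them (`IsTightProfile.isTight`).

*There are no others.* Radial competitors are enough (`not_isTight_of_replacement`). Replacing `φ`
by a chord shows that `φ` is convex (`IsTight.le_chord`), and that on each `[a, b]` it is affine or
Lipschitz with constant the larger of `α φ(a) / a` and `α φ(b) / b` (`IsTight.affine_or_lipschitz`);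
lowering `φ` slightly shows that its local Lipschitz constant is nowhere less than `α φ(r) / r`
(`IsTight.not_locLip`). To the right of a minimum point of `φ` it follows that the slope is at least
`α φ / r`, and that beyond the longest initial interval on which `φ` is affine it is at most
`α φ / r`. So `φ' = α φ / r` there, and `φ` is affine and then a multiple of `r ^ α`; symmetrically,
to the left of the minimum it is a multiple of `r ^ (-α)` and then affine. Convexity and the bounds
on the slopes leave only the combinations in the list.
-/

namespace RadialTight

variable {R₁ R₂ α : ℝ} {φ : ℝ → ℝ}

/-! ### Polar coordinates and the distance of the cover -/

theorem norm_polar_sub_sq (a b s t : ℝ) :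
    ‖polar (a, s) - polar (b, t)‖ ^ 2 = (a - b) ^ 2 + 4 * a * b * Real.sin ((s - t) / 2) ^ 2 := by
  have h : Real.sin ((s - t) / 2) ^ 2 = (1 - Real.cos (s - t)) / 2 := by
    rw [Real.sin_sq_eq_half_sub]; ring_nf
  rw [h, Real.cos_sub, Complex.sq_norm, Complex.normSq_apply]
  simp only [polar, Complex.sub_re, Complex.sub_im]
  linear_combination a ^ 2 * Real.sin_sq_add_cos_sq s + b ^ 2 * Real.sin_sq_add_cos_sq t

theorem abs_sub_le_norm_polar_sub {a b : ℝ} (ha : 0 ≤ a) (hb : 0 ≤ b) (s t : ℝ) :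
    |a - b| ≤ ‖polar (a, s) - polar (b, t)‖ := by
  refine abs_le_of_sq_le_sq ?_ (norm_nonneg _)
  rw [norm_polar_sub_sq]
  have : 0 ≤ 4 * a * b * Real.sin ((s - t) / 2) ^ 2 := by positivity
  linarith

theorem norm_polar_sub_same_angle (a b s : ℝ) : ‖polar (a, s) - polar (b, s)‖ = |a - b| := by
  rw [← sq_eq_sq₀ (norm_nonneg _) (abs_nonneg _), norm_polar_sub_sq, sq_abs]
  simp

theorem norm_polar_sub_same_radius {a : ℝ} (ha : 0 ≤ a) (s t : ℝ) :
    ‖polar (a, s) - polar (a, t)‖ = 2 * a * |Real.sin ((s - t) / 2)| := by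
  rw [← sq_eq_sq₀ (norm_nonneg _) (by positivity), norm_polar_sub_sq, mul_pow, sq_abs]
  ring

/-- Away from the origin, the angle is controlled by the planar distance. -/
theorem abs_angle_sub_le {a b : ℝ} (hR₁ : 0 < R₁) (ha : R₁ ≤ a) (hb : R₁ ≤ b) {s t : ℝ}
    (hst : |s - t| ≤ 1) :
    |s - t| ≤ Real.pi / (2 * R₁) * ‖polar (a, s) - polar (b, t)‖ := by
  have h1 : 2 / Real.pi * |(s - t) / 2| ≤ |Real.sin ((s - t) / 2)| := by
    apply Real.mul_abs_le_abs_sin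
    rw [abs_div, abs_two]
    have := Real.pi_gt_three
    linarith
  have h2 : 2 * R₁ / Real.pi * |s - t| ≤ ‖polar (a, s) - polar (b, t)‖ := by
    apply le_of_sq_le_sq _ (norm_nonneg _)
    rw [norm_polar_sub_sq]
    have h3 : (2 * R₁ / Real.pi * |s - t|) ^ 2 ≤ 4 * (R₁ * R₁) * Real.sin ((s - t) / 2) ^ 2 := by
      rw [← sq_abs (Real.sin _)]
      calc (2 * R₁ / Real.pi * |s - t|) ^ 2
          = 4 * (R₁ * R₁) * (2 / Real.pi * |(s - t) / 2|) ^ 2 := by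
            rw [abs_div, abs_two]; ring
        _ ≤ _ := by gcongr
    have h4 : 4 * (R₁ * R₁) * Real.sin ((s - t) / 2) ^ 2
        ≤ 4 * (a * b) * Real.sin ((s - t) / 2) ^ 2 := by gcongr; linarith
    nlinarith [sq_nonneg (a - b)]
  have hpi := Real.pi_pos
  calc |s - t| = Real.pi / (2 * R₁) * (2 * R₁ / Real.pi * |s - t|) := by field_simp
    _ ≤ _ := by gcongr

/-- A map which is locally `C`-Lipschitz for the planar distance of the projections, uniformly in
the angular variable, is `C`-Lipschitz for the intrinsic distance of the cover. -/
theorem edist_le_mul_coverEDist {E : Type*} [PseudoMetricSpace E] {F : ℝ × ℝ → E} {C η : ℝ}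
    (hC : 0 < C) (hη : 0 < η)
    (h : ∀ p ∈ closedCover R₁ R₂, ∀ q ∈ closedCover R₁ R₂, |p.2 - q.2| ≤ η →
      dist (F p) (F q) ≤ C * ‖polar p - polar q‖) (p q : ℝ × ℝ) :
    edist (F p) (F q) ≤ ENNReal.ofReal C * coverEDist R₁ R₂ p q := by
  have key : ∀ γ, IsCoverPath R₁ R₂ p q γ →
      edist (F p) (F q) ≤ ENNReal.ofReal C * eVariationOn (fun t => polar (γ t)) (Icc 0 1) := by
    intro γ hγ
    have huc : UniformContinuousOn γ (Icc 0 1) :=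
      isCompact_Icc.uniformContinuousOn_of_continuous hγ.continuousOn
    obtain ⟨δ, hδ, hδ'⟩ := Metric.uniformContinuousOn_iff.1 huc η hη
    obtain ⟨n, hn⟩ := exists_nat_one_div_lt hδ
    set N : ℝ := (n : ℝ) + 1 with hN
    have hN0 : 0 < N := by positivity
    let x : ℕ → ℝ := fun i => min (i / N) 1
    have hx : ∀ i, x i ∈ Icc (0 : ℝ) 1 := fun i => ⟨le_min (by positivity) zero_le_one, min_le_right _ _⟩
    have hxm : Monotone x := by
      intro i j hij
      have : (i : ℝ) ≤ j := by exact_mod_cast hij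
      exact min_le_min (by gcongr) le_rfl
    have hx0 : x 0 = 0 := by simp [x]
    have hx1 : x (n + 1) = 1 := by
      have : ((n + 1 : ℕ) : ℝ) / N = 1 := by rw [hN]; push_cast; exact div_self hN0.ne'
      simp only [x, this, min_self]
    have hstep : ∀ i, dist (x i) (x (i + 1)) < δ := by
      intro i
      have h1 : x (i + 1) - x i ≤ 1 / N := by
        simp only [x]
        have : ((i + 1 : ℕ) : ℝ) / N = i / N + 1 / N := by push_cast; ring
        rw [this]
        have h2 : 0 < 1 / N := by positivity
        rcases le_total (i / N) 1 with h3 | h3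
        · rw [min_eq_left h3]; linarith [min_le_left (i / N + 1 / N) 1]
        · rw [min_eq_right h3]; linarith [min_le_right (i / N + 1 / N) 1]
      rw [dist_comm, Real.dist_eq, abs_of_nonneg (sub_nonneg.2 (hxm (Nat.le_succ i)))]
      exact lt_of_le_of_lt h1 hn
    have hsum := eVariationOn.sum_le (f := fun t => polar (γ t)) (s := Icc (0:ℝ) 1) (n := n + 1) hxm hx
    calc edist (F p) (F q) = edist (F (γ (x 0))) (F (γ (x (n + 1)))) := by
          rw [hx0, hx1, hγ.source, hγ.target]
      _ ≤ ∑ i ∈ Finset.range (n + 1), edist (F (γ (x i))) (F (γ (x (i + 1)))) :=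
          edist_le_range_sum_edist (fun i => F (γ (x i))) (n + 1)
      _ ≤ ∑ i ∈ Finset.range (n + 1),
            ENNReal.ofReal C * edist (polar (γ (x (i + 1)))) (polar (γ (x i))) := by
          refine Finset.sum_le_sum fun i _ => ?_
          rw [edist_comm (polar _), edist_dist, edist_dist, ← ENNReal.ofReal_mul hC.le]
          apply ENNReal.ofReal_le_ofReal
          rw [dist_eq_norm (polar _)]
          refine h _ (hγ.mapsTo _ (hx _)) _ (hγ.mapsTo _ (hx _)) ?_
          have h3 := (hδ' _ (hx i) _ (hx (i + 1)) (hstep i)).le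
          exact le_trans (le_trans (le_of_eq (Real.dist_eq _ _).symm) (le_max_right _ _)) h3
      _ ≤ _ := by rw [← Finset.mul_sum]; gcongr
  have hC' : ENNReal.ofReal C ≠ 0 := by simpa using hC
  simp only [coverEDist, ENNReal.mul_iInf_of_ne hC' ENNReal.ofReal_ne_top]
  exact le_iInf₂ key

theorem edist_polar_le_coverEDist (p q : ℝ × ℝ) :
    edist (polar p) (polar q) ≤ coverEDist R₁ R₂ p q := by
  refine le_iInf₂ fun γ hγ => ?_
  have := eVariationOn.edist_le (fun t => polar (γ t)) (s := Icc (0 : ℝ) 1) (x := 0) (y := 1)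
    (by simp) (by simp)
  simpa [hγ.source, hγ.target] using this

/-- The coordinate segment joining two points of the cover bounds their distance. -/
theorem coverEDist_le (hR₁ : 0 < R₁) {p q : ℝ × ℝ} (hp : p ∈ closedCover R₁ R₂)
    (hq : q ∈ closedCover R₁ R₂) :
    coverEDist R₁ R₂ p q
      ≤ ENNReal.ofReal √((p.1 - q.1) ^ 2 + (max p.1 q.1) ^ 2 * (p.2 - q.2) ^ 2) := by
  obtain ⟨a, s⟩ := p
  obtain ⟨b, t⟩ := q
  simp only [closedCover, mem_ofPred_eq] at hp hq
  set D := √((a - b) ^ 2 + (max a b) ^ 2 * (s - t) ^ 2) with hD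
  have hD0 : 0 ≤ D := Real.sqrt_nonneg _
  let γ : ℝ → ℝ × ℝ := fun τ => (a + τ * (b - a), s + τ * (t - s))
  have hγmem : ∀ τ ∈ Icc (0 : ℝ) 1, R₁ ≤ a + τ * (b - a) ∧ a + τ * (b - a) ≤ R₂ ∧
      a + τ * (b - a) ≤ max a b := by
    intro τ hτ
    obtain ⟨h0, h1⟩ := hτ
    have e : a + τ * (b - a) = (1 - τ) * a + τ * b := by ring
    have h1' : 0 ≤ 1 - τ := by linarith
    rw [e]
    refine ⟨?_, ?_, ?_⟩
    · nlinarith [mul_le_mul_of_nonneg_left hp.1 h1', mul_le_mul_of_nonneg_left hq.1 h0]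
    · nlinarith [mul_le_mul_of_nonneg_left hp.2 h1', mul_le_mul_of_nonneg_left hq.2 h0]
    · nlinarith [mul_le_mul_of_nonneg_left (le_max_left a b) h1',
        mul_le_mul_of_nonneg_left (le_max_right a b) h0]
  have hγ : IsCoverPath R₁ R₂ (a, s) (b, t) γ :=
    ⟨by fun_prop, fun τ hτ => ⟨(hγmem τ hτ).1, (hγmem τ hτ).2.1⟩, by simp [γ], by simp [γ]⟩
  have hlip : LipschitzOnWith D.toNNReal (fun τ => polar (γ τ)) (Icc 0 1) := by
    refine LipschitzOnWith.of_dist_le_mul fun x hx y hy => ?_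
    rw [Real.coe_toNNReal _ hD0, dist_eq_norm, Real.dist_eq]
    refine le_of_sq_le_sq ?_ (by positivity)
    simp only [γ]
    rw [norm_polar_sub_sq, mul_pow, sq_abs, hD, Real.sq_sqrt (by positivity)]
    have hsin : Real.sin ((s + x * (t - s) - (s + y * (t - s))) / 2) ^ 2
        ≤ ((x - y) * (s - t) / 2) ^ 2 := by
      rw [show (s + x * (t - s) - (s + y * (t - s))) / 2 = -((x - y) * (s - t) / 2) by ring,
        Real.sin_neg, neg_sq]
      exact sq_le_sq.2 Real.abs_sin_le_abs
    obtain ⟨h1, _, h2⟩ := hγmem x hx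
    obtain ⟨h3, _, h4⟩ := hγmem y hy
    have hm0 : 0 ≤ max a b := le_max_of_le_left (by linarith [hp.1])
    have hM : (a + x * (b - a)) * (a + y * (b - a)) ≤ max a b * max a b := by
      gcongr
      linarith
    have hpos : 0 ≤ (a + x * (b - a)) * (a + y * (b - a)) :=
      mul_nonneg (by linarith) (by linarith)
    have := mul_le_mul hM hsin (sq_nonneg _) (mul_nonneg hm0 hm0)
    nlinarith
  calc coverEDist R₁ R₂ (a, s) (b, t)
      ≤ eVariationOn (fun τ => polar (γ τ)) (Icc 0 1) := iInf₂_le γ hγ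
    _ ≤ (D.toNNReal : ℝ≥0∞) * eVariationOn (id : ℝ → ℝ) (Icc 0 1) :=
        hlip.comp_eVariationOn_le (g := id) (mapsTo_id _)
    _ ≤ (D.toNNReal : ℝ≥0∞) * ENNReal.ofReal (1 - 0) := by
        gcongr
        have := (monotone_id (α := ℝ)).monotoneOn (Icc (0 : ℝ) 1) |>.eVariationOn_eq
          (left_mem_Icc.2 zero_le_one) (right_mem_Icc.2 zero_le_one)
        simp only [inter_self] at this
        exact this.le
    _ = ENNReal.ofReal D := by simp [ENNReal.ofReal]

/-! ### The local Lipschitz constants of a radial map -/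

/-- `φ` is `K`-Lipschitz on a neighbourhood of `x`. -/
def LocLip (φ : ℝ → ℝ) (x K : ℝ) : Prop :=
  ∃ δ > 0, ∀ y ∈ Ioo (x - δ) (x + δ), ∀ z ∈ Ioo (x - δ) (x + δ), |φ y - φ z| ≤ K * |y - z|

theorem LocLip.continuousAt {x K : ℝ} (h : LocLip φ x K) : ContinuousAt φ x := by
  obtain ⟨δ, hδ, h⟩ := h
  have hlip : LipschitzOnWith K.toNNReal φ (Ioo (x - δ) (x + δ)) := by
    refine LipschitzOnWith.of_dist_le_mul fun y hy z hz => ?_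
    rw [Real.dist_eq, Real.dist_eq]
    exact (h y hy z hz).trans (by gcongr; exact Real.le_coe_toNNReal K)
  exact hlip.continuousOn.continuousAt (Ioo_mem_nhds (by linarith) (by linarith))

theorem exists_mul_abs_le_abs_sin {c : ℝ} (hc : c < 1) :
    ∃ η > 0, ∀ y : ℝ, |y| ≤ η → c * |y| ≤ |Real.sin y| := by
  have key : ∃ η > 0, ∀ y : ℝ, 0 < y → y ≤ η → c * y ≤ Real.sin y := by
    refine ⟨min 1 (1 - c), lt_min one_pos (by linarith), fun y h0 h1 => ?_⟩
    have h2 := Real.sin_gt_sub_cube h0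
    have h3 : y ≤ 1 := h1.trans (min_le_left _ _)
    have h4 : y ≤ 1 - c := h1.trans (min_le_right _ _)
    have h5 : y * y ≤ 1 - c := by nlinarith
    nlinarith
  obtain ⟨η, hη, h⟩ := key
  refine ⟨η, hη, fun y hy => ?_⟩
  rcases lt_trichotomy y 0 with h0 | h0 | h0
  · have := h (-y) (by linarith) (by rwa [abs_of_neg h0] at hy)
    rw [Real.sin_neg] at this
    rw [abs_of_neg h0]
    exact this.trans (neg_le_abs _)
  · simp [h0]
  · rw [abs_of_pos h0] at hy ⊢
    exact (h y h0 hy).trans (le_abs_self _)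

/-- A bound `K` on the radial and the tangential stretch bounds the increment between two points. The
tangential bound `M` is compared with `K` through the ratio of an angle to its sine. -/
theorem norm_radial_sub_le {a b r s M K η η' : ℝ} (hα : 0 < α) (ha : 0 ≤ a) (hb : 0 ≤ b)
    (hr : 0 < r) (hs : 0 < s) (hK : 0 ≤ K) (hab : |a - b| ≤ K * |r - s|) (har : α * a ≤ M * r)
    (hbs : α * b ≤ M * s) (hM : M * |(η - η') / 2| ≤ K * |Real.sin ((η - η') / 2)|) :
    ‖polar (a, α * η) - polar (b, α * η')‖ ≤ K * ‖polar (r, η) - polar (s, η')‖ := by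
  have hM0 : 0 ≤ M := by
    by_contra h
    nlinarith [mul_nonneg hα.le ha]
  refine le_of_sq_le_sq ?_ (by positivity)
  rw [mul_pow, norm_polar_sub_sq, norm_polar_sub_sq]
  have h1 : (a - b) ^ 2 ≤ K ^ 2 * (r - s) ^ 2 := by
    rw [← sq_abs (a - b), ← sq_abs (r - s), ← mul_pow]
    gcongr
  have h2 : Real.sin ((α * η - α * η') / 2) ^ 2 ≤ α ^ 2 * ((η - η') / 2) ^ 2 := by
    rw [← mul_pow, show (α * η - α * η') / 2 = α * ((η - η') / 2) by ring]
    exact sq_le_sq.2 Real.abs_sin_le_abs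
  have h3 : M ^ 2 * ((η - η') / 2) ^ 2 ≤ K ^ 2 * Real.sin ((η - η') / 2) ^ 2 := by
    rw [← sq_abs ((η - η') / 2), ← sq_abs (Real.sin _), ← mul_pow, ← mul_pow]
    gcongr
  have h4 : (α * a) * (α * b) ≤ (M * r) * (M * s) := by gcongr
  have h5 : 4 * a * b * Real.sin ((α * η - α * η') / 2) ^ 2
      ≤ 4 * r * s * (K ^ 2 * Real.sin ((η - η') / 2) ^ 2) :=
    calc 4 * a * b * Real.sin ((α * η - α * η') / 2) ^ 2
        ≤ 4 * a * b * (α ^ 2 * ((η - η') / 2) ^ 2) := by gcongr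
      _ = 4 * ((α * a) * (α * b)) * ((η - η') / 2) ^ 2 := by ring
      _ ≤ 4 * ((M * r) * (M * s)) * ((η - η') / 2) ^ 2 := by gcongr
      _ = 4 * r * s * (M ^ 2 * ((η - η') / 2) ^ 2) := by ring
      _ ≤ _ := by gcongr
  nlinarith

theorem ofReal_abs_fst_sub_le {p q : ℝ × ℝ} (hp : 0 ≤ p.1) (hq : 0 ≤ q.1) :
    ENNReal.ofReal |p.1 - q.1| ≤ coverEDist R₁ R₂ p q := by
  refine le_trans ?_ (edist_polar_le_coverEDist p q)
  rw [edist_dist, dist_eq_norm]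
  exact ENNReal.ofReal_le_ofReal (abs_sub_le_norm_polar_sub hp hq _ _)

theorem ofReal_abs_snd_sub_le (hR₁ : 0 < R₁) (p q : ℝ × ℝ) :
    ENNReal.ofReal |p.2 - q.2| ≤ ENNReal.ofReal (Real.pi / (2 * R₁)) * coverEDist R₁ R₂ p q := by
  have hpi := Real.pi_pos
  have := edist_le_mul_coverEDist (R₁ := R₁) (R₂ := R₂) (F := Prod.snd) (η := 1)
    (C := Real.pi / (2 * R₁)) (by positivity) one_pos
    (fun p hp q hq h => by
      rw [Real.dist_eq]; exact abs_angle_sub_le hR₁ hp.1 hq.1 h) p q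
  rwa [edist_dist, Real.dist_eq] at this

/-- Points of a small ball of the cover have coordinates close to those of the centre. -/
theorem exists_ball_coords (hR₁ : 0 < R₁) {ε : ℝ} (hε : 0 < ε) :
    ∃ δ : ℝ≥0∞, 0 < δ ∧ ∀ p q : ℝ × ℝ, 0 ≤ p.1 → 0 ≤ q.1 → coverEDist R₁ R₂ p q < δ →
      |p.1 - q.1| < ε ∧ |p.2 - q.2| < ε := by
  have hpi := Real.pi_pos
  set C := Real.pi / (2 * R₁) with hC
  have hC0 : 0 < C := by positivity
  refine ⟨ENNReal.ofReal (min ε (ε / C)), by simp; exact ⟨hε, by positivity⟩,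
    fun p q hp hq h => ⟨?_, ?_⟩⟩
  · have := lt_of_le_of_lt (ofReal_abs_fst_sub_le hp hq) h
    rw [ENNReal.ofReal_lt_ofReal_iff'] at this
    exact this.1.trans_le (min_le_left _ _)
  · have h1 : ENNReal.ofReal C * coverEDist R₁ R₂ p q < ENNReal.ofReal C *
        ENNReal.ofReal (min ε (ε / C)) :=
      ENNReal.mul_lt_mul_right (by simpa using hC0) ENNReal.ofReal_ne_top h
    have h2 := lt_of_le_of_lt (ofReal_abs_snd_sub_le hR₁ p q) h1
    rw [← ENNReal.ofReal_mul hC0.le, ENNReal.ofReal_lt_ofReal_iff'] at h2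
    refine h2.1.trans_le ?_
    calc C * min ε (ε / C) ≤ C * (ε / C) := by gcongr; exact min_le_right _ _
      _ = ε := by field_simp

/-- The local Lipschitz constant of a radial map is at most the larger of the radial stretch, which
is the local Lipschitz constant of `φ`, and the tangential stretch `α φ(x) / x`. -/
theorem localLip_radialMap_le (hα : 0 < α) (hR₁ : 0 < R₁) (hφ : ∀ r ∈ Icc R₁ R₂, 0 ≤ φ r)
    {x K : ℝ} (hx : x ∈ Ioo R₁ R₂) (θ : ℝ) (hg : α * φ x / x ≤ K)
    (hL : ∀ K' > K, LocLip φ x K') :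
    localLip R₁ R₂ (radialMap α φ) (x, θ) ≤ ENNReal.ofReal K := by
  have hx0 : 0 < x := hR₁.trans hx.1
  have hφx := hφ x (Ioo_subset_Icc_self hx)
  have hK0 : 0 ≤ K := le_trans (by positivity) hg
  refine ENNReal.le_of_forall_pos_le_add fun ε hε _ => ?_
  rw [← ENNReal.ofReal_coe_nnreal, ← ENNReal.ofReal_add hK0 ε.coe_nonneg]
  have hε' : (0 : ℝ) < ε := hε
  set K' : ℝ := K + ε with hK'
  set M : ℝ := K + ε / 2 with hM
  have hM0 : 0 < M := by positivity
  have hMK : M < K' := by rw [hM, hK']; linarith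
  have hK'0 : 0 < K' := hM0.trans hMK
  have hLK := hL K' (by linarith)
  have hcont := hLK.continuousAt
  have hgev : ∀ᶠ r in nhds x, α * φ r < M * r := by
    refine ContinuousAt.eventually_lt (by fun_prop) (by fun_prop) ?_
    rw [div_le_iff₀ hx0] at hg
    nlinarith
  obtain ⟨δ₁, hδ₁, h₁⟩ := Metric.eventually_nhds_iff.1 hgev
  obtain ⟨δ₂, hδ₂, h₂⟩ := hLK
  obtain ⟨η, hη, h₃⟩ := exists_mul_abs_le_abs_sin (c := M / K') ((div_lt_one hK'0).2 hMK)
  obtain ⟨δ, hδ, hball⟩ := exists_ball_coords (R₁ := R₁) (R₂ := R₂) hR₁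
    (ε := min (min δ₁ δ₂) η) (lt_min (lt_min hδ₁ hδ₂) hη)
  refine (iInf₂_le δ hδ).trans (sInf_le ?_)
  rintro ⟨r, a⟩ ⟨hr, hrd⟩ ⟨s, b⟩ ⟨hs, hsd⟩
  simp only [openCover, mem_ofPred_eq] at hr hs hrd hsd
  have hr0 : 0 < r := hR₁.trans hr.1
  have hs0 : 0 < s := hR₁.trans hs.1
  obtain ⟨hr1, hr2⟩ := hball _ _ hx0.le hr0.le hrd
  obtain ⟨hs1, hs2⟩ := hball _ _ hx0.le hs0.le hsd
  simp only [lt_min_iff] at hr1 hr2 hs1 hs2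
  have hmem : ∀ {y}, |x - y| < δ₂ → y ∈ Ioo (x - δ₂) (x + δ₂) := fun {y} hy => by
    rw [abs_lt] at hy; constructor <;> linarith
  have hang : |(a - b) / 2| ≤ η := by
    rw [abs_le]
    have h4 := abs_lt.1 hr2.2
    have h5 := abs_lt.1 hs2.2
    constructor <;> linarith
  have hmain : ‖radialMap α φ (r, a) - radialMap α φ (s, b)‖ ≤ K' * ‖polar (r, a) - polar (s, b)‖ := by
    refine norm_radial_sub_le (M := M) hα (hφ r (Ioo_subset_Icc_self hr))
      (hφ s (Ioo_subset_Icc_self hs)) hr0 hs0 hK'0.le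
      (h₂ r (hmem hr1.1.2) s (hmem hs1.1.2)) (h₁ ?_).le (h₁ ?_).le ?_
    · rw [Real.dist_eq, abs_sub_comm]; exact hr1.1.1
    · rw [Real.dist_eq, abs_sub_comm]; exact hs1.1.1
    · have := mul_le_mul_of_nonneg_left (h₃ _ hang) hK'0.le
      calc M * |(a - b) / 2| = K' * (M / K' * |(a - b) / 2|) := by field_simp
        _ ≤ _ := this
  rw [edist_dist, dist_eq_norm]
  refine (ENNReal.ofReal_le_ofReal hmain).trans ?_
  rw [ENNReal.ofReal_mul hK'0.le]
  gcongr
  refine le_trans ?_ (edist_polar_le_coverEDist _ _)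
  rw [edist_dist, dist_eq_norm]

theorem coverEDist_same_angle_le (hR₁ : 0 < R₁) {y z : ℝ} (hy : y ∈ Icc R₁ R₂)
    (hz : z ∈ Icc R₁ R₂) (θ : ℝ) :
    coverEDist R₁ R₂ (y, θ) (z, θ) ≤ ENNReal.ofReal |y - z| := by
  refine (coverEDist_le hR₁ (p := (y, θ)) (q := (z, θ)) hy hz).trans (le_of_eq ?_)
  simp [Real.sqrt_sq_eq_abs]

theorem coverEDist_same_radius_le (hR₁ : 0 < R₁) {x : ℝ} (hx : x ∈ Icc R₁ R₂) (s t : ℝ) :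
    coverEDist R₁ R₂ (x, s) (x, t) ≤ ENNReal.ofReal (x * |s - t|) := by
  refine (coverEDist_le hR₁ (p := (x, s)) (q := (x, t)) hx hx).trans (le_of_eq ?_)
  have : 0 ≤ x := hR₁.le.trans hx.1
  simp [← mul_pow, Real.sqrt_sq_eq_abs, abs_mul, abs_of_nonneg this]

/-- The local Lipschitz constant of a radial map dominates its radial and its tangential stretch. -/
theorem locLip_and_le_of_localLip_lt (hα : 0 < α) (hR₁ : 0 < R₁)
    (hφ : ∀ r ∈ Icc R₁ R₂, 0 ≤ φ r) {x K : ℝ} (hx : x ∈ Ioo R₁ R₂) {θ : ℝ}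
    (h : localLip R₁ R₂ (radialMap α φ) (x, θ) < ENNReal.ofReal K) :
    LocLip φ x K ∧ α * φ x / x ≤ K := by
  have hx0 : 0 < x := hR₁.trans hx.1
  have hφx := hφ x (Ioo_subset_Icc_self hx)
  have hK0 : 0 < K := by
    by_contra hK
    rw [ENNReal.ofReal_of_nonpos (not_lt.1 hK)] at h
    exact not_lt_bot h
  simp only [localLip, iInf_lt_iff] at h
  obtain ⟨δ, hδ, h⟩ := h
  obtain ⟨K₀, hK₀, hlt⟩ := sInf_lt_iff.1 h
  obtain ⟨ε, hε, hεδ⟩ : ∃ ε : ℝ, 0 < ε ∧ ENNReal.ofReal ε < δ := by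
    obtain ⟨e, he, he'⟩ := ENNReal.lt_iff_exists_nnreal_btwn.1 hδ
    exact ⟨e, by exact_mod_cast he, by simpa using he'⟩
  have hdist : ∀ p ∈ openCover R₁ R₂, ∀ q ∈ openCover R₁ R₂,
      coverEDist R₁ R₂ (x, θ) p ≤ ENNReal.ofReal ε → coverEDist R₁ R₂ (x, θ) q ≤ ENNReal.ofReal ε →
      ∀ D : ℝ, coverEDist R₁ R₂ p q ≤ ENNReal.ofReal D → 0 ≤ D →
      ‖radialMap α φ p - radialMap α φ q‖ ≤ K * D := by
    intro p hp q hq hpε hqε D hD hD0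
    have h1 := hK₀ p ⟨hp, hpε.trans_lt hεδ⟩ q ⟨hq, hqε.trans_lt hεδ⟩
    have h2 : edist (radialMap α φ p) (radialMap α φ q) ≤ ENNReal.ofReal (K * D) := by
      rw [ENNReal.ofReal_mul hK0.le]
      exact h1.trans (by gcongr)
    rw [edist_dist, dist_eq_norm] at h2
    exact (ENNReal.ofReal_le_ofReal_iff (by positivity)).1 h2
  constructor
  · set e := min ε (min (x - R₁) (R₂ - x)) with he
    have hmem : ∀ y ∈ Ioo (x - e) (x + e), y ∈ Ioo R₁ R₂ ∧ |x - y| ≤ ε := by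
      intro y hy
      have h1 : e ≤ ε := min_le_left _ _
      have h2 : e ≤ x - R₁ := (min_le_right _ _).trans (min_le_left _ _)
      have h3 : e ≤ R₂ - x := (min_le_right _ _).trans (min_le_right _ _)
      refine ⟨⟨by linarith [hy.1], by linarith [hy.2]⟩, ?_⟩
      rw [abs_le]
      constructor <;> linarith [hy.1, hy.2]
    refine ⟨e, lt_min hε (lt_min (by linarith [hx.1]) (by linarith [hx.2])), fun y hy z hz => ?_⟩
    obtain ⟨hy, hy'⟩ := hmem y hy
    obtain ⟨hz, hz'⟩ := hmem z hz
    have h1 := hdist (y, θ) hy (z, θ) hz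
      ((coverEDist_same_angle_le hR₁ (Ioo_subset_Icc_self hx) (Ioo_subset_Icc_self hy) θ).trans
        (ENNReal.ofReal_le_ofReal hy'))
      ((coverEDist_same_angle_le hR₁ (Ioo_subset_Icc_self hx) (Ioo_subset_Icc_self hz) θ).trans
        (ENNReal.ofReal_le_ofReal hz')) _
      (coverEDist_same_angle_le hR₁ (Ioo_subset_Icc_self hy) (Ioo_subset_Icc_self hz) θ)
      (abs_nonneg _)
    simpa only [radialMap, norm_polar_sub_same_angle] using h1
  · have hc : ∀ c < 1, c * (α * φ x) ≤ K * x := by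
      intro c hc
      obtain ⟨η, hη, hsin⟩ := exists_mul_abs_le_abs_sin hc
      set t := min (ε / x) (2 * η / α) with ht
      have ht0 : 0 < t := lt_min (by positivity) (by positivity)
      have ht1 : x * t ≤ ε := by
        calc x * t ≤ x * (ε / x) := by gcongr; exact min_le_left _ _
          _ = ε := by field_simp
      have ht2 : α * t / 2 ≤ η := by
        calc α * t / 2 ≤ α * (2 * η / α) / 2 := by gcongr; exact min_le_right _ _
          _ = η := by field_simp
      have hxI := Ioo_subset_Icc_self hx
      have h1 := hdist (x, θ + t) hx (x, θ) hx
        ((coverEDist_same_radius_le hR₁ hxI _ _).trans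
          (ENNReal.ofReal_le_ofReal (by simpa [abs_of_pos ht0] using ht1)))
        ((coverEDist_same_radius_le hR₁ hxI _ _).trans
          (ENNReal.ofReal_le_ofReal (by simpa using hε.le))) _
        (coverEDist_same_radius_le hR₁ hxI _ _) (by positivity)
      simp only [radialMap] at h1
      rw [norm_polar_sub_same_radius hφx,
        show (α * (θ + t) - α * θ) / 2 = α * t / 2 by ring,
        show |θ + t - θ| = t by simp [abs_of_pos ht0]] at h1
      have h2 := hsin (α * t / 2) (by rwa [abs_of_pos (by positivity)])
      rw [abs_of_pos (a := α * t / 2) (by positivity)] at h2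
      have h3 := mul_le_mul_of_nonneg_left h2 (a := 2 * φ x) (by positivity)
      have h4 : t * (c * (α * φ x)) ≤ t * (K * x) := by nlinarith
      exact le_of_mul_le_mul_left h4 ht0
    rw [div_le_iff₀ hx0]
    by_contra hcon
    push Not at hcon
    have hpos : 0 < α * φ x := lt_of_le_of_lt (by positivity) hcon
    obtain ⟨c, hc1, hc2⟩ := exists_between ((div_lt_one hpos).2 hcon)
    have := hc c hc2
    rw [div_lt_iff₀ hpos] at hc1
    linarith

theorem ofReal_le_localLip_of_not_locLip (hα : 0 < α) (hR₁ : 0 < R₁)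
    (hφ : ∀ r ∈ Icc R₁ R₂, 0 ≤ φ r) {x K : ℝ} (hx : x ∈ Ioo R₁ R₂) (θ : ℝ) (h : ¬ LocLip φ x K) :
    ENNReal.ofReal K ≤ localLip R₁ R₂ (radialMap α φ) (x, θ) := by
  by_contra hlt
  exact h (locLip_and_le_of_localLip_lt hα hR₁ hφ hx (not_le.1 hlt)).1

theorem ofReal_tangential_le_localLip (hα : 0 < α) (hR₁ : 0 < R₁)
    (hφ : ∀ r ∈ Icc R₁ R₂, 0 ≤ φ r) {x : ℝ} (hx : x ∈ Ioo R₁ R₂) (θ : ℝ) :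
    ENNReal.ofReal (α * φ x / x) ≤ localLip R₁ R₂ (radialMap α φ) (x, θ) := by
  by_contra hlt
  obtain ⟨K, -, h1, h2⟩ := ENNReal.lt_iff_exists_real_btwn.1 (not_le.1 hlt)
  have := (locLip_and_le_of_localLip_lt hα hR₁ hφ hx h1).2
  exact absurd (ENNReal.ofReal_le_ofReal this) (not_le.2 h2)

theorem isPeriodicLipschitz_radialMap (hα : 0 < α) (hR₁ : 0 < R₁) (hR : R₁ ≤ R₂)
    (hφ : ∀ r ∈ Icc R₁ R₂, 0 ≤ φ r) {K : ℝ}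
    (hK : ∀ r ∈ Icc R₁ R₂, ∀ s ∈ Icc R₁ R₂, |φ r - φ s| ≤ K * |r - s|) :
    IsPeriodicLipschitz α R₁ R₂ (radialMap α φ) := by
  have hpi := Real.pi_pos
  refine ⟨fun r _ θ => ?_, ?_⟩
  · simp only [radialMap, polar]
    rw [show α * (θ + 2 * Real.pi / α) = α * θ + 2 * Real.pi by field_simp, Real.cos_add_two_pi,
      Real.sin_add_two_pi]
  · set B := φ R₁ + |K| * (R₂ - R₁) with hB
    have hB0 : 0 ≤ B := by
      have := hφ R₁ ⟨le_rfl, hR⟩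
      have : 0 ≤ R₂ - R₁ := by linarith
      positivity
    have hφB : ∀ r ∈ Icc R₁ R₂, φ r ≤ B := by
      intro r hr
      have h1 := hK r hr R₁ ⟨le_rfl, hR⟩
      have h2 : |r - R₁| ≤ R₂ - R₁ := by
        rw [abs_of_nonneg (by linarith [hr.1])]; linarith [hr.2]
      have h3 : K * |r - R₁| ≤ |K| * (R₂ - R₁) :=
        mul_le_mul (le_abs_self _) h2 (abs_nonneg _) (abs_nonneg _)
      have := le_abs_self (φ r - φ R₁)
      linarith
    set M := α * B / R₁ with hM
    have hM0 : 0 ≤ M := by positivity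
    have hMr : ∀ r ∈ Icc R₁ R₂, α * φ r ≤ M * r := by
      intro r hr
      calc α * φ r ≤ α * B := by gcongr; exact hφB r hr
        _ = M * R₁ := by rw [hM]; field_simp
        _ ≤ M * r := by gcongr; exact hr.1
    set C := |K| + M * Real.pi / 2 + 1 with hC
    have hC0 : 0 < C := by positivity
    refine ⟨C.toNNReal, fun p _ q _ => ?_⟩
    exact edist_le_mul_coverEDist (R₁ := R₁) (R₂ := R₂) (F := radialMap α φ) hC0 one_pos
      (fun p hp q hq h => by
        rw [dist_eq_norm]
        refine norm_radial_sub_le (M := M) hα (hφ _ hp) (hφ _ hq) (hR₁.trans_le hp.1)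
          (hR₁.trans_le hq.1) hC0.le ((hK _ hp _ hq).trans ?_) (hMr _ hp) (hMr _ hq) ?_
        · gcongr
          have : 0 ≤ M * Real.pi / 2 := by positivity
          linarith [le_abs_self K]
        · have h1 : 2 / Real.pi * |(p.2 - q.2) / 2| ≤ |Real.sin ((p.2 - q.2) / 2)| := by
            apply Real.mul_abs_le_abs_sin
            rw [abs_div, abs_two]
            have := Real.pi_gt_three
            linarith
          calc M * |(p.2 - q.2) / 2|
              = M * Real.pi / 2 * (2 / Real.pi * |(p.2 - q.2) / 2|) := by field_simp
            _ ≤ C * |Real.sin ((p.2 - q.2) / 2)| := by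
                gcongr
                linarith [abs_nonneg K]) p q

theorem IsPeriodicLipschitz.exists_lipschitz_radial (hR₁ : 0 < R₁)
    (h : IsPeriodicLipschitz α R₁ R₂ (radialMap α φ)) :
    ∃ K : ℝ, 0 ≤ K ∧ ∀ r ∈ Icc R₁ R₂, ∀ s ∈ Icc R₁ R₂, |φ r - φ s| ≤ K * |r - s| := by
  obtain ⟨K, hK⟩ := h.lipschitz
  refine ⟨K, K.coe_nonneg, fun r hr s hs => ?_⟩
  have h1 := (hK (r, 0) hr (s, 0) hs).trans
    (mul_le_mul_right (coverEDist_same_angle_le hR₁ hr hs 0) _)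
  rw [edist_dist, dist_eq_norm, ← ENNReal.ofReal_coe_nnreal, ← ENNReal.ofReal_mul K.coe_nonneg,
    ENNReal.ofReal_le_ofReal_iff (by positivity)] at h1
  simpa only [radialMap, norm_polar_sub_same_angle] using h1

/-! ### The local Lipschitz constant as an upper gradient -/

open Filter Topology in
/-- A continuous map whose upper right difference quotients are at most `K` is `K`-Lipschitz. -/
theorem norm_sub_le_of_eventually {E : Type*} [NormedAddCommGroup E] {f : ℝ → E} {a b K : ℝ}
    (hab : a ≤ b) (hf : ContinuousOn f (Icc a b))
    (h : ∀ x ∈ Ioo a b, ∀ K' > K, ∀ᶠ z in 𝓝[>] x, ‖f z - f x‖ ≤ K' * (z - x)) :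
    ‖f b - f a‖ ≤ K * (b - a) := by
  rcases hab.eq_or_lt with rfl | hab
  · simp
  have key : ∀ a' ∈ Ioo a b, ‖f b - f a'‖ ≤ K * (b - a') := by
    intro a' ha'
    have hsub : Icc a' b ⊆ Icc a b := Icc_subset_Icc_left ha'.1.le
    refine image_le_of_liminf_slope_right_le_deriv_boundary (f := fun x => ‖f x - f a'‖)
      (B := fun x => K * (x - a')) (B' := fun _ => K) (a := a') (b := b)
      ((hf.mono hsub).sub continuousOn_const).norm (by simp) (by fun_prop) (fun x _ => ?_)
      (fun x hx r hr => ?_) (right_mem_Icc.2 ha'.2.le)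
    · simpa using (((hasDerivAt_id x).sub_const a').const_mul K).hasDerivWithinAt
    · obtain ⟨r', hr', hr''⟩ := exists_between hr
      refine Eventually.frequently ?_
      filter_upwards [h x ⟨ha'.1.trans_le hx.1, hx.2⟩ r' hr', self_mem_nhdsWithin] with z hz hxz
      have hxz' : 0 < z - x := sub_pos.2 hxz
      rw [slope_def_field, div_lt_iff₀ hxz']
      have h1 : ‖f z - f a'‖ ≤ ‖f z - f x‖ + ‖f x - f a'‖ := norm_sub_le_norm_sub_add_norm_sub ..
      nlinarith
  have ht : Tendsto (fun a' => ‖f b - f a'‖) (𝓝[Ioo a b] a) (𝓝 ‖f b - f a‖) :=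
    (tendsto_const_nhds.sub ((hf a (left_mem_Icc.2 hab.le)).mono Ioo_subset_Icc_self)).norm
  have ht' : Tendsto (fun a' => K * (b - a')) (𝓝[Ioo a b] a) (𝓝 (K * (b - a))) :=
    (Continuous.tendsto (by fun_prop) a).mono_left nhdsWithin_le_nhds
  have : (𝓝[Ioo a b] a).NeBot := left_nhdsWithin_Ioo_neBot hab
  exact le_of_tendsto_of_tendsto ht ht' (eventually_mem_nhdsWithin.mono key)

/-- A function which is locally `K'`-Lipschitz for all `K' > K` is `K`-Lipschitz. -/
theorem abs_sub_le_of_locLip {a b K : ℝ} (hf : ContinuousOn φ (Icc a b))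
    (h : ∀ x ∈ Ioo a b, ∀ K' > K, LocLip φ x K') :
    ∀ y ∈ Icc a b, ∀ z ∈ Icc a b, |φ y - φ z| ≤ K * |y - z| := by
  have key : ∀ y ∈ Icc a b, ∀ z ∈ Icc a b, y ≤ z → |φ y - φ z| ≤ K * |y - z| := by
    intro y hy z hz hyz
    rw [abs_sub_comm, abs_sub_comm y, abs_of_nonneg (sub_nonneg.2 hyz), ← Real.norm_eq_abs]
    refine norm_sub_le_of_eventually hyz (hf.mono (Icc_subset_Icc hy.1 hz.2)) ?_
    intro x hx K' hK'
    obtain ⟨δ, hδ, hL⟩ := h x ⟨hy.1.trans_lt hx.1, hx.2.trans_le hz.2⟩ K' hK'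
    filter_upwards [Ioo_mem_nhdsGT (show x < x + δ by linarith)] with w hw
    have := hL w ⟨by linarith [hw.1], hw.2⟩ x ⟨by linarith, by linarith⟩
    rwa [abs_of_pos (sub_pos.2 hw.1)] at this
  intro y hy z hz
  rcases le_total y z with h1 | h1
  · exact key y hy z hz h1
  · rw [abs_sub_comm, abs_sub_comm y]
    exact key z hz y hy h1

open Filter Topology in
theorem tendsto_coordDist {ι : Type*} {l : Filter ι} {r θ : ι → ℝ} {r₀ θ₀ : ℝ}
    (hr : Tendsto r l (𝓝 r₀)) (hθ : Tendsto θ l (𝓝 θ₀)) :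
    Tendsto (fun i => √((r₀ - r i) ^ 2 + (max r₀ (r i)) ^ 2 * (θ₀ - θ i) ^ 2)) l (𝓝 0) := by
  have h1 : Tendsto (fun i => (r₀ - r i) ^ 2 + (max r₀ (r i)) ^ 2 * (θ₀ - θ i) ^ 2) l
      (𝓝 ((r₀ - r₀) ^ 2 + (max r₀ r₀) ^ 2 * (θ₀ - θ₀) ^ 2)) :=
    ((tendsto_const_nhds.sub hr).pow 2).add
      (((tendsto_const_nhds.max hr).pow 2).mul ((tendsto_const_nhds.sub hθ).pow 2))
  have h2 := (Real.continuous_sqrt.tendsto _).comp h1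
  simp only [sub_self, ne_eq, OfNat.ofNat_ne_zero, not_false_eq_true, zero_pow, mul_zero, add_zero,
    Real.sqrt_zero] at h2
  exact h2

open Filter Topology in
theorem IsPeriodicLipschitz.continuousOn {v : ℝ × ℝ → ℂ} (hR₁ : 0 < R₁)
    (hv : IsPeriodicLipschitz α R₁ R₂ v) : ContinuousOn v (closedCover R₁ R₂) := by
  obtain ⟨K, hK⟩ := hv.lipschitz
  intro p hp
  have h0 : Tendsto (fun q : ℝ × ℝ => (K : ℝ) *
      √((p.1 - q.1) ^ 2 + (max p.1 q.1) ^ 2 * (p.2 - q.2) ^ 2)) (𝓝[closedCover R₁ R₂] p) (𝓝 0) := by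
    have := (tendsto_coordDist (continuous_fst.tendsto p) (continuous_snd.tendsto p)).const_mul
      (K : ℝ)
    rw [mul_zero] at this
    exact this.mono_left nhdsWithin_le_nhds
  refine tendsto_iff_dist_tendsto_zero.2 (squeeze_zero' (Eventually.of_forall fun _ => dist_nonneg)
    ?_ h0)
  filter_upwards [self_mem_nhdsWithin] with q hq
  have h1 := (hK p hp q hq).trans (mul_le_mul_right (coverEDist_le hR₁ hp hq) _)
  rw [edist_dist, ← ENNReal.ofReal_coe_nnreal, ← ENNReal.ofReal_mul K.coe_nonneg,
    ENNReal.ofReal_le_ofReal_iff (by positivity)] at h1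
  rwa [dist_comm]

open Filter Topology in
/-- The local Lipschitz constant is an upper gradient: it bounds the growth of a map along curves. -/
theorem norm_comp_curve_sub_le {v : ℝ × ℝ → ℂ} (hR₁ : 0 < R₁) (hv : IsPeriodicLipschitz α R₁ R₂ v)
    {r θ r' θ' ℓ : ℝ → ℝ} {a b K : ℝ} (hab : a ≤ b) (hrc : ContinuousOn r (Icc a b))
    (hθc : ContinuousOn θ (Icc a b)) (hr : ∀ t ∈ Icc a b, r t ∈ Icc R₁ R₂)
    (hro : ∀ t ∈ Ioo a b, r t ∈ Ioo R₁ R₂) (hr' : ∀ t ∈ Ioo a b, HasDerivAt r (r' t) t)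
    (hθ' : ∀ t ∈ Ioo a b, HasDerivAt θ (θ' t) t)
    (hℓ : ∀ t ∈ Ioo a b, localLip R₁ R₂ v (r t, θ t) ≤ ENNReal.ofReal (ℓ t))
    (hℓ0 : ∀ t ∈ Ioo a b, 0 ≤ ℓ t)
    (hK : ∀ t ∈ Ioo a b, ℓ t * √((r' t) ^ 2 + (r t) ^ 2 * (θ' t) ^ 2) ≤ K) :
    ‖v (r b, θ b) - v (r a, θ a)‖ ≤ K * (b - a) := by
  refine norm_sub_le_of_eventually (f := fun t => v (r t, θ t)) hab
    ((hv.continuousOn hR₁).comp (hrc.prodMk hθc) hr) ?_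
  intro t ht K' hK'
  set n := √((r' t) ^ 2 + (r t) ^ 2 * (θ' t) ^ 2) with hn
  have hn0 : 0 ≤ n := Real.sqrt_nonneg _
  have hlt : ℓ t * n < K' := (hK t ht).trans_lt hK'
  obtain ⟨ℓ', hℓ', hℓ'n⟩ : ∃ ℓ', ℓ t < ℓ' ∧ ℓ' * n < K' := by
    have hc : ContinuousAt (fun x => x * n) (ℓ t) := by fun_prop
    have he := (hc.eventually_lt continuousAt_const hlt).filter_mono (nhdsWithin_le_nhds (s := Ioi (ℓ t)))
    obtain ⟨x, hx, hx'⟩ := (he.and self_mem_nhdsWithin).exists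
    exact ⟨x, hx', hx⟩
  have hℓ'0 : 0 < ℓ' := (hℓ0 t ht).trans_lt hℓ'
  have hloc : localLip R₁ R₂ v (r t, θ t) < ENNReal.ofReal ℓ' :=
    (hℓ t ht).trans_lt ((ENNReal.ofReal_lt_ofReal_iff hℓ'0).2 hℓ')
  simp only [localLip, iInf_lt_iff] at hloc
  obtain ⟨δ, hδ, hloc⟩ := hloc
  obtain ⟨K₀, hK₀, hlt₀⟩ := sInf_lt_iff.1 hloc
  have htr : Tendsto r (𝓝[>] t) (𝓝 (r t)) := (hr' t ht).continuousAt.tendsto.mono_left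
    nhdsWithin_le_nhds
  have htθ : Tendsto θ (𝓝[>] t) (𝓝 (θ t)) := (hθ' t ht).continuousAt.tendsto.mono_left
    nhdsWithin_le_nhds
  have hball : ∀ᶠ z in 𝓝[>] t, ENNReal.ofReal
      √((r t - r z) ^ 2 + (max (r t) (r z)) ^ 2 * (θ t - θ z) ^ 2) < δ := by
    have h1 := (ENNReal.continuous_ofReal.tendsto _).comp (tendsto_coordDist htr htθ)
    rw [ENNReal.ofReal_zero] at h1
    exact h1.eventually_lt_const hδ
  have hsr := (hasDerivAt_iff_tendsto_slope.1 (hr' t ht)).mono_left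
    (nhdsWithin_mono t (s := Ioi t) (fun z (hz : t < z) => hz.ne'))
  have hsθ := (hasDerivAt_iff_tendsto_slope.1 (hθ' t ht)).mono_left
    (nhdsWithin_mono t (s := Ioi t) (fun z (hz : t < z) => hz.ne'))
  have hquot : ∀ᶠ z in 𝓝[>] t,
      ℓ' * √((slope r t z) ^ 2 + (max (r t) (r z)) ^ 2 * (slope θ t z) ^ 2) < K' := by
    have h1 : Tendsto (fun z => (slope r t z) ^ 2 + (max (r t) (r z)) ^ 2 * (slope θ t z) ^ 2)
        (𝓝[>] t) (𝓝 ((r' t) ^ 2 + (max (r t) (r t)) ^ 2 * (θ' t) ^ 2)) :=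
      (hsr.pow 2).add (((tendsto_const_nhds.max htr).pow 2).mul (hsθ.pow 2))
    rw [max_self] at h1
    have h2 := ((Real.continuous_sqrt.tendsto _).comp h1).const_mul ℓ'
    exact h2.eventually_lt_const hℓ'n
  have hopen : ∀ᶠ z in 𝓝[>] t, r z ∈ Ioo R₁ R₂ :=
    htr.eventually (Ioo_mem_nhds (hro t ht).1 (hro t ht).2)
  filter_upwards [hball, hquot, hopen, self_mem_nhdsWithin] with z hz1 hz2 hz3 hz4
  have hzt : 0 < z - t := sub_pos.2 hz4
  have hct : coverEDist R₁ R₂ (r t, θ t) (r z, θ z) ≤ _ :=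
    coverEDist_le hR₁ (p := (r t, θ t)) (q := (r z, θ z)) (Ioo_subset_Icc_self (hro t ht))
      (Ioo_subset_Icc_self hz3)
  have hself : coverEDist R₁ R₂ (r t, θ t) (r t, θ t) < δ := by
    refine lt_of_le_of_lt (coverEDist_le hR₁ (p := (r t, θ t)) (q := (r t, θ t))
      (Ioo_subset_Icc_self (hro t ht)) (Ioo_subset_Icc_self (hro t ht))) ?_
    simpa using hδ
  have h1 := hK₀ (r t, θ t) ⟨hro t ht, hself⟩ (r z, θ z) ⟨hz3, hct.trans_lt hz1⟩
  have h2 : edist (v (r t, θ t)) (v (r z, θ z)) ≤ ENNReal.ofReal ℓ' * ENNReal.ofReal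
      √((r t - r z) ^ 2 + (max (r t) (r z)) ^ 2 * (θ t - θ z) ^ 2) :=
    h1.trans (mul_le_mul' hlt₀.le hct)
  rw [edist_comm, edist_dist, dist_eq_norm, ← ENNReal.ofReal_mul hℓ'0.le,
    ENNReal.ofReal_le_ofReal_iff (by positivity)] at h2
  refine h2.trans ?_
  have h3 : √((r t - r z) ^ 2 + (max (r t) (r z)) ^ 2 * (θ t - θ z) ^ 2)
      = √((slope r t z) ^ 2 + (max (r t) (r z)) ^ 2 * (slope θ t z) ^ 2) * (z - t) := by
    rw [← Real.sqrt_sq hzt.le, ← Real.sqrt_mul' _ (by positivity)]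
    congr 1
    rw [slope_def_field, slope_def_field]
    field_simp
    ring
  rw [h3, ← mul_assoc]
  gcongr

theorem localLip_le_of_eq {u v : ℝ × ℝ → ℂ} (hR₁ : 0 < R₁) {p : ℝ × ℝ} {ε : ℝ} (hε : 0 < ε)
    (hp : 0 ≤ p.1) (h : ∀ q ∈ openCover R₁ R₂, |p.1 - q.1| < ε → v q = u q) :
    localLip R₁ R₂ v p ≤ localLip R₁ R₂ u p := by
  obtain ⟨δ₀, hδ₀, hball⟩ := exists_ball_coords (R₁ := R₁) (R₂ := R₂) hR₁ hε
  refine le_iInf₂ fun δ hδ => (iInf₂_le (min δ δ₀) (lt_min hδ hδ₀)).trans ?_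
  refine sInf_le_sInf fun K hK q hq q' hq' => ?_
  have e : ∀ q ∈ openCover R₁ R₂ ∩ {q | coverEDist R₁ R₂ p q < min δ δ₀}, v q = u q := by
    intro q hq
    exact h q hq.1 (hball p q hp (hR₁.trans hq.1.1).le (lt_of_lt_of_le hq.2 (min_le_right _ _))).1
  rw [e q hq, e q' hq']
  have hlt : coverEDist R₁ R₂ p q < min δ δ₀ := hq.2
  have hlt' : coverEDist R₁ R₂ p q' < min δ δ₀ := hq'.2
  exact hK q ⟨hq.1, hlt.trans_le (min_le_left _ _)⟩ q' ⟨hq'.1, hlt'.trans_le (min_le_left _ _)⟩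

/-- A point whose distances to the ends of a segment are at most half its length is the midpoint. -/
theorem eq_of_two_mul_eq_add {z p q m : ℂ} {T : ℝ} (hT : 0 ≤ T) (hp : ‖p - z‖ ≤ T)
    (hq : ‖q - z‖ ≤ T) (hpq : ‖p - q‖ = 2 * T) (hm : p + q = 2 * m) : z = m := by
  have h := parallelogram_law_with_norm ℝ (p - z) (q - z)
  have e1 : p - z + (q - z) = 2 * (m - z) := by linear_combination hm
  have e2 : p - z - (q - z) = p - q := by ring
  rw [e1, e2, hpq, norm_mul, Complex.norm_ofNat] at h
  have h1 : ‖m - z‖ * ‖m - z‖ ≤ 0 := by nlinarith [norm_nonneg (p - z), norm_nonneg (q - z)]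
  have h2 : ‖m - z‖ = 0 := by nlinarith [norm_nonneg (m - z)]
  exact (sub_eq_zero.1 (norm_eq_zero.1 h2)).symm

/-! ### Rigidity on power and affine parts -/

/-- The half-chord estimate. The point of the image chord at distance `t` from its midpoint, which
lies at distance `d = k r₀ ^ β` from the origin, has modulus `√(d² + t²)` and argument
`α θ₀ + σ arctan (t / d)`, where `σ = ± 1` selects the half; the curve is its preimage. -/
theorem IsPeriodicLipschitz.norm_sub_le_chord {v : ℝ × ℝ → ℂ} (hα : 0 < α) (hR₁ : 0 < R₁)
    (hv : IsPeriodicLipschitz α R₁ R₂ v) {k β r₀ e θ₀ σ : ℝ} (hβ : β ^ 2 = α ^ 2) (hσ : σ ^ 2 = 1)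
    (hk : 0 < k) (hr₀ : 0 < r₀) (he : e ∈ Icc R₁ R₂) (hle : k * r₀ ^ β < k * e ^ β)
    (H : ∀ r > 0, k * r₀ ^ β ≤ k * r ^ β → k * r ^ β < k * e ^ β → r ∈ Ioo R₁ R₂ ∧
      ∀ θ, localLip R₁ R₂ v (r, θ) ≤ ENNReal.ofReal (α * (k * r ^ β) / r)) :
    ‖v (e, θ₀ + σ * Real.arctan (√((k * e ^ β) ^ 2 - (k * r₀ ^ β) ^ 2) / (k * r₀ ^ β)) / α)
      - v (r₀, θ₀)‖ ≤ √((k * e ^ β) ^ 2 - (k * r₀ ^ β) ^ 2) := by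
  have he0 : 0 < e := hR₁.trans_le he.1
  have hβ0 : β ≠ 0 := by
    rintro rfl
    have : 0 < α ^ 2 := by positivity
    norm_num at hβ
    exact this.ne hβ
  set d := k * r₀ ^ β with hd
  set ρ := k * e ^ β with hρ
  have hd0 : 0 < d := by positivity
  have hdρ : d ^ 2 < ρ ^ 2 := by gcongr
  set T := √(ρ ^ 2 - d ^ 2) with hT
  have hT2 : T ^ 2 = ρ ^ 2 - d ^ 2 := Real.sq_sqrt (by linarith)
  have hT0 : 0 < T := Real.sqrt_pos.2 (by linarith)
  let X : ℝ → ℝ := fun t => (d ^ 2 + t ^ 2) / k ^ 2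
  have hX0 : ∀ t, 0 < X t := fun t => by positivity
  let r : ℝ → ℝ := fun t => X t ^ (1 / (2 * β))
  have hr0 : ∀ t, 0 < r t := fun t => Real.rpow_pos_of_pos (hX0 t) _
  have hkr : ∀ t, k * r t ^ β = √(d ^ 2 + t ^ 2) := by
    intro t
    simp only [r]
    rw [← Real.rpow_mul (hX0 t).le, show 1 / (2 * β) * β = 1 / 2 by field_simp, ← Real.sqrt_eq_rpow,
      Real.sqrt_div' _ (by positivity), Real.sqrt_sq hk.le]
    field_simp
  have hrpow : ∀ {x y : ℝ}, 0 < x → 0 < y → k * x ^ β = k * y ^ β → x = y := by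
    intro x y hx hy hxy
    have h1 := mul_left_cancel₀ hk.ne' hxy
    exact (Real.rpow_left_inj hx.le hy.le hβ0).1 h1
  have hrz : r 0 = r₀ := by
    apply hrpow (hr0 0) hr₀
    rw [hkr, ← hd]
    simp [Real.sqrt_sq hd0.le]
  have hrT : r T = e := by
    apply hrpow (hr0 T) he0
    rw [hkr, ← hρ, hT2, add_sub_cancel, Real.sqrt_sq (hd0.trans hle).le]
  let θ : ℝ → ℝ := fun t => θ₀ + σ * Real.arctan (t / d) / α
  have hrd : ∀ t, HasDerivAt r (r t * t / (β * (d ^ 2 + t ^ 2))) t := by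
    intro t
    have h1 : HasDerivAt X (2 * t / k ^ 2) t := by
      have := (((hasDerivAt_id t).pow 2).const_add (d ^ 2)).div_const (k ^ 2)
      simpa using this
    have h2 := h1.rpow_const (p := 1 / (2 * β)) (Or.inl (hX0 t).ne')
    rw [Real.rpow_sub_one (hX0 t).ne'] at h2
    convert h2 using 1
    simp only [r, X]
    field_simp
  have hθd : ∀ t, HasDerivAt θ (σ * d / (α * (d ^ 2 + t ^ 2))) t := by
    intro t
    have h1 := ((((hasDerivAt_id t).div_const d).arctan.const_mul σ).div_const α).const_add θ₀
    refine HasDerivAt.congr_deriv (f := θ) h1 ?_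
    simp only [id]
    field_simp
  have hrange : ∀ t ∈ Ico 0 T, k * r₀ ^ β ≤ k * r t ^ β ∧ k * r t ^ β < k * e ^ β := by
    intro t ht
    rw [hkr, ← hd, ← hρ]
    constructor
    · exact Real.le_sqrt_of_sq_le (by nlinarith)
    · rw [Real.sqrt_lt' (hd0.trans hle)]
      nlinarith [ht.1, ht.2]
  have hmem : ∀ t ∈ Ico 0 T, r t ∈ Ioo R₁ R₂ := fun t ht =>
    (H (r t) (hr0 t) (hrange t ht).1 (hrange t ht).2).1
  have hmain := norm_comp_curve_sub_le (α := α) hR₁ hv (r := r) (θ := θ) (a := 0) (b := T) (K := 1)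
    (r' := fun t => r t * t / (β * (d ^ 2 + t ^ 2))) (θ' := fun t => σ * d / (α * (d ^ 2 + t ^ 2)))
    (ℓ := fun t => α * (k * r t ^ β) / r t) hT0.le
    (fun t _ => (hrd t).continuousAt.continuousWithinAt)
    (fun t _ => (hθd t).continuousAt.continuousWithinAt)
    (fun t ht => by
      rcases ht.2.lt_or_eq with h | h
      · exact Ioo_subset_Icc_self (hmem t ⟨ht.1, h⟩)
      · rw [h, hrT]; exact he)
    (fun t ht => hmem t ⟨ht.1.le, ht.2⟩) (fun t _ => hrd t) (fun t _ => hθd t)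
    (fun t ht => (H (r t) (hr0 t) (hrange t ⟨ht.1.le, ht.2⟩).1 (hrange t ⟨ht.1.le, ht.2⟩).2).2 _)
    (fun t _ => by have := hr0 t; positivity)
    (fun t _ => by
      have h0 := hr0 t
      have hs : 0 < d ^ 2 + t ^ 2 := by positivity
      have e1 : (r t * t / (β * (d ^ 2 + t ^ 2))) ^ 2
          + r t ^ 2 * (σ * d / (α * (d ^ 2 + t ^ 2))) ^ 2
          = (r t / α) ^ 2 / (d ^ 2 + t ^ 2) := by
        rw [div_pow, div_pow, mul_pow β, hβ, mul_pow σ, hσ]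
        field_simp
        ring
      rw [e1, hkr, Real.sqrt_div (by positivity), Real.sqrt_sq (by positivity)]
      have : 0 < √(d ^ 2 + t ^ 2) := Real.sqrt_pos.2 hs
      apply le_of_eq
      field_simp)
  simp only [hrT, hrz] at hmain
  simpa [θ] using hmain

/-- Where `φ(r) = k r ^ (± α)` the radial map is conformal, so the preimage of a straight chord
of the image annulus is a curve whose length, weighted by the stretch of the map, equals the length
of the chord. A map with no larger local Lipschitz constants which agrees with the radial map at
the two ends of the chord, on the circle `r = e` mapped to the outer boundary of the image,
agrees with it at the midpoint of the chord. -/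
theorem IsPeriodicLipschitz.eq_of_localLip_le_power {v : ℝ × ℝ → ℂ} (hα : 0 < α) (hR₁ : 0 < R₁)
    (hv : IsPeriodicLipschitz α R₁ R₂ v) {k β r₀ e : ℝ} (hβ : β ^ 2 = α ^ 2)
    (hk : 0 < k) (hr₀ : 0 < r₀) (he : e ∈ Icc R₁ R₂) (hle : k * r₀ ^ β < k * e ^ β)
    (H : ∀ r > 0, k * r₀ ^ β ≤ k * r ^ β → k * r ^ β < k * e ^ β → r ∈ Ioo R₁ R₂ ∧
      ∀ θ, localLip R₁ R₂ v (r, θ) ≤ ENNReal.ofReal (α * (k * r ^ β) / r))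
    (hve : ∀ θ, v (e, θ) = polar (k * e ^ β, α * θ)) (θ₀ : ℝ) :
    v (r₀, θ₀) = polar (k * r₀ ^ β, α * θ₀) := by
  have he0 : 0 < e := hR₁.trans_le he.1
  have h1 := hv.norm_sub_le_chord hα hR₁ (θ₀ := θ₀) (σ := 1) hβ (by norm_num) hk hr₀ he hle H
  have h2 := hv.norm_sub_le_chord hα hR₁ (θ₀ := θ₀) (σ := -1) hβ (by norm_num) hk hr₀ he hle H
  rw [hve] at h1 h2
  have hd0 : 0 < k * r₀ ^ β := by positivity
  have hρ0 : 0 < k * e ^ β := by positivity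
  set d := k * r₀ ^ β with hd
  set ρ := k * e ^ β with hρ
  set T := √(ρ ^ 2 - d ^ 2) with hT
  have hT2 : T ^ 2 = ρ ^ 2 - d ^ 2 := Real.sq_sqrt (by nlinarith)
  have hs : √(1 + (T / d) ^ 2) = ρ / d := by
    rw [← Real.sqrt_sq (show 0 ≤ ρ / d by positivity)]
    congr 1
    field_simp
    linarith
  set ω := Real.arctan (T / d) with hω
  have hcos : Real.cos ω = d / ρ := by
    rw [hω, Real.cos_arctan, hs]; field_simp
  have hsin : Real.sin ω = T / ρ := by
    rw [hω, Real.sin_arctan, hs]; field_simp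
  have e1 : α * (θ₀ + 1 * ω / α) = α * θ₀ + ω := by field_simp
  have e2 : α * (θ₀ + -1 * ω / α) = α * θ₀ - ω := by field_simp; ring
  rw [e1] at h1
  rw [e2] at h2
  refine eq_of_two_mul_eq_add (Real.sqrt_nonneg _) h1 h2 ?_ ?_
  · rw [norm_polar_sub_same_radius hρ0.le, show (α * θ₀ + ω - (α * θ₀ - ω)) / 2 = ω by ring, hsin,
      abs_of_nonneg (by positivity), ← hT]
    field_simp
  · apply Complex.ext
    · simp only [polar, Complex.add_re, Complex.mul_re, Complex.re_ofNat, Complex.im_ofNat,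
        Real.cos_add, Real.cos_sub, hcos]
      field_simp
      ring
    · simp only [polar, Complex.add_im, Complex.mul_im, Complex.re_ofNat, Complex.im_ofNat,
        Real.sin_add, Real.sin_sub, hcos]
      field_simp
      ring

theorem IsPeriodicLipschitz.norm_sub_le_radial {v : ℝ × ℝ → ℂ} (hR₁ : 0 < R₁)
    (hv : IsPeriodicLipschitz α R₁ R₂ v) {a b N θ : ℝ} (ha : R₁ ≤ a) (hab : a ≤ b) (hb : b ≤ R₂)
    (hN : 0 ≤ N) (H : ∀ r ∈ Ioo a b, localLip R₁ R₂ v (r, θ) ≤ ENNReal.ofReal N) :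
    ‖v (b, θ) - v (a, θ)‖ ≤ N * (b - a) :=
  norm_comp_curve_sub_le (α := α) hR₁ hv (r := id) (θ := fun _ => θ) (r' := fun _ => 1)
    (θ' := fun _ => 0) (ℓ := fun _ => N) hab continuousOn_id continuousOn_const
    (fun _ ht => ⟨ha.trans ht.1, ht.2.trans hb⟩)
    (fun _ ht => ⟨ha.trans_lt ht.1, ht.2.trans_le hb⟩) (fun t _ => hasDerivAt_id t)
    (fun t _ => hasDerivAt_const t θ) H (fun _ _ => hN) (fun _ _ => by simp)

/-- Where `φ` is affine the radial map sends radial segments to segments stretched by its slope, and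
so is determined by its values at their ends. -/
theorem IsPeriodicLipschitz.eq_of_localLip_le_affine {v : ℝ × ℝ → ℂ} (hR₁ : 0 < R₁)
    (hv : IsPeriodicLipschitz α R₁ R₂ v) {a b m c θ : ℝ} (ha : R₁ ≤ a) (hab : a < b) (hb : b ≤ R₂)
    (H : ∀ r ∈ Ioo a b, localLip R₁ R₂ v (r, θ) ≤ ENNReal.ofReal |m|)
    (hva : v (a, θ) = polar (m * a + c, α * θ)) (hvb : v (b, θ) = polar (m * b + c, α * θ))
    {x : ℝ} (hx : x ∈ Icc a b) : v (x, θ) = polar (m * x + c, α * θ) := by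
  have h1 := hv.norm_sub_le_radial hR₁ ha hx.1 (hx.2.trans hb) (abs_nonneg m)
    (fun r hr => H r ⟨hr.1, hr.2.trans_le hx.2⟩)
  have h2 := hv.norm_sub_le_radial hR₁ (ha.trans hx.1) hx.2 hb (abs_nonneg m)
    (fun r hr => H r ⟨hx.1.trans_lt hr.1, hr.2⟩)
  have h3 : dist (v (a, θ)) (v (b, θ)) = |m| * (b - a) := by
    rw [hva, hvb, dist_eq_norm, norm_polar_sub_same_angle,
      show m * a + c - (m * b + c) = m * (a - b) by ring, abs_mul, abs_sub_comm a,
      abs_of_pos (sub_pos.2 hab)]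
  rw [← dist_eq_norm, dist_comm] at h1
  rw [← dist_eq_norm, dist_comm] at h2
  have h4 := dist_triangle (v (a, θ)) (v (x, θ)) (v (b, θ))
  have hba : 0 < b - a := sub_pos.2 hab
  have e : (x - a) / (b - a) * (|m| * (b - a)) = |m| * (x - a) := by field_simp
  have h5 : dist (v (a, θ)) (v (x, θ)) = (x - a) / (b - a) * dist (v (a, θ)) (v (b, θ)) := by
    rw [h3, e]; linarith
  have h6 : dist (v (x, θ)) (v (b, θ)) = (1 - (x - a) / (b - a)) * dist (v (a, θ)) (v (b, θ)) := by
    rw [sub_mul, h3, e]; linarith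
  rw [eq_lineMap_of_dist_eq_mul_of_dist_eq_mul h5 h6, hva, hvb, AffineMap.lineMap_apply_module]
  have hba' : (b : ℂ) - a ≠ 0 := by exact_mod_cast hba.ne'
  apply Complex.ext <;>
  · simp only [polar, Complex.add_re, Complex.add_im, Complex.smul_re, Complex.smul_im, smul_eq_mul]
    field_simp
    ring

/-! ### Tightness of the glued profiles -/

theorem LocLip.glue {φ₁ φ₂ : ℝ → ℝ} {x K ε : ℝ} (hε : 0 < ε) (h₁ : LocLip φ₁ x K)
    (h₂ : LocLip φ₂ x K) (hl : ∀ y ∈ Ioc (x - ε) x, φ y = φ₁ y)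
    (hr : ∀ y ∈ Ico x (x + ε), φ y = φ₂ y) : LocLip φ x K := by
  obtain ⟨δ₁, hδ₁, h₁⟩ := h₁
  obtain ⟨δ₂, hδ₂, h₂⟩ := h₂
  set δ := min ε (min δ₁ δ₂) with hδ
  have hδε : δ ≤ ε := min_le_left _ _
  have hδ1 : δ ≤ δ₁ := (min_le_right _ _).trans (min_le_left _ _)
  have hδ2 : δ ≤ δ₂ := (min_le_right _ _).trans (min_le_right _ _)
  have hx1 : φ x = φ₁ x := hl x ⟨by linarith, le_rfl⟩
  have hx2 : φ x = φ₂ x := hr x ⟨le_rfl, by linarith⟩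
  have hL : ∀ y ∈ Ioc (x - δ) x, ∀ z ∈ Ioc (x - δ) x, |φ y - φ z| ≤ K * |y - z| := by
    intro y hy z hz
    rw [hl y ⟨by linarith [hy.1], hy.2⟩, hl z ⟨by linarith [hz.1], hz.2⟩]
    exact h₁ y ⟨by linarith [hy.1], by linarith [hy.2]⟩ z ⟨by linarith [hz.1], by linarith [hz.2]⟩
  have hR : ∀ y ∈ Ico x (x + δ), ∀ z ∈ Ico x (x + δ), |φ y - φ z| ≤ K * |y - z| := by
    intro y hy z hz
    rw [hr y ⟨hy.1, by linarith [hy.2]⟩, hr z ⟨hz.1, by linarith [hz.2]⟩]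
    exact h₂ y ⟨by linarith [hy.1], by linarith [hy.2]⟩ z ⟨by linarith [hz.1], by linarith [hz.2]⟩
  have hδ0 : 0 < δ := lt_min hε (lt_min hδ₁ hδ₂)
  have hx : x ∈ Ioc (x - δ) x ∧ x ∈ Ico x (x + δ) := ⟨⟨by linarith, le_rfl⟩, le_rfl, by linarith⟩
  have hLR : ∀ y ∈ Ioc (x - δ) x, ∀ z ∈ Ico x (x + δ), |φ y - φ z| ≤ K * |y - z| := by
    intro y hy z hz
    have h3 := hL y hy x hx.1
    have h4 := hR x hx.2 z hz
    have h5 := abs_sub_le (φ y) (φ x) (φ z)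
    rw [abs_of_nonpos (a := y - x) (by linarith [hy.2])] at h3
    rw [abs_of_nonpos (a := x - z) (by linarith [hz.1])] at h4
    rw [abs_of_nonpos (a := y - z) (by linarith [hy.2, hz.1])]
    linarith
  refine ⟨δ, hδ0, fun y hy z hz => ?_⟩
  rcases le_total y x with h3 | h3 <;> rcases le_total z x with h4 | h4
  · exact hL y ⟨hy.1, h3⟩ z ⟨hz.1, h4⟩
  · exact hLR y ⟨hy.1, h3⟩ z ⟨h4, hz.2⟩
  · rw [abs_sub_comm, abs_sub_comm y]
    exact hLR z ⟨hz.1, h4⟩ y ⟨h3, hy.2⟩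
  · exact hR y ⟨h3, hy.2⟩ z ⟨h4, hz.2⟩

theorem locLip_affine (m c x : ℝ) {K : ℝ} (hK : |m| ≤ K) : LocLip (fun r => m * r + c) x K := by
  refine ⟨1, one_pos, fun y _ z _ => ?_⟩
  rw [show m * y + c - (m * z + c) = m * (y - z) by ring, abs_mul]
  gcongr

theorem locLip_power (hα : 0 < α) {k β x K : ℝ} (hβ : β = α ∨ β = -α) (hk : 0 ≤ k) (hx : 0 < x)
    (hK : α * (k * x ^ β) / x < K) : LocLip (fun r => k * r ^ β) x K := by
  have hK0 : 0 < K := lt_of_le_of_lt (by positivity) hK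
  have h1 : HasStrictDerivAt (fun r : ℝ => k * r ^ β) (k * (β * x ^ (β - 1))) x :=
    (Real.hasStrictDerivAt_rpow_const_of_ne hx.ne' β).const_mul k
  obtain ⟨s, hs, hl⟩ := h1.hasStrictFDerivAt.exists_lipschitzOnWith_of_nnnorm_lt K.toNNReal (by
    rw [← NNReal.coe_lt_coe, coe_nnnorm, Real.coe_toNNReal _ hK0.le,
      ContinuousLinearMap.norm_toSpanSingleton, Real.norm_eq_abs]
    refine lt_of_eq_of_lt ?_ hK
    have hβ' : |β| = α := by
      rcases hβ with rfl | rfl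
      · exact abs_of_pos hα
      · rw [abs_neg, abs_of_pos hα]
    have : 0 < x ^ (β - 1) := by positivity
    rw [abs_mul, abs_mul, hβ', abs_of_nonneg hk, abs_of_pos this, Real.rpow_sub_one hx.ne']
    ring)
  obtain ⟨δ, hδ, hb⟩ := Metric.mem_nhds_iff.1 hs
  rw [Real.ball_eq_Ioo] at hb
  refine ⟨δ, hδ, fun y hy z hz => ?_⟩
  have := hl.dist_le_mul y (hb hy) z (hb hz)
  rwa [Real.dist_eq, Real.dist_eq, Real.coe_toNNReal _ hK0.le] at this

/-- `φ` is `k₁ r ^ (-α)` on `[R₁, A]`, affine with slope `m` on `[A, B]`, and `k₂ r ^ α` on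
`[B, R₂]`. Each of the three intervals may reduce to a point, in which case its formula is void.
The radial direction dominates on the affine part, neither direction dominates at its ends
in the open annulus, and `α ≥ 1` if the last part is present. -/
structure IsTightProfile (α R₁ A B R₂ k₁ m c k₂ : ℝ) (φ : ℝ → ℝ) : Prop where
  left_le : R₁ ≤ A
  le : A ≤ B
  le_right : B ≤ R₂
  left_pos : R₁ < A → 0 < k₁
  left : R₁ < A → PowerOn φ R₁ A k₁ (-α)
  mid : A < B → AffineOn φ A B m c
  tangential_le : A < B → ∀ r ∈ Ioo A B, α * φ r / r ≤ |m|
  left_slope : R₁ < A → A < B → |m| = α * φ A / A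
  right_slope : A < B → B < R₂ → |m| = α * φ B / B
  one_le : B < R₂ → 1 ≤ α
  right_pos : B < R₂ → 0 < k₂
  right : B < R₂ → PowerOn φ B R₂ k₂ α

namespace IsTightProfile

variable {A B k₁ m c k₂ : ℝ}

theorem locLip_of_lt_left (h : IsTightProfile α R₁ A B R₂ k₁ m c k₂ φ) (hα : 0 < α) (hR₁ : 0 < R₁)
    {x : ℝ} (hx : x ∈ Ioo R₁ A) {K : ℝ} (hK : α * φ x / x < K) : LocLip φ x K := by
  have hA := hx.1.trans hx.2
  have hp := h.left hA
  rw [hp x (Ioo_subset_Icc_self hx)] at hK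
  have h1 := locLip_power hα (Or.inr rfl) (h.left_pos hA).le (hR₁.trans hx.1) hK
  refine LocLip.glue (ε := min (x - R₁) (A - x)) (lt_min (by linarith [hx.1]) (by linarith [hx.2]))
    h1 h1 (fun y hy => hp y ?_) (fun y hy => hp y ?_)
  · exact ⟨by linarith [hy.1, min_le_left (x - R₁) (A - x)], by linarith [hy.2, hx.2]⟩
  · exact ⟨by linarith [hy.1, hx.1], by linarith [hy.2, min_le_right (x - R₁) (A - x)]⟩

theorem locLip_of_right_lt (h : IsTightProfile α R₁ A B R₂ k₁ m c k₂ φ) (hα : 0 < α) (hR₁ : 0 < R₁)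
    {x : ℝ} (hx : x ∈ Ioo B R₂) {K : ℝ} (hK : α * φ x / x < K) : LocLip φ x K := by
  have hB := hx.1.trans hx.2
  have hp := h.right hB
  rw [hp x (Ioo_subset_Icc_self hx)] at hK
  have hx0 : 0 < x := hR₁.trans_le ((h.left_le.trans h.le).trans hx.1.le)
  have h1 := locLip_power hα (Or.inl rfl) (h.right_pos hB).le hx0 hK
  refine LocLip.glue (ε := min (x - B) (R₂ - x)) (lt_min (by linarith [hx.1]) (by linarith [hx.2]))
    h1 h1 (fun y hy => hp y ?_) (fun y hy => hp y ?_)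
  · exact ⟨by linarith [hy.1, min_le_left (x - B) (R₂ - x)], by linarith [hy.2, hx.2]⟩
  · exact ⟨by linarith [hy.1, hx.1], by linarith [hy.2, min_le_right (x - B) (R₂ - x)]⟩

theorem locLip_of_mem_Ioo (h : IsTightProfile α R₁ A B R₂ k₁ m c k₂ φ)
    {x : ℝ} (hx : x ∈ Ioo A B) {K : ℝ} (hK : |m| ≤ K) : LocLip φ x K := by
  have hp := h.mid (hx.1.trans hx.2)
  have h1 := locLip_affine m c x hK
  refine LocLip.glue (ε := min (x - A) (B - x)) (lt_min (by linarith [hx.1]) (by linarith [hx.2]))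
    h1 h1 (fun y hy => hp y ?_) (fun y hy => hp y ?_)
  · exact ⟨by linarith [hy.1, min_le_left (x - A) (B - x)], by linarith [hy.2, hx.2]⟩
  · exact ⟨by linarith [hy.1, hx.1], by linarith [hy.2, min_le_right (x - A) (B - x)]⟩

theorem locLip_left (h : IsTightProfile α R₁ A B R₂ k₁ m c k₂ φ) (hα : 0 < α) (hR₁ : 0 < R₁)
    (hA : R₁ < A) (hA' : A < R₂) {K : ℝ} (hK : α * φ A / A < K) : LocLip φ A K := by
  have hp := h.left hA
  have hA0 := hR₁.trans hA
  have hK' := hK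
  rw [hp A ⟨hA.le, le_rfl⟩] at hK'
  have h1 := locLip_power hα (Or.inr rfl) (h.left_pos hA).le hA0 hK'
  rcases h.le.lt_or_eq with hAB | hAB
  · have h2 := locLip_affine m c A ((h.left_slope hA hAB).trans_le hK.le)
    refine LocLip.glue (ε := min (A - R₁) (B - A)) (lt_min (by linarith) (by linarith))
      h1 h2 (fun y hy => hp y ?_) (fun y hy => h.mid hAB y ?_)
    · exact ⟨by linarith [hy.1, min_le_left (A - R₁) (B - A)], by linarith [hy.2]⟩
    · exact ⟨by linarith [hy.1], by linarith [hy.2, min_le_right (A - R₁) (B - A)]⟩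
  · subst hAB
    have hp2 := h.right hA'
    rw [hp2 A ⟨le_rfl, hA'.le⟩] at hK
    have h2 := locLip_power hα (Or.inl rfl) (h.right_pos hA').le hA0 hK
    refine LocLip.glue (ε := min (A - R₁) (R₂ - A)) (lt_min (by linarith) (by linarith))
      h1 h2 (fun y hy => hp y ?_) (fun y hy => hp2 y ?_)
    · exact ⟨by linarith [hy.1, min_le_left (A - R₁) (R₂ - A)], by linarith [hy.2]⟩
    · exact ⟨by linarith [hy.1], by linarith [hy.2, min_le_right (A - R₁) (R₂ - A)]⟩

theorem locLip_right (h : IsTightProfile α R₁ A B R₂ k₁ m c k₂ φ) (hα : 0 < α) (hR₁ : 0 < R₁)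
    (hB : R₁ < B) (hB' : B < R₂) {K : ℝ} (hK : α * φ B / B < K) : LocLip φ B K := by
  rcases h.le.lt_or_eq with hAB | hAB
  · have hp := h.right hB'
    have hK' := hK
    rw [hp B ⟨le_rfl, hB'.le⟩] at hK'
    have h1 := locLip_power hα (Or.inl rfl) (h.right_pos hB').le (hR₁.trans hB) hK'
    have h2 := locLip_affine m c B ((h.right_slope hAB hB').trans_le hK.le)
    refine LocLip.glue (ε := min (B - A) (R₂ - B)) (lt_min (by linarith) (by linarith))
      h2 h1 (fun y hy => h.mid hAB y ?_) (fun y hy => hp y ?_)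
    · exact ⟨by linarith [hy.1, min_le_left (B - A) (R₂ - B)], by linarith [hy.2]⟩
    · exact ⟨by linarith [hy.1], by linarith [hy.2, min_le_right (B - A) (R₂ - B)]⟩
  · subst hAB
    exact h.locLip_left hα hR₁ hB hB' hK

theorem continuousOn (h : IsTightProfile α R₁ A B R₂ k₁ m c k₂ φ) (hR₁ : 0 < R₁) :
    ContinuousOn φ (Icc R₁ R₂) := by
  have hpow : ∀ {a b k β : ℝ}, 0 < a → PowerOn φ a b k β → ContinuousOn φ (Icc a b) := by
    intro a b k β ha hp
    refine ContinuousOn.congr (f := fun r => k * r ^ β) ?_ hp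
    refine continuousOn_const.mul (continuousOn_id.rpow_const fun r hr => Or.inl ?_)
    exact (ha.trans_le hr.1).ne'
  have h1 : ContinuousOn φ (Icc R₁ A) := by
    rcases h.left_le.lt_or_eq with hA | hA
    · exact hpow hR₁ (h.left hA)
    · rw [hA, Icc_self]; exact continuousOn_singleton _ _
  have h2 : ContinuousOn φ (Icc A B) := by
    rcases h.le.lt_or_eq with hA | hA
    · exact ContinuousOn.congr (f := fun r => m * r + c) (by fun_prop) (h.mid hA)
    · rw [hA, Icc_self]; exact continuousOn_singleton _ _
  have h3 : ContinuousOn φ (Icc B R₂) := by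
    rcases h.le_right.lt_or_eq with hA | hA
    · exact hpow (hR₁.trans_le (h.left_le.trans h.le)) (h.right hA)
    · rw [hA, Icc_self]; exact continuousOn_singleton _ _
  rw [← Icc_union_Icc_eq_Icc (h.left_le.trans h.le) h.le_right, ← Icc_union_Icc_eq_Icc h.left_le h.le]
  exact (h1.union_of_isClosed h2 isClosed_Icc isClosed_Icc).union_of_isClosed h3
    (isClosed_Icc.union isClosed_Icc) isClosed_Icc

theorem isPeriodicLipschitz (h : IsTightProfile α R₁ A B R₂ k₁ m c k₂ φ) (hα : 0 < α)
    (hR₁ : 0 < R₁) (hφ : ∀ r ∈ Icc R₁ R₂, 0 ≤ φ r) :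
    IsPeriodicLipschitz α R₁ R₂ (radialMap α φ) := by
  have hcont := h.continuousOn hR₁
  obtain ⟨M, hM⟩ := isCompact_Icc.exists_bound_of_continuousOn hcont
  have hR : R₁ ≤ R₂ := (h.left_le.trans h.le).trans h.le_right
  have hM0 : 0 ≤ M := (norm_nonneg _).trans (hM R₁ ⟨le_rfl, hR⟩)
  refine isPeriodicLipschitz_radialMap hα hR₁ hR hφ (K := α * M / R₁ + |m|) ?_
  refine abs_sub_le_of_locLip hcont fun x hx K' hK' => ?_
  have hx0 : 0 < x := hR₁.trans hx.1
  have hm : |m| ≤ K' := by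
    have : 0 ≤ α * M / R₁ := by positivity
    linarith
  have hg : α * φ x / x < K' := by
    refine lt_of_le_of_lt ?_ hK'
    have h1 : φ x ≤ M := (le_abs_self _).trans (hM x (Ioo_subset_Icc_self hx))
    have : α * φ x / x ≤ α * M / R₁ := by gcongr; exact hx.1.le
    linarith [abs_nonneg m]
  rcases lt_trichotomy x A with h1 | rfl | h1
  · exact h.locLip_of_lt_left hα hR₁ ⟨hx.1, h1⟩ hg
  · exact h.locLip_left hα hR₁ hx.1 hx.2 hg
  · rcases lt_trichotomy x B with h2 | rfl | h2
    · exact h.locLip_of_mem_Ioo ⟨h1, h2⟩ hm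
    · exact h.locLip_right hα hR₁ hx.1 hx.2 hg
    · exact h.locLip_of_right_lt hα hR₁ ⟨h2, hx.2⟩ hg

/-- The level `S` that a tighter map must respect is exceeded by the stretch of `u` at some point. If
the point lies on a power part, chords force `v = u` on a neighbourhood of its circle; if it lies on
the affine part or at its ends, the whole stretch of `u` is at least `S` and `v = u` throughout. -/
theorem isTight (h : IsTightProfile α R₁ A B R₂ k₁ m c k₂ φ) (hα : 0 < α)
    (hR₁ : 0 < R₁) (hφ : ∀ r ∈ Icc R₁ R₂, 0 ≤ φ r) : IsTight α R₁ R₂ (radialMap α φ) := by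
  refine ⟨h.isPeriodicLipschitz hα hR₁ hφ, ?_⟩
  rintro ⟨v, hv, hvu⟩
  set u := radialMap α φ with hu
  have hbd : ∀ r θ, r = R₁ ∨ r = R₂ → v (r, θ) = u (r, θ) := fun r θ hr =>
    hvu.eqOn_boundary (r, θ) hr
  set S := sSup (localLip R₁ R₂ v ''
        {p ∈ openCover R₁ R₂ | localLip R₁ R₂ u p < localLip R₁ R₂ v p}) with hS
  obtain ⟨_, ⟨⟨x, θx⟩, ⟨hx, hlt⟩, rfl⟩, hSp⟩ := lt_sSup_iff.1 hvu.sup_lt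
  change x ∈ Ioo R₁ R₂ at hx
  have hvle : ∀ p ∈ openCover R₁ R₂, localLip R₁ R₂ v p ≤ max (localLip R₁ R₂ u p) S := by
    intro p hp
    by_cases hc : localLip R₁ R₂ u p < localLip R₁ R₂ v p
    · exact le_max_of_le_right (le_sSup ⟨p, ⟨hp, hc⟩, rfl⟩)
    · exact le_max_of_le_left (not_lt.1 hc)
  have hA0 : 0 < A := hR₁.trans_le h.left_le
  have hB0 : 0 < B := hA0.trans_le h.le
  -- a map agreeing with `u` near the point `(x, θx)` has the same local Lipschitz constant there
  have hfar : ∀ a b, x ∈ Ioo a b → (∀ r ∈ Ioo R₁ R₂, r ∈ Ioo a b → ∀ θ, v (r, θ) = u (r, θ)) →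
      False := by
    intro a b hxab hab
    refine absurd (localLip_le_of_eq (u := v) (v := u) (p := (x, θx)) hR₁
      (ε := min (x - a) (b - x)) (lt_min (by linarith [hxab.1]) (by linarith [hxab.2]))
      (hR₁.trans hx.1).le ?_) (not_le.2 hlt)
    rintro ⟨r, θ⟩ hr hd
    simp only [lt_min_iff, abs_lt] at hd
    exact (hab r hr ⟨by linarith [hd.1.2], by linarith [hd.2.1]⟩ θ).symm
  have hule_left : ∀ r ∈ Ioc R₁ A, r < R₂ → ∀ θ,
      localLip R₁ R₂ u (r, θ) ≤ ENNReal.ofReal (α * φ r / r) := by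
    intro r hr hr2 θ
    refine localLip_radialMap_le hα hR₁ hφ ⟨hr.1, hr2⟩ θ le_rfl fun K' hK' => ?_
    rcases hr.2.lt_or_eq with h1 | h1
    · exact h.locLip_of_lt_left hα hR₁ ⟨hr.1, h1⟩ hK'
    · rw [h1] at hK' ⊢
      exact h.locLip_left hα hR₁ (h1 ▸ hr.1) (h1 ▸ hr2) hK'
  have hule_right : ∀ r ∈ Ico B R₂, R₁ < r → ∀ θ,
      localLip R₁ R₂ u (r, θ) ≤ ENNReal.ofReal (α * φ r / r) := by
    intro r hr hr1 θ
    refine localLip_radialMap_le hα hR₁ hφ ⟨hr1, hr.2⟩ θ le_rfl fun K' hK' => ?_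
    rcases hr.1.lt_or_eq with h1 | h1
    · exact h.locLip_of_right_lt hα hR₁ ⟨h1, hr.2⟩ hK'
    · rw [← h1] at hK' ⊢
      exact h.locLip_right hα hR₁ (h1 ▸ hr1) (h1 ▸ hr.2) hK'
  have hule_mid : ∀ r ∈ Ioo A B, ∀ θ, localLip R₁ R₂ u (r, θ) ≤ ENNReal.ofReal |m| := by
    intro r hr θ
    exact localLip_radialMap_le hα hR₁ hφ ⟨h.left_le.trans_lt hr.1, hr.2.trans_le h.le_right⟩ θ
      (h.tangential_le (hr.1.trans hr.2) r hr) fun K' hK' => h.locLip_of_mem_Ioo hr hK'.le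
  have heq_left : ∀ r₁ ∈ Ioc R₁ A, r₁ < R₂ → S ≤ ENNReal.ofReal (α * φ r₁ / r₁) →
      ∀ r ∈ Ioc R₁ r₁, ∀ θ, v (r, θ) = u (r, θ) := by
    intro r₁ hr₁ hr₁2 hS₁ r hr θ
    have hRA := hr₁.1.trans_le hr₁.2
    have hp := h.left hRA
    have hk := h.left_pos hRA
    have hr0 := hR₁.trans hr.1
    have hanti : ∀ {y z : ℝ}, 0 < y → y ≤ z → k₁ * z ^ (-α) ≤ k₁ * y ^ (-α) := by
      intro y z hy hyz
      have := Real.rpow_le_rpow_of_nonpos hy hyz (z := -α) (by linarith)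
      gcongr
    have hsanti : ∀ {y z : ℝ}, 0 < y → y < z → k₁ * z ^ (-α) < k₁ * y ^ (-α) := by
      intro y z hy hyz
      have := Real.rpow_lt_rpow_of_neg hy hyz (z := -α) (by linarith)
      gcongr
    have hφr : φ r = k₁ * r ^ (-α) := hp r ⟨hr.1.le, hr.2.trans hr₁.2⟩
    rw [hu, radialMap, hφr]
    refine hv.eq_of_localLip_le_power hα hR₁ (β := -α) (by ring) hk hr0 (e := R₁)
      ⟨le_rfl, hx.1.le.trans hx.2.le⟩ (hsanti hR₁ hr.1) ?_ ?_ θ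
    · intro s hs hs1 hs2
      have hs3 : s ≤ r := by
        by_contra hc
        exact absurd (hsanti hr0 (not_le.1 hc)) (not_lt.2 hs1)
      have hs4 : R₁ < s := by
        by_contra hc
        exact absurd (hanti hs (not_lt.1 hc)) (not_le.2 hs2)
      have hs5 : s ≤ A := hs3.trans (hr.2.trans hr₁.2)
      have hs6 : s < R₂ := (hs3.trans hr.2).trans_lt hr₁2
      refine ⟨⟨hs4, hs6⟩, fun θ' => (hvle (s, θ') ⟨hs4, hs6⟩).trans (max_le ?_ (hS₁.trans ?_))⟩
      · rw [← hp s ⟨hs4.le, hs5⟩]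
        exact hule_left s ⟨hs4, hs5⟩ hs6 θ'
      · rw [hp r₁ (Ioc_subset_Icc_self hr₁)]
        have h1 := hanti hs (hs3.trans hr.2)
        have h2 : 0 < k₁ * r₁ ^ (-α) := by have := hR₁.trans hr₁.1; positivity
        apply ENNReal.ofReal_le_ofReal
        gcongr
        exact hs3.trans hr.2
    · intro θ'
      rw [hbd R₁ θ' (Or.inl rfl), hu, radialMap, hp R₁ ⟨le_rfl, hRA.le⟩]
  have heq_right : ∀ r₁ ∈ Ico B R₂, R₁ < r₁ → S ≤ ENNReal.ofReal (α * φ r₁ / r₁) →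
      ∀ r ∈ Ico r₁ R₂, ∀ θ, v (r, θ) = u (r, θ) := by
    intro r₁ hr₁ hr₁2 hS₁ r hr θ
    have hRB := hr₁.1.trans_lt hr₁.2
    have hp := h.right hRB
    have hk := h.right_pos hRB
    have hr0 := (hR₁.trans hr₁2).trans_le hr.1
    have hmono : ∀ {y z : ℝ}, 0 < y → y ≤ z → k₂ * y ^ α ≤ k₂ * z ^ α := by
      intro y z hy hyz
      gcongr
    have hsmono : ∀ {y z : ℝ}, 0 < y → y < z → k₂ * y ^ α < k₂ * z ^ α := by
      intro y z hy hyz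
      gcongr
    have hφr : φ r = k₂ * r ^ α := hp r ⟨hr₁.1.trans hr.1, hr.2.le⟩
    rw [hu, radialMap, hφr]
    refine hv.eq_of_localLip_le_power hα hR₁ (β := α) rfl hk hr0 (e := R₂)
      ⟨hx.1.le.trans hx.2.le, le_rfl⟩ (hsmono hr0 hr.2) ?_ ?_ θ
    · intro s hs hs1 hs2
      have hs3 : r ≤ s := by
        by_contra hc
        exact absurd (hsmono hs (not_le.1 hc)) (not_lt.2 hs1)
      have hs4 : s < R₂ := by
        by_contra hc
        exact absurd (hmono (hr0.trans hr.2) (not_lt.1 hc)) (not_le.2 hs2)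
      have hs5 : B ≤ s := (hr₁.1.trans hr.1).trans hs3
      have hs6 : R₁ < s := hr₁2.trans_le (hr.1.trans hs3)
      refine ⟨⟨hs6, hs4⟩, fun θ' => (hvle (s, θ') ⟨hs6, hs4⟩).trans (max_le ?_ (hS₁.trans ?_))⟩
      · rw [← hp s ⟨hs5, hs4.le⟩]
        exact hule_right s ⟨hs5, hs4⟩ hs6 θ'
      · rw [hp r₁ (Ico_subset_Icc_self hr₁)]
        have hr₁0 := hR₁.trans hr₁2
        have h1 := Real.rpow_le_rpow hr₁0.le (hr.1.trans hs3)
          (z := α - 1) (by linarith [h.one_le hRB])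
        rw [Real.rpow_sub_one hr₁0.ne', Real.rpow_sub_one hs.ne'] at h1
        apply ENNReal.ofReal_le_ofReal
        calc α * (k₂ * r₁ ^ α) / r₁ = α * k₂ * (r₁ ^ α / r₁) := by ring
          _ ≤ α * k₂ * (s ^ α / s) := by gcongr
          _ = α * (k₂ * s ^ α) / s := by ring
    · intro θ'
      rw [hbd R₂ θ' (Or.inr rfl), hu, radialMap, hp R₂ ⟨hRB.le, le_rfl⟩]
  -- the stretch at `(x, θx)` exceeds `S`; for a continuous stretch so do those of nearby points
  have hnear : LocLip φ x (α * φ x / x + 1) → S < ENNReal.ofReal (α * φ x / x) →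
      ∀ᶠ r in nhds x, S < ENNReal.ofReal (α * φ r / r) := by
    intro hL hSx
    have hc := hL.continuousAt
    have hx0 : x ≠ 0 := (hR₁.trans hx.1).ne'
    have h1 : ContinuousAt (fun r => ENNReal.ofReal (α * φ r / r)) x :=
      ENNReal.continuous_ofReal.continuousAt.comp
        ((continuousAt_const.mul hc).div continuousAt_id hx0)
    exact h1.eventually_const_lt hSx
  by_cases hxA : x < A
  · have hSx := hSp.trans_le (hule_left x ⟨hx.1, hxA.le⟩ hx.2 θx)
    have h1 := hnear (h.locLip_of_lt_left hα hR₁ ⟨hx.1, hxA⟩ (by linarith)) hSx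
    obtain ⟨ε, hε, h2⟩ := Metric.eventually_nhds_iff.1 h1
    obtain ⟨r₁, h3, h4⟩ := exists_between (lt_min hxA (show x < x + ε by linarith))
    rw [lt_min_iff] at h4
    have h5 := h2 (y := r₁) (by rw [Real.dist_eq, abs_lt]; constructor <;> linarith)
    refine hfar R₁ r₁ ⟨hx.1, h3⟩ fun r _ hr' θ => heq_left r₁ ⟨hx.1.trans h3, h4.1.le⟩
      (h4.1.trans_le (h.le.trans h.le_right)) h5.le r ⟨hr'.1, hr'.2.le⟩ θ
  by_cases hxB : B < x
  · have hSx := hSp.trans_le (hule_right x ⟨hxB.le, hx.2⟩ hx.1 θx)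
    have h1 := hnear (h.locLip_of_right_lt hα hR₁ ⟨hxB, hx.2⟩ (by linarith)) hSx
    obtain ⟨ε, hε, h2⟩ := Metric.eventually_nhds_iff.1 h1
    obtain ⟨r₁, h3, h4⟩ := exists_between (max_lt hxB (show x - ε < x by linarith))
    rw [max_lt_iff] at h3
    have h5 := h2 (y := r₁) (by rw [Real.dist_eq, abs_lt]; constructor <;> linarith)
    exact hfar r₁ R₂ ⟨h4, hx.2⟩ fun r _ hr' θ => heq_right r₁ ⟨h3.1.le, h4.trans hx.2⟩
      ((h.left_le.trans h.le).trans_lt h3.1) h5.le r ⟨hr'.1.le, hr'.2⟩ θ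
  push Not at hxA hxB
  -- now the stretch is at least `S` on all three parts, which forces `v = u`
  have hlevel : (R₁ < A → S ≤ ENNReal.ofReal (α * φ A / A)) ∧
      (B < R₂ → S ≤ ENNReal.ofReal (α * φ B / B)) ∧ (A < B → S ≤ ENNReal.ofReal |m|) := by
    have hmid : A < B → S ≤ ENNReal.ofReal |m| := by
      intro hAB
      rcases hxA.lt_or_eq with h1 | h1
      · rcases hxB.lt_or_eq with h2 | h2
        · exact hSp.le.trans (hule_mid x ⟨h1, h2⟩ θx)
        · rw [h.right_slope hAB (h2 ▸ hx.2), ← h2]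
          exact hSp.le.trans (hule_right x ⟨h2.ge, hx.2⟩ hx.1 θx)
      · rw [h.left_slope (h1 ▸ hx.1) hAB, h1]
        exact hSp.le.trans (hule_left x ⟨hx.1, h1.ge⟩ hx.2 θx)
    refine ⟨fun hA => ?_, fun hB => ?_, hmid⟩
    · rcases h.le.lt_or_eq with hAB | hAB
      · rw [← h.left_slope hA hAB]; exact hmid hAB
      · have h1 : x = A := le_antisymm (hAB ▸ hxB) hxA
        rw [← h1]
        exact hSp.le.trans (hule_left x ⟨hx.1, h1.le⟩ hx.2 θx)
    · rcases h.le.lt_or_eq with hAB | hAB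
      · rw [← h.right_slope hAB hB]; exact hmid hAB
      · have h1 : x = B := le_antisymm hxB (hAB ▸ hxA)
        rw [← h1]
        exact hSp.le.trans (hule_right x ⟨h1.ge, hx.2⟩ hx.1 θx)
  obtain ⟨hlA, hlB, hlm⟩ := hlevel
  have heqA : ∀ r ∈ Icc R₁ A, ∀ θ, v (r, θ) = u (r, θ) := by
    intro r hr θ
    rcases hr.1.lt_or_eq with h1 | h1
    · have hRA := h1.trans_le hr.2
      rcases (h.le.trans h.le_right).lt_or_eq with h2 | h2
      · exact heq_left A ⟨hRA, le_rfl⟩ h2 (hlA hRA) r ⟨h1, hr.2⟩ θ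
      · exact absurd (h2 ▸ hxA) (not_le.2 hx.2)
    · exact hbd r θ (Or.inl h1.symm)
  have heqB : ∀ r ∈ Icc B R₂, ∀ θ, v (r, θ) = u (r, θ) := by
    intro r hr θ
    rcases hr.2.lt_or_eq with h1 | h1
    · have hRB := hr.1.trans_lt h1
      rcases (h.left_le.trans h.le).lt_or_eq with h2 | h2
      · exact heq_right B ⟨le_rfl, hRB⟩ h2 (hlB hRB) r ⟨hr.1, h1⟩ θ
      · exact absurd (h2 ▸ hxB) (not_le.2 hx.1)
    · exact hbd r θ (Or.inr h1)
  refine hfar R₁ R₂ hx fun r hr _ θ => ?_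
  by_cases h1 : r ≤ A
  · exact heqA r ⟨hr.1.le, h1⟩ θ
  by_cases h2 : B ≤ r
  · exact heqB r ⟨h2, hr.2.le⟩ θ
  push Not at h1 h2
  have hAB := h1.trans h2
  have hp := h.mid hAB
  have h3 := hv.eq_of_localLip_le_affine hR₁ (m := m) (c := c) (θ := θ) h.left_le hAB h.le_right
    (fun s hs => (hvle (s, θ) ⟨h.left_le.trans_lt hs.1, hs.2.trans_le h.le_right⟩).trans
      (max_le (hule_mid s hs θ) (hlm hAB)))
    (by rw [heqA A ⟨h.left_le, le_rfl⟩, hu, radialMap, hp A ⟨le_rfl, hAB.le⟩])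
    (by rw [heqB B ⟨le_rfl, h.le_right⟩, hu, radialMap, hp B ⟨hAB.le, le_rfl⟩]) ⟨h1.le, h2.le⟩
  rw [h3, hu, radialMap, hp r ⟨h1.le, h2.le⟩]

end IsTightProfile

/-! ### Radial competitors -/

/-- Replacing `φ` on `[a, b]` by a function with the same end values keeps a Lipschitz bound on an
interval `J`. -/
theorem abs_piecewise_sub_le {χ : ℝ → ℝ} {a b K : ℝ} {J : Set ℝ} (hJ : J.OrdConnected)
    (hφ : ∀ y ∈ J, ∀ z ∈ J, |φ y - φ z| ≤ K * |y - z|)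
    (hχ : ∀ y ∈ Icc a b, ∀ z ∈ Icc a b, |χ y - χ z| ≤ K * |y - z|) (ha : χ a = φ a)
    (hb : χ b = φ b) :
    ∀ y ∈ J, ∀ z ∈ J, |(Icc a b).piecewise χ φ y - (Icc a b).piecewise χ φ z| ≤ K * |y - z| := by
  have key : ∀ y ∈ J, ∀ z ∈ J, y ≤ z →
      |(Icc a b).piecewise χ φ y - (Icc a b).piecewise χ φ z| ≤ K * |y - z| := by
    intro y hy z hz hyz
    by_cases h1 : y ∈ Icc a b <;> by_cases h2 : z ∈ Icc a b
    · rw [piecewise_eq_of_mem _ _ _ h1, piecewise_eq_of_mem _ _ _ h2]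
      exact hχ y h1 z h2
    · rw [piecewise_eq_of_mem _ _ _ h1, piecewise_eq_of_notMem _ _ _ h2]
      have hbz : b ≤ z := by
        by_contra hc
        exact h2 ⟨h1.1.trans hyz, (not_le.1 hc).le⟩
      have h3 := hχ y h1 b ⟨h1.1.trans h1.2, le_rfl⟩
      have h4 := hφ b (hJ.out hy hz ⟨h1.2, hbz⟩) z hz
      rw [hb] at h3
      have h5 := abs_sub_le (χ y) (φ b) (φ z)
      rw [abs_of_nonpos (a := y - b) (by linarith [h1.2])] at h3
      rw [abs_of_nonpos (a := b - z) (by linarith)] at h4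
      rw [abs_of_nonpos (a := y - z) (by linarith)]
      linarith
    · rw [piecewise_eq_of_notMem _ _ _ h1, piecewise_eq_of_mem _ _ _ h2]
      have hya : y ≤ a := by
        by_contra hc
        exact h1 ⟨(not_le.1 hc).le, hyz.trans h2.2⟩
      have h3 := hφ y hy a (hJ.out hy hz ⟨hya, h2.1⟩)
      have h4 := hχ a ⟨le_rfl, h2.1.trans h2.2⟩ z h2
      rw [ha] at h4
      have h5 := abs_sub_le (φ y) (φ a) (χ z)
      rw [abs_of_nonpos (a := y - a) (by linarith)] at h3
      rw [abs_of_nonpos (a := a - z) (by linarith [h2.1])] at h4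
      rw [abs_of_nonpos (a := y - z) (by linarith)]
      linarith
    · rw [piecewise_eq_of_notMem _ _ _ h1, piecewise_eq_of_notMem _ _ _ h2]
      exact hφ y hy z hz
  intro y hy z hz
  rcases le_total y z with h | h
  · exact key y hy z hz h
  · rw [abs_sub_comm, abs_sub_comm y]
    exact key z hz y hy h

/-- Replacing `φ` on `[a, b]` by an `N`-Lipschitz function `χ` whose tangential stretch is at most
that of `φ`, or at most `N`, gives a tighter map as soon as the stretch is diminished at some point
where it exceeds `N`. -/
theorem not_isTight_of_replacement (hα : 0 < α) (hR₁ : 0 < R₁)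
    (hφ : ∀ r ∈ Icc R₁ R₂, 0 ≤ φ r) {χ : ℝ → ℝ} {a b N : ℝ} (ha : R₁ ≤ a) (hb : b ≤ R₂)
    (hχa : χ a = φ a) (hχb : χ b = φ b) (hχ0 : ∀ r ∈ Icc a b, 0 ≤ χ r) (hN0 : 0 ≤ N)
    (hχN : ∀ y ∈ Icc a b, ∀ z ∈ Icc a b, |χ y - χ z| ≤ N * |y - z|)
    (hχg : ∀ r ∈ Icc a b, α * χ r / r ≤ max N (α * φ r / r)) {r₀ K : ℝ} (hr₀ : r₀ ∈ Ioo a b)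
    (hχr₀ : α * χ r₀ / r₀ < K) (hNK : N < K)
    (hK : ∀ θ, ENNReal.ofReal K ≤ localLip R₁ R₂ (radialMap α φ) (r₀, θ)) :
    ¬ IsTight α R₁ R₂ (radialMap α φ) := by
  rintro ⟨hlip, hno⟩
  obtain ⟨C, hC0, hC⟩ := hlip.exists_lipschitz_radial hR₁
  have hab : a < b := hr₀.1.trans hr₀.2
  have hR : R₁ ≤ R₂ := ha.trans (hab.le.trans hb)
  set ψ := (Icc a b).piecewise χ φ with hψ
  have hψin : ∀ r ∈ Icc a b, ψ r = χ r := fun r hr => piecewise_eq_of_mem _ _ _ hr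
  have hψout : ∀ r ∉ Icc a b, ψ r = φ r := fun r hr => piecewise_eq_of_notMem _ _ _ hr
  have hψ0 : ∀ r ∈ Icc R₁ R₂, 0 ≤ ψ r := by
    intro r hr
    by_cases h : r ∈ Icc a b
    · rw [hψin r h]; exact hχ0 r h
    · rw [hψout r h]; exact hφ r hr
  have hψL : ∀ r ∈ Icc R₁ R₂, ∀ s ∈ Icc R₁ R₂, |ψ r - ψ s| ≤ (C + N) * |r - s| := by
    refine abs_piecewise_sub_le ordConnected_Icc (fun r hr s hs => (hC r hr s hs).trans ?_)
      (fun r hr s hs => (hχN r hr s hs).trans ?_) hχa hχb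
    · gcongr; linarith
    · gcongr; linarith
  refine hno ⟨radialMap α ψ, isPeriodicLipschitz_radialMap hα hR₁ hR hψ0 hψL, ?_, ?_⟩
  · rintro ⟨r, θ⟩ hr
    have : ψ r = φ r := by
      by_cases h : r ∈ Icc a b
      · rw [hψin r h]
        rcases hr with hr | hr
        · have hra : r = a := le_antisymm ((show r = R₁ from hr).trans_le ha) h.1
          rw [hra, hχa]
        · have hrb : r = b := le_antisymm h.2 (hb.trans_eq (show r = R₂ from hr).symm)
          rw [hrb, hχb]
      · exact hψout r h
    simp only [radialMap, this]
  have hle : ∀ p ∈ openCover R₁ R₂, localLip R₁ R₂ (radialMap α ψ) p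
      ≤ max (ENNReal.ofReal N) (localLip R₁ R₂ (radialMap α φ) p) := by
    rintro ⟨x, θ⟩ hx
    change x ∈ Ioo R₁ R₂ at hx
    refine le_of_forall_gt_imp_ge_of_dense fun c hc => ?_
    rcases eq_or_ne c ∞ with rfl | hctop
    · exact le_top
    lift c to ℝ≥0 using hctop
    rw [max_lt_iff, ← ENNReal.ofReal_coe_nnreal, ENNReal.ofReal_lt_ofReal_iff'] at hc
    obtain ⟨⟨hNc, -⟩, hc⟩ := hc
    obtain ⟨⟨δ, hδ, hL⟩, hg⟩ := locLip_and_le_of_localLip_lt hα hR₁ hφ hx hc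
    rw [← ENNReal.ofReal_coe_nnreal]
    refine localLip_radialMap_le hα hR₁ hψ0 hx θ ?_ fun K' hK' => ⟨δ, hδ, ?_⟩
    · by_cases h : x ∈ Icc a b
      · rw [hψin x h]; exact (hχg x h).trans (max_le hNc.le hg)
      · rw [hψout x h]; exact hg
    · refine abs_piecewise_sub_le ordConnected_Ioo (fun r hr s hs => (hL r hr s hs).trans ?_)
        (fun r hr s hs => (hχN r hr s hs).trans ?_) hχa hχb
      · gcongr
      · gcongr; linarith
  have hr₀mem : r₀ ∈ Ioo R₁ R₂ := ⟨ha.trans_lt hr₀.1, hr₀.2.trans_le hb⟩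
  have hlt : localLip R₁ R₂ (radialMap α ψ) (r₀, 0) < ENNReal.ofReal K := by
    have h1 : localLip R₁ R₂ (radialMap α ψ) (r₀, 0)
        ≤ ENNReal.ofReal (max N (α * χ r₀ / r₀)) := by
      refine localLip_radialMap_le hα hR₁ hψ0 hr₀mem 0 ?_ fun K' hK' => ?_
      · rw [hψin r₀ (Ioo_subset_Icc_self hr₀)]; exact le_max_right _ _
      · have hχL : LocLip χ r₀ K' := by
          refine ⟨min (r₀ - a) (b - r₀), lt_min (by linarith [hr₀.1]) (by linarith [hr₀.2]),
            fun y hy z hz => (hχN y ⟨?_, ?_⟩ z ⟨?_, ?_⟩).trans ?_⟩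
          · linarith [hy.1, min_le_left (r₀ - a) (b - r₀)]
          · linarith [hy.2, min_le_right (r₀ - a) (b - r₀)]
          · linarith [hz.1, min_le_left (r₀ - a) (b - r₀)]
          · linarith [hz.2, min_le_right (r₀ - a) (b - r₀)]
          · have : N ≤ K' := (le_max_left _ _).trans hK'.le
            gcongr
        refine LocLip.glue (ε := min (r₀ - a) (b - r₀))
          (lt_min (by linarith [hr₀.1]) (by linarith [hr₀.2])) hχL hχL
          (fun y hy => hψin y ⟨?_, ?_⟩) (fun y hy => hψin y ⟨?_, ?_⟩)
        · linarith [hy.1, min_le_left (r₀ - a) (b - r₀)]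
        · linarith [hy.2, hr₀.2]
        · linarith [hy.1, hr₀.1]
        · linarith [hy.2, min_le_right (r₀ - a) (b - r₀)]
    refine h1.trans_lt ((ENNReal.ofReal_lt_ofReal_iff (hN0.trans_lt hNK)).2 (max_lt hNK hχr₀))
  have hmem : (r₀, (0 : ℝ)) ∈ {p ∈ openCover R₁ R₂ |
      localLip R₁ R₂ (radialMap α ψ) p < localLip R₁ R₂ (radialMap α φ) p} :=
    ⟨hr₀mem, hlt.trans_le (hK 0)⟩
  calc sSup (localLip R₁ R₂ (radialMap α ψ) '' {p ∈ openCover R₁ R₂ |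
        localLip R₁ R₂ (radialMap α φ) p < localLip R₁ R₂ (radialMap α ψ) p})
      ≤ ENNReal.ofReal N := by
        refine sSup_le ?_
        rintro _ ⟨p, ⟨hp, hlt'⟩, rfl⟩
        rcases le_max_iff.1 (hle p hp) with h | h
        · exact h
        · exact absurd hlt' (not_lt.2 h)
    _ < ENNReal.ofReal K := (ENNReal.ofReal_lt_ofReal_iff (hN0.trans_lt hNK)).2 hNK
    _ ≤ localLip R₁ R₂ (radialMap α φ) (r₀, 0) := hK 0
    _ ≤ _ := le_sSup (mem_image_of_mem _ hmem)

/-- The affine function with the values of `φ` at `a` and `b`, for `a ≠ b` (for `a = b` it is the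
constant `φ a`). -/
noncomputable def chord (φ : ℝ → ℝ) (a b r : ℝ) : ℝ := φ a + slope φ a b * (r - a)

theorem chord_left (φ : ℝ → ℝ) (a b : ℝ) : chord φ a b a = φ a := by simp [chord]

theorem chord_right (φ : ℝ → ℝ) {a b : ℝ} (hab : a < b) : chord φ a b b = φ b := by
  have : b - a ≠ 0 := (sub_pos.2 hab).ne'
  rw [chord, slope_def_field]
  field_simp
  ring

theorem abs_chord_sub (φ : ℝ → ℝ) (a b y z : ℝ) :
    |chord φ a b y - chord φ a b z| = |slope φ a b| * |y - z| := by
  rw [← abs_mul]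
  congr 1
  simp only [chord]
  ring

/-- A function whose Lipschitz constant on `[a, b]` is its mean slope is affine there. -/
theorem eq_chord_of_abs_sub_le {a b : ℝ} (hab : a < b)
    (h : ∀ y ∈ Icc a b, ∀ z ∈ Icc a b, |φ y - φ z| ≤ |slope φ a b| * |y - z|) :
    ∀ r ∈ Icc a b, φ r = chord φ a b r := by
  intro r hr
  have h1 := abs_le.1 (h r hr a ⟨le_rfl, hab.le⟩)
  have h2 := abs_le.1 (h b ⟨hab.le, le_rfl⟩ r hr)
  rw [abs_of_nonneg (a := r - a) (by linarith [hr.1])] at h1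
  rw [abs_of_nonneg (a := b - r) (by linarith [hr.2])] at h2
  have h3 := chord_right φ hab
  simp only [chord] at h3 ⊢
  rcases abs_cases (slope φ a b) with ⟨e, -⟩ | ⟨e, -⟩ <;> rw [e] at h1 h2 <;>
    apply le_antisymm <;> linarith [h1.1, h1.2, h2.1, h2.2]

theorem chord_nonneg {a b r : ℝ} (hab : a < b) (ha : 0 ≤ φ a) (hb : 0 ≤ φ b) (hr : r ∈ Icc a b) :
    0 ≤ chord φ a b r := by
  have hb' := chord_right φ hab
  simp only [chord] at hb' ⊢
  rcases le_total 0 (slope φ a b) with h | h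
  · nlinarith [hr.1, mul_nonneg h (sub_nonneg.2 hr.1)]
  · nlinarith [mul_nonpos_of_nonpos_of_nonneg h (sub_nonneg.2 hr.2)]

theorem IsTight.continuousOn (hR₁ : 0 < R₁) (ht : IsTight α R₁ R₂ (radialMap α φ)) :
    ContinuousOn φ (Icc R₁ R₂) := by
  obtain ⟨C, hC0, hC⟩ := ht.1.exists_lipschitz_radial hR₁
  have : LipschitzOnWith C.toNNReal φ (Icc R₁ R₂) := by
    refine LipschitzOnWith.of_dist_le_mul fun r hr s hs => ?_
    rw [Real.coe_toNNReal _ hC0, Real.dist_eq, Real.dist_eq]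
    exact hC r hr s hs
  exact this.continuousOn

theorem exists_not_locLip {a b N : ℝ} (hf : ContinuousOn φ (Icc a b))
    (h : ¬ ∀ y ∈ Icc a b, ∀ z ∈ Icc a b, |φ y - φ z| ≤ N * |y - z|) :
    ∃ r ∈ Ioo a b, ∃ K > N, ¬ LocLip φ r K := by
  by_contra hc
  push Not at hc
  exact h (abs_sub_le_of_locLip hf hc)

theorem chord_congr {a b a' b' : ℝ} (hab : a' < b') (ha : φ a' = chord φ a b a')
    (hb : φ b' = chord φ a b b') : chord φ a' b' = chord φ a b := by
  have hs : slope φ a' b' = slope φ a b := by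
    rw [slope_def_field φ a' b', ha, hb, div_eq_iff (sub_pos.2 hab).ne']
    simp only [chord]
    ring
  ext r
  rw [chord, hs, ha]
  simp only [chord]
  ring

theorem exists_last_zero {f : ℝ → ℝ} {a c : ℝ} (hac : a ≤ c) (hf : ContinuousOn f (Icc a c))
    (ha : f a ≤ 0) (hc : 0 < f c) : ∃ a' ∈ Ico a c, f a' = 0 ∧ ∀ x ∈ Ioc a' c, 0 < f x := by
  have hcomp : IsCompact (Icc a c ∩ f ⁻¹' Iic 0) :=
    isCompact_Icc.of_isClosed_subset (hf.preimage_isClosed_of_isClosed isClosed_Icc isClosed_Iic)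
      inter_subset_left
  obtain ⟨a', ⟨ha', hfa'⟩, hmax⟩ := hcomp.exists_isGreatest ⟨a, ⟨le_rfl, hac⟩, ha⟩
  change f a' ≤ 0 at hfa'
  have hlt : a' < c := by
    rcases ha'.2.lt_or_eq with h | h
    · exact h
    · rw [h] at hfa'; linarith
  have hpos : ∀ x ∈ Ioc a' c, 0 < f x := by
    intro x hx
    by_contra hcon
    exact absurd (hmax ⟨⟨ha'.1.trans hx.1.le, hx.2⟩, not_lt.1 hcon⟩) (not_le.2 hx.1)
  refine ⟨a', ⟨ha'.1, hlt⟩, ?_, hpos⟩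
  obtain ⟨z, hz, hz0⟩ := intermediate_value_Icc hlt.le (hf.mono (Icc_subset_Icc_left ha'.1))
    ⟨hfa', hc.le⟩
  rcases hz.1.lt_or_eq with h | h
  · exact absurd hz0 (hpos z ⟨h, hz.2⟩).ne'
  · rw [h, hz0]

theorem exists_first_zero {f : ℝ → ℝ} {c b : ℝ} (hcb : c ≤ b) (hf : ContinuousOn f (Icc c b))
    (hb : f b ≤ 0) (hc : 0 < f c) : ∃ b' ∈ Ioc c b, f b' = 0 ∧ ∀ x ∈ Ico c b', 0 < f x := by
  obtain ⟨x, hx, hx0, hpos⟩ := exists_last_zero (f := fun x => f (-x)) (a := -b) (c := -c)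
    (by linarith) (hf.comp continuousOn_neg fun x hx => ⟨by linarith [hx.2], by linarith [hx.1]⟩)
    (by simpa using hb) (by simpa using hc)
  refine ⟨-x, ⟨by linarith [hx.2], by linarith [hx.1]⟩, hx0, fun y hy => ?_⟩
  have := hpos (-y) ⟨by linarith [hy.2], by linarith [hy.1]⟩
  simpa using this

/-- If the graph of `φ` rises above a chord, replacing `φ` by the chord on an excursion decreases
the tangential stretch everywhere and the largest radial stretch. Hence `φ` is convex. -/
theorem IsTight.le_chord (hα : 0 < α) (hR₁ : 0 < R₁) (hφ : ∀ r ∈ Icc R₁ R₂, 0 ≤ φ r)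
    (ht : IsTight α R₁ R₂ (radialMap α φ)) {a b c : ℝ} (ha : R₁ ≤ a) (hb : b ≤ R₂) (hab : a < b)
    (hc : c ∈ Icc a b) : φ c ≤ chord φ a b c := by
  by_contra hcon
  push Not at hcon
  have hcont := (ht.continuousOn hR₁).mono (Icc_subset_Icc ha hb)
  have hch : Continuous (chord φ a b) := by unfold chord; fun_prop
  have hf : ContinuousOn (fun r => φ r - chord φ a b r) (Icc a b) := hcont.sub hch.continuousOn
  obtain ⟨a', ha', ha'0, hposa⟩ := exists_last_zero hc.1 (hf.mono (Icc_subset_Icc_right hc.2))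
    (by rw [chord_left]; simp) (sub_pos.2 hcon)
  obtain ⟨b', hb', hb'0, hposb⟩ := exists_first_zero hc.2 (hf.mono (Icc_subset_Icc_left hc.1))
    (by rw [chord_right φ hab]; simp) (sub_pos.2 hcon)
  have hab' : a' < b' := ha'.2.trans hb'.1
  have hch' := chord_congr hab' (sub_eq_zero.1 ha'0) (sub_eq_zero.1 hb'0)
  have hlt : ∀ r ∈ Ioo a' b', chord φ a' b' r < φ r := by
    intro r hr
    rw [hch']
    rcases le_total r c with h | h
    · exact sub_pos.1 (hposa r ⟨hr.1, h⟩)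
    · exact sub_pos.1 (hposb r ⟨h, hr.2⟩)
  have hsub : Icc a' b' ⊆ Icc R₁ R₂ := Icc_subset_Icc (ha.trans ha'.1) (hb'.2.trans hb)
  have hle : ∀ r ∈ Icc a' b', chord φ a' b' r ≤ φ r := by
    intro r hr
    rcases hr.1.lt_or_eq with h1 | rfl
    · rcases hr.2.lt_or_eq with h2 | rfl
      · exact (hlt r ⟨h1, h2⟩).le
      · rw [chord_right φ hab']
    · rw [chord_left]
  obtain ⟨r, hr, K, hK, hnot⟩ := exists_not_locLip (φ := φ) (a := a') (b := b')
    (N := |slope φ a' b'|) ((ht.continuousOn hR₁).mono hsub) fun h => by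
      have := eq_chord_of_abs_sub_le hab' h c ⟨ha'.2.le, hb'.1.le⟩
      exact absurd this (hlt c ⟨ha'.2, hb'.1⟩).ne'
  have hr2 := hsub (Ioo_subset_Icc_self hr)
  have hr0 : 0 < r := hR₁.trans_le hr2.1
  have hrI : r ∈ Ioo R₁ R₂ :=
    ⟨(ha.trans ha'.1).trans_lt hr.1, hr.2.trans_le (hb'.2.trans hb)⟩
  refine not_isTight_of_replacement hα hR₁ hφ (χ := chord φ a' b') (a := a') (b := b')
    (N := |slope φ a' b'|) (K := max K (α * φ r / r)) (ha.trans ha'.1) (hb'.2.trans hb)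
    (chord_left _ _ _) (chord_right φ hab') (fun s hs => chord_nonneg hab'
      (hφ _ (hsub ⟨le_rfl, hab'.le⟩)) (hφ _ (hsub ⟨hab'.le, le_rfl⟩)) hs) (abs_nonneg _)
    (fun y _ z _ => (abs_chord_sub φ a' b' y z).le) (fun s hs => le_max_of_le_right ?_) hr
    (lt_max_of_lt_right ?_) (lt_max_of_lt_left hK) (fun θ => ?_) ht
  · have := hle s hs
    have hs0 : 0 < s := hR₁.trans_le (hsub hs).1
    gcongr
  · have := hlt r hr
    gcongr
  · rw [ENNReal.ofReal_max]
    exact max_le (ofReal_le_localLip_of_not_locLip hα hR₁ hφ hrI θ hnot)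
      (ofReal_tangential_le_localLip hα hR₁ hφ hrI θ)

/-- On each interval `φ` is affine, or its Lipschitz constant is at most the tangential stretch at
one of the ends: otherwise the chord would be a better competitor. -/
theorem IsTight.affine_or_lipschitz (hα : 0 < α) (hR₁ : 0 < R₁) (hφ : ∀ r ∈ Icc R₁ R₂, 0 ≤ φ r)
    (ht : IsTight α R₁ R₂ (radialMap α φ)) {a b : ℝ} (ha : R₁ ≤ a) (hb : b ≤ R₂) (hab : a < b) :
    (∀ r ∈ Icc a b, φ r = chord φ a b r) ∨ ∀ y ∈ Icc a b, ∀ z ∈ Icc a b,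
      |φ y - φ z| ≤ max (α * φ a / a) (α * φ b / b) * |y - z| := by
  by_contra hcon
  rw [not_or] at hcon
  set M := max (α * φ a / a) (α * φ b / b) with hM
  have hsub : Icc a b ⊆ Icc R₁ R₂ := Icc_subset_Icc ha hb
  have ha0 : 0 < a := hR₁.trans_le ha
  have hb0 : 0 < b := ha0.trans hab
  obtain ⟨r, hr, K, hK, hnot⟩ := exists_not_locLip (φ := φ) (a := a) (b := b)
    (N := max |slope φ a b| M) ((ht.continuousOn hR₁).mono hsub) fun h => by
      rcases le_total |slope φ a b| M with h1 | h1
      · rw [max_eq_right h1] at h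
        exact hcon.2 h
      · rw [max_eq_left h1] at h
        exact hcon.1 (eq_chord_of_abs_sub_le hab h)
  have hrI : r ∈ Ioo R₁ R₂ := ⟨ha.trans_lt hr.1, hr.2.trans_le hb⟩
  have hφa := hφ _ (hsub ⟨le_rfl, hab.le⟩)
  have hφb := hφ _ (hsub ⟨hab.le, le_rfl⟩)
  have hg : ∀ s ∈ Icc a b, α * chord φ a b s / s ≤ M := by
    intro s hs
    rw [div_le_iff₀ (ha0.trans_le hs.1)]
    have h1 : α * φ a ≤ M * a := by rw [← div_le_iff₀ ha0]; exact le_max_left _ _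
    have h2 : α * φ b ≤ M * b := by rw [← div_le_iff₀ hb0]; exact le_max_right _ _
    have e : chord φ a b s * (b - a) = (b - s) * φ a + (s - a) * φ b := by
      rw [chord, slope_def_field]
      have := (sub_pos.2 hab).ne'
      field_simp
      ring
    have hba := sub_pos.2 hab
    have h3 := mul_le_mul_of_nonneg_left h1 (sub_nonneg.2 hs.2)
    have h4 := mul_le_mul_of_nonneg_left h2 (sub_nonneg.2 hs.1)
    refine le_of_mul_le_mul_right (a := b - a) ?_ hba
    rw [mul_assoc, e]
    linarith
  refine not_isTight_of_replacement hα hR₁ hφ (χ := chord φ a b) (a := a) (b := b)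
    (N := max |slope φ a b| M) (K := K) ha hb (chord_left _ _ _) (chord_right φ hab)
    (fun s hs => chord_nonneg hab hφa hφb hs) (le_max_of_le_left (abs_nonneg _))
    (fun y _ z _ => (abs_chord_sub φ a b y z).trans_le ?_)
    (fun s hs => le_max_of_le_left (le_max_of_le_right (hg s hs))) hr
    (((hg r (Ioo_subset_Icc_self hr)).trans (le_max_right _ _)).trans_lt hK) hK
    (fun θ => ofReal_le_localLip_of_not_locLip hα hR₁ hφ hrI θ hnot) ht
  gcongr
  exact le_max_left _ _

/-- The tangential direction never strictly dominates: otherwise lowering `φ` slightly would reduce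
the stretch. -/
theorem IsTight.not_locLip (hα : 0 < α) (hR₁ : 0 < R₁) (hφ : ∀ r ∈ Icc R₁ R₂, 0 ≤ φ r)
    (ht : IsTight α R₁ R₂ (radialMap α φ)) {r K : ℝ} (hr : r ∈ Ioo R₁ R₂) (hK0 : 0 ≤ K)
    (hK : K < α * φ r / r) : ¬ LocLip φ r K := by
  intro hL
  obtain ⟨K₁, hKK₁, hK₁⟩ := exists_between hK
  have hK₁0 : 0 < K₁ := hK0.trans_lt hKK₁
  have hr0 : 0 < r := hR₁.trans hr.1
  have hev : ∀ᶠ y in nhds r, K₁ * y < α * φ y := by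
    have := hL.continuousAt
    refine ContinuousAt.eventually_lt (by fun_prop) (by fun_prop) ?_
    rwa [← lt_div_iff₀ hr0]
  obtain ⟨δ₁, hδ₁, h₁⟩ := Metric.eventually_nhds_iff.1 hev
  obtain ⟨δ₂, hδ₂, h₂⟩ := hL
  obtain ⟨δ, hδ, hδlt⟩ := exists_between (lt_min (lt_min hδ₁ hδ₂)
    (lt_min (sub_pos.2 hr.1) (sub_pos.2 hr.2)))
  simp only [lt_min_iff] at hδlt
  obtain ⟨⟨hδ1, hδ2⟩, hδ3, hδ4⟩ := hδlt
  set a := r - δ with ha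
  set b := r + δ with hb
  have haR : R₁ ≤ a := by linarith
  have hbR : b ≤ R₂ := by linarith
  have ha0 : 0 < a := hR₁.trans_le haR
  have hL' : ∀ y ∈ Icc a b, ∀ z ∈ Icc a b, |φ y - φ z| ≤ K * |y - z| := fun y hy z hz =>
    h₂ y ⟨by linarith [hy.1], by linarith [hy.2]⟩ z ⟨by linarith [hz.1], by linarith [hz.2]⟩
  have hg : ∀ y ∈ Icc a b, K₁ * y < α * φ y := fun y hy => h₁ (by
    rw [Real.dist_eq, abs_lt]; constructor <;> linarith [hy.1, hy.2])
  have hba : 0 < b - a := by linarith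
  -- small enough to keep `χ` nonnegative and `K₁`-Lipschitz
  set η := min ((K₁ - K) / (b - a)) (K₁ * a / α / (b - a) ^ 2) with hη
  have hη0 : 0 < η := by
    have : 0 < K₁ - K := sub_pos.2 hKK₁
    exact lt_min (by positivity) (by positivity)
  have hη1 : η * (b - a) ≤ K₁ - K := by
    rw [← le_div_iff₀ hba]; exact min_le_left _ _
  have hη2 : α * (η * (b - a) ^ 2) ≤ K₁ * a := by
    have : η * (b - a) ^ 2 ≤ K₁ * a / α := by
      rw [← le_div_iff₀ (by positivity)]; exact min_le_right _ _
    rw [le_div_iff₀ hα] at this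
    linarith
  let χ : ℝ → ℝ := fun y => φ y - η * ((y - a) * (b - y))
  have hq : ∀ y ∈ Icc a b, 0 ≤ (y - a) * (b - y) ∧ (y - a) * (b - y) ≤ (b - a) ^ 2 := by
    intro y hy
    have h3 := sub_nonneg.2 hy.1
    have h4 := sub_nonneg.2 hy.2
    refine ⟨mul_nonneg h3 h4, ?_⟩
    rw [sq]
    apply mul_le_mul <;> linarith
  refine not_isTight_of_replacement hα hR₁ hφ (χ := χ) (a := a) (b := b) (N := K₁)
    (r₀ := r) (K := α * φ r / r) haR hbR (by simp [χ]) (by simp [χ]) (fun y hy => ?_) hK₁0.le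
    (fun y hy z hz => ?_) (fun y hy => le_max_of_le_right ?_) ⟨by linarith, by linarith⟩ ?_ hK₁
    (fun θ => ofReal_tangential_le_localLip hα hR₁ hφ hr θ) ht
  · have h3 := hg y hy
    have h4 : η * ((y - a) * (b - y)) ≤ η * (b - a) ^ 2 := by gcongr; exact (hq y hy).2
    have h5 : K₁ * a ≤ K₁ * y := by gcongr; exact hy.1
    have h6 : α * (η * ((y - a) * (b - y))) ≤ α * φ y := by
      have := mul_le_mul_of_nonneg_left h4 hα.le
      linarith
    have := le_of_mul_le_mul_left h6 hα
    simp only [χ]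
    linarith
  · have h3 := hL' y hy z hz
    have e : χ y - χ z = (φ y - φ z) - η * ((a + b - y - z) * (y - z)) := by
      simp only [χ]; ring
    have h4 : |a + b - y - z| ≤ b - a := by
      rw [abs_le]; constructor <;> linarith [hy.1, hy.2, hz.1, hz.2]
    have h5 : |η * ((a + b - y - z) * (y - z))| ≤ η * ((b - a) * |y - z|) := by
      rw [abs_mul, abs_mul, abs_of_pos hη0]
      gcongr
    have h6 : η * (b - a) * |y - z| ≤ (K₁ - K) * |y - z| := by gcongr
    rw [e]
    have h7 := abs_sub (φ y - φ z) (η * ((a + b - y - z) * (y - z)))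
    linarith
  · have h3 := (hq y hy).1
    have hy0 : 0 < y := ha0.trans_le hy.1
    have h4 : χ y ≤ φ y := by
      have : 0 ≤ η * ((y - a) * (b - y)) := by positivity
      simp only [χ]
      linarith
    gcongr
  · have h4 : χ r < φ r := by
      have h5 : 0 < r - a := by linarith
      have h6 : 0 < b - r := by linarith
      have : 0 < η * ((r - a) * (b - r)) := by positivity
      simp only [χ]
      linarith
    gcongr

/-! ### Profiles of tight radial maps -/

/-- The properties of the profile `φ` of a tight radial map which, by themselves, determine it. -/
structure RadialConditions (α R₁ R₂ : ℝ) (φ : ℝ → ℝ) : Prop where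
  continuousOn : ContinuousOn φ (Icc R₁ R₂)
  nonneg : ∀ r ∈ Icc R₁ R₂, 0 ≤ φ r
  convexOn : ConvexOn ℝ (Icc R₁ R₂) φ
  affine_or_lipschitz : ∀ {a b : ℝ}, R₁ ≤ a → b ≤ R₂ → a < b →
    (∀ r ∈ Icc a b, φ r = chord φ a b r) ∨ ∀ y ∈ Icc a b, ∀ z ∈ Icc a b,
      |φ y - φ z| ≤ max (α * φ a / a) (α * φ b / b) * |y - z|
  not_locLip : ∀ {r K : ℝ}, r ∈ Ioo R₁ R₂ → 0 ≤ K → K < α * φ r / r → ¬ LocLip φ r K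

theorem IsTight.radialConditions (hα : 0 < α) (hR₁ : 0 < R₁) (hφ : ∀ r ∈ Icc R₁ R₂, 0 ≤ φ r)
    (ht : IsTight α R₁ R₂ (radialMap α φ)) : RadialConditions α R₁ R₂ φ where
  continuousOn := ht.continuousOn hR₁
  nonneg := hφ
  convexOn := by
    refine convexOn_of_slope_mono_adjacent (convex_Icc _ _) fun {x y z} hx hz hxy hyz => ?_
    have h1 := ht.le_chord hα hR₁ hφ hx.1 hz.2 (hxy.trans hyz) ⟨hxy.le, hyz.le⟩
    have h2 : 0 < z - x := by linarith
    have h3 : 0 < y - x := by linarith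
    have h4 : 0 < z - y := by linarith
    rw [chord, slope_def_field, ← sub_nonneg] at h1
    have h5 := mul_nonneg h1 h2.le
    have e : (φ x + (φ z - φ x) / (z - x) * (y - x) - φ y) * (z - x)
        = (φ x - φ y) * (z - x) + (φ z - φ x) * (y - x) := by
      field_simp
      ring
    rw [e] at h5
    rw [div_le_div_iff₀ h3 h4]
    nlinarith
  affine_or_lipschitz := fun ha hb hab => ht.affine_or_lipschitz hα hR₁ hφ ha hb hab
  not_locLip := fun hr hK0 hK => ht.not_locLip hα hR₁ hφ hr hK0 hK

theorem le_of_le_Ioo {f g : ℝ → ℝ} {a b : ℝ} (hab : a < b) (hf : ContinuousOn f (Icc a b))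
    (hg : ContinuousOn g (Icc a b)) (h : ∀ x ∈ Ioo a b, f x ≤ g x) : ∀ x ∈ Icc a b, f x ≤ g x := by
  intro x hx
  have hcl : x ∈ closure (Ioo a b) := by rwa [closure_Ioo hab.ne]
  exact ContinuousWithinAt.closure_le hcl ((hf x hx).mono Ioo_subset_Icc_self)
    ((hg x hx).mono Ioo_subset_Icc_self) h

/-- There is a longest interval starting at `p` on which `φ` is affine. -/
theorem exists_maximal_affine_right {p q : ℝ} (hpq : p ≤ q) (hφ : ContinuousOn φ (Icc p q)) :
    ∃ B ∈ Icc p q, (∃ m, ∀ r ∈ Icc p B, φ r = φ p + m * (r - p)) ∧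
      ∀ x ∈ Ioc B q, ¬ ∃ m, ∀ r ∈ Icc p x, φ r = φ p + m * (r - p) := by
  set S := {b ∈ Icc p q | ∃ m, ∀ r ∈ Icc p b, φ r = φ p + m * (r - p)} with hS
  have hpS : p ∈ S := ⟨⟨le_rfl, hpq⟩, 0, fun r hr => by
    rw [le_antisymm hr.2 hr.1]; ring⟩
  have hbdd : BddAbove S := ⟨q, fun x hx => hx.1.2⟩
  have hB : sSup S ∈ Icc p q := ⟨le_csSup hbdd hpS, csSup_le ⟨p, hpS⟩ fun x hx => hx.1.2⟩
  refine ⟨sSup S, hB, ?_, fun x hx hm => ?_⟩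
  · rcases hB.1.lt_or_eq with hlt | heq
    · obtain ⟨b₁, ⟨hb₁, m, hm⟩, hb₁p⟩ := exists_lt_of_lt_csSup ⟨p, hpS⟩ hlt
      have key : ∀ r ∈ Ioo p (sSup S), φ r = φ p + m * (r - p) := by
        intro r hr
        obtain ⟨b₂, ⟨hb₂, m₂, hm₂⟩, hb₂r⟩ := exists_lt_of_lt_csSup ⟨p, hpS⟩ hr.2
        have hmin : p < min b₁ b₂ := lt_min hb₁p (hr.1.trans hb₂r)
        have e1 := hm (min b₁ b₂) ⟨hmin.le, min_le_left _ _⟩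
        have e2 := hm₂ (min b₁ b₂) ⟨hmin.le, min_le_right _ _⟩
        have e3 : m = m₂ := by
          have : 0 < min b₁ b₂ - p := sub_pos.2 hmin
          apply mul_right_cancel₀ this.ne'
          linarith
        rw [e3]
        exact hm₂ r ⟨hr.1.le, hb₂r.le⟩
      have hc := hφ.mono (Icc_subset_Icc_right hB.2)
      refine ⟨m, fun r hr => le_antisymm ?_ ?_⟩
      · exact le_of_le_Ioo hlt hc (g := fun r => φ p + m * (r - p)) (by fun_prop)
          (fun x hx => (key x hx).le) r hr
      · exact le_of_le_Ioo hlt (f := fun r => φ p + m * (r - p)) (by fun_prop) hc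
          (fun x hx => (key x hx).ge) r hr
    · rw [← heq]
      exact hpS.2
  · exact absurd (le_csSup hbdd (show x ∈ S from ⟨⟨hB.1.trans hx.1.le, hx.2⟩, hm⟩)) (not_le.2 hx.1)

/-- There is a longest interval ending at `q` on which `φ` is affine. -/
theorem exists_maximal_affine_left {p q : ℝ} (hpq : p ≤ q) (hφ : ContinuousOn φ (Icc p q)) :
    ∃ A ∈ Icc p q, (∃ m, ∀ r ∈ Icc A q, φ r = φ q + m * (r - q)) ∧
      ∀ x ∈ Ico p A, ¬ ∃ m, ∀ r ∈ Icc x q, φ r = φ q + m * (r - q) := by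
  obtain ⟨B, hB, ⟨m, hm⟩, hmax⟩ := exists_maximal_affine_right (φ := fun x => φ (-x)) (p := -q)
    (q := -p) (by linarith)
    (hφ.comp continuousOn_neg fun x hx => ⟨by linarith [hx.2], by linarith [hx.1]⟩)
  simp only [neg_neg] at hm hmax
  refine ⟨-B, ⟨by linarith [hB.2], by linarith [hB.1]⟩, ⟨-m, fun r hr => ?_⟩, ?_⟩
  · have := hm (-r) ⟨by linarith [hr.2], by linarith [hr.1]⟩
    rw [neg_neg] at this
    rw [this]; ring
  · rintro x hx ⟨m', hm'⟩
    refine hmax (-x) ⟨by linarith [hx.2], by linarith [hx.1]⟩ ⟨-m', fun r hr => ?_⟩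
    rw [hm' (-r) ⟨by linarith [hr.2], by linarith [hr.1]⟩]; ring

open Filter Topology in
/-- If the slopes of `φ` between `x < y` lie between `β φ(x) / x` and `β φ(y) / y`, then `φ` solves
`φ' = β φ / r`, and so is a multiple of `r ^ β`. -/
theorem powerOn_of_slope_bounds {a b β : ℝ} (ha : 0 < a) (hφ : ContinuousOn φ (Icc a b))
    (h : ∀ x ∈ Ioo a b, ∀ y ∈ Ioo a b, x < y →
      β * φ x / x * (y - x) ≤ φ y - φ x ∧ φ y - φ x ≤ β * φ y / y * (y - x)) :
    ∃ k, PowerOn φ a b k β := by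
  have hderiv : ∀ x ∈ Ioo a b, HasDerivAt φ (β * φ x / x) x := by
    intro x hx
    have hx0 : x ≠ 0 := (ha.trans hx.1).ne'
    have hc : ContinuousAt φ x := hφ.continuousAt (Icc_mem_nhds hx.1 hx.2)
    rw [hasDerivAt_iff_tendsto_slope, tendsto_iff_dist_tendsto_zero]
    have h0 : Tendsto (fun y => |β * φ y / y - β * φ x / x|) (𝓝[≠] x) (𝓝 0) := by
      have h1 : ContinuousAt (fun y => |β * φ y / y - β * φ x / x|) x :=
        (((continuousAt_const.mul hc).div continuousAt_id hx0).sub continuousAt_const).abs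
      have h2 := h1.tendsto
      rw [sub_self, abs_zero] at h2
      exact h2.mono_left nhdsWithin_le_nhds
    refine squeeze_zero' (Eventually.of_forall fun _ => dist_nonneg) ?_ h0
    filter_upwards [nhdsWithin_le_nhds (Ioo_mem_nhds hx.1 hx.2), self_mem_nhdsWithin] with y hy hne
    rw [Real.dist_eq, slope_def_field]
    rcases lt_or_gt_of_ne (show y ≠ x from hne) with hlt | hlt
    · obtain ⟨h1, h2⟩ := h y hy x hx hlt
      have hpos : 0 < x - y := sub_pos.2 hlt
      rw [← le_div_iff₀ hpos] at h1
      rw [← div_le_iff₀ hpos] at h2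
      have e : (φ y - φ x) / (y - x) = (φ x - φ y) / (x - y) := by
        rw [← neg_sub (φ x), ← neg_sub x, neg_div_neg_eq]
      rw [e, abs_of_nonpos (by linarith), abs_of_nonpos (by linarith)]
      linarith
    · obtain ⟨h1, h2⟩ := h x hx y hy hlt
      have hpos : 0 < y - x := sub_pos.2 hlt
      rw [← le_div_iff₀ hpos] at h1
      rw [← div_le_iff₀ hpos] at h2
      rw [abs_of_nonneg (by linarith), abs_of_nonneg (by linarith)]
      linarith
  have hf : ContinuousOn (fun r => φ r * r ^ (-β)) (Icc a b) :=
    hφ.mul (continuousOn_id.rpow_const fun r hr => Or.inl (ha.trans_le hr.1).ne')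
  have hfd : ∀ x ∈ Ioo a b, HasDerivAt (fun r => φ r * r ^ (-β)) 0 x := by
    intro x hx
    have hx0 : x ≠ 0 := (ha.trans hx.1).ne'
    refine ((hderiv x hx).mul (Real.hasDerivAt_rpow_const (p := -β) (Or.inl hx0))).congr_deriv ?_
    rw [Real.rpow_sub_one hx0]
    field_simp
    ring
  refine ⟨φ a * a ^ (-β), fun r hr => ?_⟩
  have hr0 : 0 < r := ha.trans_le hr.1
  have hconst : φ r * r ^ (-β) = φ a * a ^ (-β) := by
    rcases hr.1.lt_or_eq with hlt | rfl
    · obtain ⟨c, -, hc⟩ := exists_hasDerivAt_eq_slope (fun r => φ r * r ^ (-β)) (fun _ => 0) hlt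
        (hf.mono (Icc_subset_Icc_right hr.2)) fun x hx => hfd x ⟨hx.1, hx.2.trans_le hr.2⟩
      have : 0 < r - a := sub_pos.2 hlt
      rw [eq_div_iff this.ne'] at hc
      linarith
    · rfl
  rw [← hconst, mul_assoc, ← Real.rpow_add hr0, neg_add_cancel, Real.rpow_zero, mul_one]

namespace RadialConditions

variable {s : ℝ}

/-- To the right of a minimum of `φ`, the radial stretch is at least the tangential one. -/
theorem le_sub_right (h : RadialConditions α R₁ R₂ φ) (hR₁ : 0 < R₁)
    (hs : s ∈ Icc R₁ R₂) (hmin : ∀ r ∈ Icc R₁ R₂, φ s ≤ φ r) :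
    ∀ x y, s ≤ x → x < y → y ≤ R₂ → α * φ x / x * (y - x) ≤ φ y - φ x := by
  have hmono : ∀ w z, s ≤ w → w ≤ z → z ≤ R₂ → φ w ≤ φ z := by
    intro w z hw hwz hz
    rcases hw.lt_or_eq with h1 | rfl
    · rcases hwz.lt_or_eq with h2 | rfl
      · have h3 := h.convexOn.slope_mono_adjacent hs ⟨hs.1.trans (hw.trans hwz), hz⟩ h1 h2
        have h4 : 0 ≤ (φ w - φ s) / (w - s) :=
          div_nonneg (sub_nonneg.2 (hmin w ⟨hs.1.trans hw, h2.le.trans hz⟩)) (by linarith)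
        have h5 := h4.trans h3
        rw [le_div_iff₀ (sub_pos.2 h2)] at h5
        linarith
      · exact le_rfl
    · exact hmin z ⟨hs.1.trans hwz, hz⟩
  have key : ∀ x y, s < x → x < y → y ≤ R₂ → α * φ x / x * (y - x) ≤ φ y - φ x := by
    intro x y hx hxy hy
    by_contra hcon
    push Not at hcon
    have hxI : x ∈ Ioo R₁ R₂ := ⟨hs.1.trans_lt hx, hxy.trans_le hy⟩
    rw [← div_lt_iff₀ (sub_pos.2 hxy)] at hcon
    obtain ⟨K, hK1, hK2⟩ := exists_between hcon
    have hK0 : 0 ≤ K :=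
      (div_nonneg (sub_nonneg.2 (hmono x y hx.le hxy.le hy)) (sub_nonneg.2 hxy.le)).trans hK1.le
    have hyI : y ∈ Icc R₁ R₂ := ⟨hxI.1.le.trans hxy.le, hy⟩
    -- slopes ending at `y` are continuous, hence smaller than `K` slightly to the right of `x`
    obtain ⟨y', hy', hxy', hy'y⟩ : ∃ y', (φ y - φ y') / (y - y') < K ∧ x < y' ∧ y' < y := by
      have hc : ContinuousAt (fun z => (φ y - φ z) / (y - z)) x := by
        have := h.continuousOn.continuousAt (Icc_mem_nhds hxI.1 hxI.2)
        exact (continuousAt_const.sub this).div (by fun_prop) (sub_pos.2 hxy).ne'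
      have he := (hc.eventually_lt continuousAt_const hK1).filter_mono
        (nhdsWithin_le_nhds (s := Ioi x))
      obtain ⟨y', h1, h2⟩ := (he.and (Ioo_mem_nhdsGT hxy)).exists
      exact ⟨y', h1, h2.1, h2.2⟩
    refine h.not_locLip hxI hK0 hK2 ⟨min (x - s) (y' - x), lt_min (by linarith) (by linarith), ?_⟩
    have hkey : ∀ w z, w ∈ Ioo (x - min (x - s) (y' - x)) (x + min (x - s) (y' - x)) →
        z ∈ Ioo (x - min (x - s) (y' - x)) (x + min (x - s) (y' - x)) → w < z →
        |φ w - φ z| ≤ K * |w - z| := by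
      intro w z hw hz hwz
      have hws : s < w := by linarith [hw.1, min_le_left (x - s) (y' - x)]
      have hzy' : z < y' := by linarith [hz.2, min_le_right (x - s) (y' - x)]
      have hwI : w ∈ Icc R₁ R₂ := ⟨hs.1.trans hws.le, (hwz.trans (hzy'.trans hy'y)).le.trans hy⟩
      have hzI : z ∈ Icc R₁ R₂ := ⟨hwI.1.trans hwz.le, (hzy'.trans hy'y).le.trans hy⟩
      have hy'I : y' ∈ Icc R₁ R₂ := ⟨hzI.1.trans hzy'.le, hy'y.le.trans hy⟩
      have h1 := h.convexOn.slope_mono_adjacent hwI hyI hwz (hzy'.trans hy'y)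
      have h2 := h.convexOn.secant_mono hyI hzI hy'I (hzy'.trans hy'y).ne hy'y.ne hzy'.le
      rw [← neg_div_neg_eq, neg_sub, neg_sub, ← neg_div_neg_eq (φ y' - φ y), neg_sub, neg_sub] at h2
      have h3 := (h1.trans h2).trans hy'.le
      rw [div_le_iff₀ (sub_pos.2 hwz)] at h3
      have h4 := hmono w z hws.le hwz.le hzI.2
      rw [abs_of_nonpos (by linarith), abs_of_nonpos (by linarith)]
      linarith
    intro w hw z hz
    rcases lt_trichotomy w z with h1 | rfl | h1
    · exact hkey w z hw hz h1
    · simp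
    · rw [abs_sub_comm, abs_sub_comm w]
      exact hkey z w hz hw h1
  intro x y hx hxy hy
  rcases hx.lt_or_eq with h1 | rfl
  · exact key x y h1 hxy hy
  · have hc := h.continuousOn.mono (Icc_subset_Icc hs.1 hy)
    have hne : ∀ r ∈ Icc s y, r ≠ 0 := fun r hr => (hR₁.trans_le (hs.1.trans hr.1)).ne'
    exact le_of_le_Ioo hxy (f := fun x => α * φ x / x * (y - x)) (g := fun x => φ y - φ x)
      (((continuousOn_const.mul hc).div continuousOn_id hne).mul (by fun_prop))
      (continuousOn_const.sub hc) (fun x hx => key x y hx.1 hx.2 hy) s ⟨le_rfl, hxy.le⟩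

/-- To the left of a minimum of `φ`, the radial stretch is at least the tangential one. -/
theorem le_sub_left (h : RadialConditions α R₁ R₂ φ) (hR₁ : 0 < R₁)
    (hs : s ∈ Icc R₁ R₂) (hmin : ∀ r ∈ Icc R₁ R₂, φ s ≤ φ r) :
    ∀ x y, R₁ ≤ x → x < y → y ≤ s → α * φ y / y * (y - x) ≤ φ x - φ y := by
  have hanti : ∀ w z, R₁ ≤ w → w ≤ z → z ≤ s → φ z ≤ φ w := by
    intro w z hw hwz hz
    rcases hz.lt_or_eq with h1 | rfl
    · rcases hwz.lt_or_eq with h2 | rfl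
      · have h3 := h.convexOn.slope_mono_adjacent ⟨hw, (hwz.trans hz).trans hs.2⟩ hs h2 h1
        have h4 : (φ s - φ z) / (s - z) ≤ 0 :=
          div_nonpos_of_nonpos_of_nonneg
            (sub_nonpos.2 (hmin z ⟨hw.trans hwz, hz.trans hs.2⟩)) (by linarith)
        have h5 := h3.trans h4
        rw [div_le_iff₀ (sub_pos.2 h2)] at h5
        linarith
      · exact le_rfl
    · exact hmin w ⟨hw, hwz.trans hs.2⟩
  have key : ∀ x y, R₁ ≤ x → x < y → y < s → α * φ y / y * (y - x) ≤ φ x - φ y := by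
    intro x y hx hxy hy
    by_contra hcon
    push Not at hcon
    have hyI : y ∈ Ioo R₁ R₂ := ⟨hx.trans_lt hxy, hy.trans_le hs.2⟩
    rw [← div_lt_iff₀ (sub_pos.2 hxy)] at hcon
    obtain ⟨K, hK1, hK2⟩ := exists_between hcon
    have hK0 : 0 ≤ K :=
      (div_nonneg (sub_nonneg.2 (hanti x y hx hxy.le hy.le)) (sub_nonneg.2 hxy.le)).trans hK1.le
    have hxI : x ∈ Icc R₁ R₂ := ⟨hx, hxy.le.trans hyI.2.le⟩
    -- slopes starting at `x` are continuous, hence greater than `-K` slightly to the left of `y`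
    obtain ⟨x', hx', hxx', hx'y⟩ : ∃ x', (φ x - φ x') / (x' - x) < K ∧ x < x' ∧ x' < y := by
      have hc : ContinuousAt (fun z => (φ x - φ z) / (z - x)) y := by
        have := h.continuousOn.continuousAt (Icc_mem_nhds hyI.1 hyI.2)
        exact (continuousAt_const.sub this).div (by fun_prop) (sub_pos.2 hxy).ne'
      have he := (hc.eventually_lt continuousAt_const hK1).filter_mono
        (nhdsWithin_le_nhds (s := Iio y))
      obtain ⟨x', h1, h2⟩ := (he.and (Ioo_mem_nhdsLT hxy)).exists
      exact ⟨x', h1, h2.1, h2.2⟩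
    refine h.not_locLip hyI hK0 hK2 ⟨min (y - x') (s - y), lt_min (by linarith) (by linarith), ?_⟩
    have hkey : ∀ w z, w ∈ Ioo (y - min (y - x') (s - y)) (y + min (y - x') (s - y)) →
        z ∈ Ioo (y - min (y - x') (s - y)) (y + min (y - x') (s - y)) → w < z →
        |φ w - φ z| ≤ K * |w - z| := by
      intro w z hw hz hwz
      have hwx' : x' < w := by linarith [hw.1, min_le_left (y - x') (s - y)]
      have hzs : z < s := by linarith [hz.2, min_le_right (y - x') (s - y)]
      have hzI : z ∈ Icc R₁ R₂ := ⟨(hx.trans hxx'.le).trans (hwx'.le.trans hwz.le), hzs.le.trans hs.2⟩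
      have hwI : w ∈ Icc R₁ R₂ := ⟨(hx.trans hxx'.le).trans hwx'.le, hwz.le.trans hzI.2⟩
      have hx'I : x' ∈ Icc R₁ R₂ := ⟨hx.trans hxx'.le, hwx'.le.trans hwI.2⟩
      have h1 := h.convexOn.slope_mono_adjacent hxI hzI (hxx'.trans hwx') hwz
      have h2 := h.convexOn.secant_mono hxI hx'I hwI hxx'.ne' (hxx'.trans hwx').ne' hwx'.le
      have h3 := h2.trans h1
      rw [le_div_iff₀ (sub_pos.2 hwz)] at h3
      have e : (φ x' - φ x) / (x' - x) = -((φ x - φ x') / (x' - x)) := by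
        rw [← neg_div, neg_sub]
      rw [e] at h3
      have h5 : (φ x - φ x') / (x' - x) * (z - w) ≤ K * (z - w) := by
        have := (sub_pos.2 hwz).le
        gcongr
      have h4 := hanti w z hwI.1 hwz.le hzs.le
      rw [abs_of_nonneg (by linarith), abs_of_nonpos (by linarith)]
      linarith
    intro w hw z hz
    rcases lt_trichotomy w z with h1 | rfl | h1
    · exact hkey w z hw hz h1
    · simp
    · rw [abs_sub_comm, abs_sub_comm w]
      exact hkey z w hz hw h1
  intro x y hx hxy hy
  rcases hy.lt_or_eq with h1 | rfl
  · exact key x y hx hxy h1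
  · have hc := h.continuousOn.mono (Icc_subset_Icc hx hs.2)
    have hne : ∀ r ∈ Icc x y, r ≠ 0 := fun r hr => (hR₁.trans_le (hx.trans hr.1)).ne'
    exact le_of_le_Ioo hxy (f := fun y => α * φ y / y * (y - x)) (g := fun y => φ x - φ y)
      (((continuousOn_const.mul hc).div continuousOn_id hne).mul (by fun_prop))
      (continuousOn_const.sub hc) (fun z hz => key x z hx hz.1 hz.2) y ⟨hxy.le, le_rfl⟩

/-- To the right of a minimum, `φ` is affine and then a multiple of `r ^ α`. -/
theorem exists_affine_power (h : RadialConditions α R₁ R₂ φ) (hR₁ : 0 < R₁)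
    (hs : s ∈ Icc R₁ R₂) (hmin : ∀ r ∈ Icc R₁ R₂, φ s ≤ φ r) :
    ∃ B ∈ Icc s R₂, ∃ m k, (∀ r ∈ Icc s B, φ r = φ s + m * (r - s)) ∧ PowerOn φ B R₂ k α ∧
      (s < B → B < R₂ → m = α * φ B / B) := by
  have hle := h.le_sub_right hR₁ hs hmin
  have hs0 : 0 < s := hR₁.trans_le hs.1
  have hcont := h.continuousOn.mono (Icc_subset_Icc_left hs.1)
  have hcg : ContinuousOn (fun r => α * φ r / r) (Icc s R₂) :=
    (continuousOn_const.mul hcont).div continuousOn_id fun r hr => (hs0.trans_le hr.1).ne'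
  obtain ⟨B, hB, ⟨m, hm⟩, hmax⟩ := exists_maximal_affine_right hs.2 hcont
  have hup : ∀ y ∈ Ioc B R₂, ∀ x ∈ Icc s y, φ y - φ x ≤ α * φ y / y * (y - x) := by
    intro y hy x hx
    have hsy : s < y := hB.1.trans_lt hy.1
    rcases h.affine_or_lipschitz hs.1 hy.2 hsy with h1 | h1
    · exact absurd ⟨_, h1⟩ (hmax y hy)
    rcases le_total (α * φ s / s) (α * φ y / y) with h2 | h2
    · rw [max_eq_right h2] at h1
      have h3 := h1 y ⟨hsy.le, le_rfl⟩ x hx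
      rw [abs_of_nonneg (a := y - x) (by linarith [hx.2])] at h3
      exact (le_abs_self _).trans h3
    · rw [max_eq_left h2] at h1
      refine absurd ⟨α * φ s / s, fun r hr => ?_⟩ (hmax y hy)
      have h3 := h1 r hr s ⟨le_rfl, hsy.le⟩
      rw [abs_of_nonneg (a := r - s) (by linarith [hr.1])] at h3
      have h4 := (le_abs_self _).trans h3
      rcases hr.1.lt_or_eq with h5 | rfl
      · have := hle s r le_rfl h5 (hr.2.trans hy.2)
        linarith
      · ring
  have hB0 : 0 < B := hs0.trans_le hB.1
  obtain ⟨k, hk⟩ : ∃ k, PowerOn φ B R₂ k α := by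
    rcases hB.2.lt_or_eq with _ | heq
    · exact powerOn_of_slope_bounds hB0 (hcont.mono (Icc_subset_Icc_left hB.1))
        fun x hx y hy hxy => ⟨hle x y (hB.1.trans hx.1.le) hxy hy.2.le,
          hup y ⟨hy.1, hy.2.le⟩ x ⟨hB.1.trans hx.1.le, hxy.le⟩⟩
    · refine ⟨φ B / B ^ α, fun r hr => ?_⟩
      have : r = B := le_antisymm (hr.2.trans_eq heq.symm) hr.1
      rw [this]
      have : 0 < B ^ α := by positivity
      field_simp
  refine ⟨B, hB, m, k, hm, hk, fun hsB hBR => le_antisymm ?_ ?_⟩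
  · have h1 := le_of_le_Ioo hBR (f := fun y => φ y - φ s) (g := fun y => α * φ y / y * (y - s))
      ((hcont.mono (Icc_subset_Icc_left hB.1)).sub continuousOn_const)
      ((hcg.mono (Icc_subset_Icc_left hB.1)).mul (by fun_prop))
      (fun y hy => hup y ⟨hy.1, hy.2.le⟩ s ⟨le_rfl, hB.1.trans hy.1.le⟩) B ⟨le_rfl, hBR.le⟩
    simp only [hm B ⟨hB.1, le_rfl⟩, add_sub_cancel_left] at h1 ⊢
    exact le_of_mul_le_mul_right h1 (sub_pos.2 hsB)
  · refine le_of_le_Ioo hsB (f := fun x => α * φ x / x) (g := fun _ => m)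
      (hcg.mono (Icc_subset_Icc_right hB.2)) continuousOn_const (fun x hx => ?_) B ⟨hsB.le, le_rfl⟩
    have h1 := hle x B hx.1.le hx.2 hB.2
    rw [hm B ⟨hB.1, le_rfl⟩, hm x ⟨hx.1.le, hx.2.le⟩,
      show φ s + m * (B - s) - (φ s + m * (x - s)) = m * (B - x) by ring,
      ← hm x ⟨hx.1.le, hx.2.le⟩] at h1
    exact le_of_mul_le_mul_right h1 (sub_pos.2 hx.2)

/-- To the left of a minimum, `φ` is a multiple of `r ^ (-α)` and then affine. -/
theorem exists_power_affine (h : RadialConditions α R₁ R₂ φ) (hα : 0 < α) (hR₁ : 0 < R₁)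
    (hs : s ∈ Icc R₁ R₂) (hmin : ∀ r ∈ Icc R₁ R₂, φ s ≤ φ r) :
    ∃ A ∈ Icc R₁ s, ∃ m k, (∀ r ∈ Icc A s, φ r = φ s + m * (r - s)) ∧ PowerOn φ R₁ A k (-α) ∧
      (R₁ < A → A < s → m = -(α * φ A / A)) := by
  have hle := h.le_sub_left hR₁ hs hmin
  have hcont := h.continuousOn.mono (Icc_subset_Icc_right hs.2)
  have hcg : ContinuousOn (fun r => α * φ r / r) (Icc R₁ s) :=
    (continuousOn_const.mul hcont).div continuousOn_id fun r hr => (hR₁.trans_le hr.1).ne'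
  obtain ⟨A, hA, ⟨m, hm⟩, hmax⟩ := exists_maximal_affine_left hs.1 hcont
  have hup : ∀ x ∈ Ico R₁ A, ∀ y ∈ Icc x s, φ x - φ y ≤ α * φ x / x * (y - x) := by
    intro x hx y hy
    have hxs : x < s := hx.2.trans_le hA.2
    have hx0 : 0 < x := hR₁.trans_le hx.1
    have hgx : α * φ s / s ≤ α * φ x / x := by
      have h1 := hmin x ⟨hx.1, hxs.le.trans hs.2⟩
      have h2 := h.nonneg s hs
      have h3 := h2.trans h1
      gcongr
    rcases h.affine_or_lipschitz hx.1 hs.2 hxs with h1 | h1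
    · refine absurd ⟨slope φ x s, fun r hr => ?_⟩ (hmax x hx)
      rw [h1 r hr]
      have e := chord_right φ hxs
      rw [chord] at e ⊢
      linear_combination e
    · rw [max_eq_left hgx] at h1
      have h3 := h1 x ⟨le_rfl, hxs.le⟩ y hy
      rw [abs_of_nonpos (a := x - y) (by linarith [hy.1]), neg_sub] at h3
      exact (le_abs_self _).trans h3
  have hA0 : 0 < A := hR₁.trans_le hA.1
  obtain ⟨k, hk⟩ : ∃ k, PowerOn φ R₁ A k (-α) := by
    rcases hA.1.lt_or_eq with _ | heq
    · refine powerOn_of_slope_bounds hR₁ (hcont.mono (Icc_subset_Icc_right hA.2))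
        fun x hx y hy hxy => ?_
      have h1 := hle x y hx.1.le hxy (hy.2.le.trans hA.2)
      have h2 := hup x ⟨hx.1.le, hx.2⟩ y ⟨hxy.le, hy.2.le.trans hA.2⟩
      rw [neg_mul, neg_mul, neg_div, neg_div]
      constructor <;> linarith
    · refine ⟨φ A / A ^ (-α), fun r hr => ?_⟩
      have : r = A := le_antisymm hr.2 (heq.symm.trans_le hr.1)
      rw [this]
      have : 0 < A ^ (-α) := by positivity
      field_simp
  refine ⟨A, hA, m, k, hm, hk, fun hRA hAs => ?_⟩
  have hmA : φ A - φ s = -m * (s - A) := by rw [hm A ⟨le_rfl, hA.2⟩]; ring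
  have h3 : -m = α * φ A / A := by
    apply le_antisymm
    · have h1 := le_of_le_Ioo hRA (f := fun x => φ x - φ s) (g := fun x => α * φ x / x * (s - x))
        ((hcont.mono (Icc_subset_Icc_right hA.2)).sub continuousOn_const)
        ((hcg.mono (Icc_subset_Icc_right hA.2)).mul (by fun_prop))
        (fun x hx => hup x ⟨hx.1.le, hx.2⟩ s ⟨hx.2.le.trans hA.2, le_rfl⟩) A ⟨hRA.le, le_rfl⟩
      rw [hmA] at h1
      exact le_of_mul_le_mul_right h1 (sub_pos.2 hAs)
    · refine le_of_le_Ioo hAs (f := fun x => α * φ x / x) (g := fun _ => -m)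
        (hcg.mono (Icc_subset_Icc_left hA.1)) continuousOn_const (fun y hy => ?_) A ⟨le_rfl, hAs.le⟩
      have h1 := hle A y hA.1 hy.1 hy.2.le
      have e : φ A - φ y = -m * (y - A) := by
        rw [hm A ⟨le_rfl, hA.2⟩, hm y ⟨hy.1.le, hy.2.le⟩]; ring
      rw [e] at h1
      exact le_of_mul_le_mul_right h1 (sub_pos.2 hy.1)
  linarith

end RadialConditions

/-! ### The classification -/

theorem hasDerivAt_power {k β R φR : ℝ} (hR : R ≠ 0) (hφR : φR = k * R ^ β) :
    HasDerivAt (fun r : ℝ => k * r ^ β) (β * φR / R) R := by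
  refine ((Real.hasDerivAt_rpow_const (p := β) (Or.inl hR)).const_mul k).congr_deriv ?_
  rw [Real.rpow_sub_one hR, hφR]
  ring

theorem isTightPower_of_eq_zero (h : ∀ r ∈ Icc R₁ R₂, φ r = 0) : IsTightPower α R₁ R₂ φ :=
  ⟨0, α, Or.inl rfl, Or.inl rfl, fun r hr => by rw [h r hr, zero_mul]⟩

/-- If the radial direction dominates weakly, it dominates strictly everywhere, or `φ(r) = m r` with
`m = 0` or `α = 1`. -/
theorem isPrincipalAffine_or_isTightPower (hα : 0 < α) (hR₁ : 0 < R₁) {m c : ℝ}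
    (h : AffineOn φ R₁ R₂ m c) (hle : ∀ r ∈ Ioo R₁ R₂, α * φ r / r ≤ |m|) :
    IsPrincipalAffine α R₁ R₂ φ ∨ IsTightPower α R₁ R₂ φ := by
  by_cases hlt : ∀ r ∈ Ioo R₁ R₂, α * (m * r + c) / r < |m|
  · exact Or.inl ⟨m, c, h, hlt⟩
  right
  push Not at hlt
  obtain ⟨x, hx, hxge⟩ := hlt
  have hle' : ∀ r ∈ Ioo R₁ R₂, α * (m * r + c) ≤ |m| * r := by
    intro r hr
    have h1 := hle r hr
    rwa [h r (Ioo_subset_Icc_self hr), div_le_iff₀ (hR₁.trans hr.1)] at h1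
  rw [le_div_iff₀ (hR₁.trans hx.1)] at hxge
  obtain ⟨y, hxy, hy⟩ := exists_between hx.2
  obtain ⟨w, hw, hwx⟩ := exists_between hx.1
  have hy' := hle' y ⟨hx.1.trans hxy, hy⟩
  have hw' := hle' w ⟨hw, hwx.trans hx.2⟩
  -- the affine function `|m| r - α (m r + c)` is nonnegative and vanishes inside the interval
  have hm1 : α * m ≤ |m| := by
    have : (α * m) * (y - x) ≤ |m| * (y - x) := by nlinarith
    exact le_of_mul_le_mul_right this (sub_pos.2 hxy)
  have hm2 : |m| ≤ α * m := by
    have : |m| * (x - w) ≤ (α * m) * (x - w) := by nlinarith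
    exact le_of_mul_le_mul_right this (sub_pos.2 hwx)
  have hmα : |m| = α * m := le_antisymm hm2 hm1
  have hc : c = 0 := by
    have h1 := hle' x hx
    rw [hmα] at h1 hxge
    have : α * c = 0 := by nlinarith
    exact (mul_eq_zero.1 this).resolve_left hα.ne'
  have hm0 : 0 ≤ m := by
    have : 0 ≤ α * m := hmα ▸ abs_nonneg m
    exact nonneg_of_mul_nonneg_right this hα
  rw [abs_of_nonneg hm0] at hmα
  rcases hm0.lt_or_eq with h1 | h1
  · have hα1 : α = 1 := by
      have : (α - 1) * m = 0 := by linarith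
      have := (mul_eq_zero.1 this).resolve_right h1.ne'
      linarith
    refine ⟨m, α, Or.inl rfl, Or.inr fun hmem => hmem.2.ne hα1, fun r hr => ?_⟩
    rw [h r hr, hc, hα1, Real.rpow_one, add_zero]
  · exact isTightPower_of_eq_zero fun r hr => by rw [h r hr, hc, ← h1]; ring

/-- For `α < 1` the power `r ^ α` is not convex. -/
theorem PowerOn.one_le {a b k : ℝ} (ha : 0 < a) (hab : a < b) (hk : 0 < k) (hα : 0 < α)
    (hφ : ConvexOn ℝ (Icc a b) φ) (h : PowerOn φ a b k α) : 1 ≤ α := by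
  by_contra hcon
  have hs := (Real.strictConcaveOn_rpow hα (not_le.1 hcon)).2 (x := a) (y := b)
    (mem_Ici.2 ha.le) (mem_Ici.2 (ha.trans hab).le) hab.ne
    (show (0 : ℝ) < 1 / 2 by norm_num) (show (0 : ℝ) < 1 / 2 by norm_num) (by norm_num)
  have hc := hφ.2 (x := a) (y := b) ⟨le_rfl, hab.le⟩ ⟨hab.le, le_rfl⟩
    (show (0 : ℝ) ≤ 1 / 2 by norm_num) (show (0 : ℝ) ≤ 1 / 2 by norm_num) (by norm_num)
  simp only [smul_eq_mul] at hs hc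
  rw [h a ⟨le_rfl, hab.le⟩, h b ⟨hab.le, le_rfl⟩, h _ ⟨by linarith, by linarith⟩] at hc
  have := mul_lt_mul_of_pos_left hs hk
  linarith

namespace RadialConditions

variable {s : ℝ}

/-- The classification when `φ` is nondecreasing. -/
theorem classify_of_min_left (h : RadialConditions α R₁ R₂ φ) (hα : 0 < α) (hR₁ : 0 < R₁)
    (hR : R₁ < R₂) (hmin : ∀ r ∈ Icc R₁ R₂, φ R₁ ≤ φ r) :
    (IsPrincipalAffine α R₁ R₂ φ ∨ IsTightPower α R₁ R₂ φ) ∨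
      ∃ R ∈ Ioo R₁ R₂, 1 ≤ α ∧ GlueIncreasingPower α R₁ R R₂ φ := by
  have hs : R₁ ∈ Icc R₁ R₂ := ⟨le_rfl, hR.le⟩
  have hle := h.le_sub_right hR₁ hs hmin
  obtain ⟨B, hB, m, k, hm, hk, hmB⟩ := h.exists_affine_power hR₁ hs hmin
  have haff : AffineOn φ R₁ B m (φ R₁ - m * R₁) := fun r hr => by rw [hm r hr]; ring
  have hB0 : 0 < B := hR₁.trans_le hB.1
  have hk0 : 0 ≤ k := by
    have h1 := h.nonneg B hB
    rw [hk B ⟨le_rfl, hB.2⟩] at h1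
    exact nonneg_of_mul_nonneg_left h1 (by positivity)
  rcases hB.2.lt_or_eq with hBR | rfl
  · rcases hk0.lt_or_eq with hk0 | hk0
    · have hα1 := hk.one_le hB0 hBR hk0 hα (h.convexOn.subset (Icc_subset_Icc_left hB.1)
        (convex_Icc _ _))
      rcases hB.1.lt_or_eq with hRB | rfl
      · have hφB := hk B ⟨le_rfl, hBR.le⟩
        have hmB' := hmB hRB hBR
        have hφB0 : 0 < φ B := by rw [hφB]; positivity
        refine Or.inr ⟨B, ⟨hRB, hBR⟩, hα1, k, m, _, hk0, by rw [hmB']; positivity, haff, hk, ?_⟩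
        rw [hmB']
        exact hasDerivAt_power hB0.ne' hφB
      · exact Or.inl (Or.inr ⟨k, α, Or.inl rfl, Or.inr fun hc => absurd hc.2 (not_lt.2 hα1), hk⟩)
    · have hφB : φ B = 0 := by rw [hk B ⟨le_rfl, hBR.le⟩, ← hk0, zero_mul]
      have hφR : φ R₁ = 0 := le_antisymm (hφB ▸ hmin B hB) (h.nonneg _ hs)
      refine Or.inl (Or.inr (isTightPower_of_eq_zero fun r hr => ?_))
      rcases le_total r B with h1 | h1
      · rcases hB.1.lt_or_eq with hRB | rfl
        · rw [hm r ⟨hr.1, h1⟩, hmB hRB hBR, hφB, hφR]; simp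
        · rw [le_antisymm h1 hr.1, hφR]
      · rw [hk r ⟨h1, hr.2⟩, ← hk0, zero_mul]
  · refine Or.inl (isPrincipalAffine_or_isTightPower hα hR₁ haff fun r hr => ?_)
    have h1 := hle r B hr.1.le hr.2 le_rfl
    have e : φ B - φ r = m * (B - r) := by
      rw [hm B ⟨hB.1, le_rfl⟩, hm r (Ioo_subset_Icc_self hr)]; ring
    rw [e] at h1
    exact (le_of_mul_le_mul_right h1 (sub_pos.2 hr.2)).trans (le_abs_self m)

/-- The classification when `φ` is nonincreasing. -/
theorem classify_of_min_right (h : RadialConditions α R₁ R₂ φ) (hα : 0 < α) (hR₁ : 0 < R₁)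
    (hR : R₁ < R₂) (hmin : ∀ r ∈ Icc R₁ R₂, φ R₂ ≤ φ r) :
    (IsPrincipalAffine α R₁ R₂ φ ∨ IsTightPower α R₁ R₂ φ) ∨
      ∃ R ∈ Ioo R₁ R₂, GluePowerDecreasing α R₁ R R₂ φ := by
  have hs : R₂ ∈ Icc R₁ R₂ := ⟨hR.le, le_rfl⟩
  have hle := h.le_sub_left hR₁ hs hmin
  obtain ⟨A, hA, m, k, hm, hk, hmA⟩ := h.exists_power_affine hα hR₁ hs hmin
  have haff : AffineOn φ A R₂ m (φ R₂ - m * R₂) := fun r hr => by rw [hm r hr]; ring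
  have hA0 : 0 < A := hR₁.trans_le hA.1
  have hk0 : 0 ≤ k := by
    have h1 := h.nonneg A hA
    rw [hk A ⟨hA.1, le_rfl⟩] at h1
    exact nonneg_of_mul_nonneg_left h1 (by positivity)
  rcases hA.1.lt_or_eq with hRA | rfl
  · rcases hA.2.lt_or_eq with hAR | rfl
    · have hφA := hk A ⟨hRA.le, le_rfl⟩
      have hmA' := hmA hRA hAR
      rcases hk0.lt_or_eq with hk0 | hk0
      · have hφA0 : 0 < φ A := by rw [hφA]; positivity
        have hm0 : m < 0 := by
          rw [hmA']
          have : 0 < α * φ A / A := by positivity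
          linarith
        refine Or.inr ⟨A, ⟨hRA, hAR⟩, k, m, _, hk0, hm0, hk, haff, ?_⟩
        rw [hmA', show -(α * φ A / A) = -α * φ A / A by ring]
        exact hasDerivAt_power hA0.ne' hφA
      · rw [← hk0, zero_mul] at hφA
        have hφR : φ R₂ = 0 := le_antisymm (hφA ▸ hmin A hA) (h.nonneg _ hs)
        refine Or.inl (Or.inr (isTightPower_of_eq_zero fun r hr => ?_))
        rcases le_total A r with h1 | h1
        · rw [hm r ⟨h1, hr.2⟩, hmA', hφA, hφR]; simp
        · rw [hk r ⟨hr.1, h1⟩, ← hk0, zero_mul]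
    · exact Or.inl (Or.inr ⟨k, -α, Or.inr rfl, Or.inr fun hc => by linarith [hc.1], hk⟩)
  · refine Or.inl (isPrincipalAffine_or_isTightPower hα hR₁ haff fun r hr => ?_)
    have h1 := hle R₁ r le_rfl hr.1 hr.2.le
    have e : φ R₁ - φ r = -m * (r - R₁) := by
      rw [hm R₁ ⟨le_rfl, hR.le⟩, hm r (Ioo_subset_Icc_self hr)]; ring
    rw [e] at h1
    exact (le_of_mul_le_mul_right h1 (sub_pos.2 hr.1)).trans (neg_le_abs m)

/-- At an interior minimum, the radial stretch is at most the tangential one. -/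
theorem locLip_of_interior_min (h : RadialConditions α R₁ R₂ φ) (hR₁ : 0 < R₁)
    (hs : s ∈ Ioo R₁ R₂) (hmin : ∀ r ∈ Icc R₁ R₂, φ s ≤ φ r) {K : ℝ} (hK : α * φ s / s < K)
    (hK0 : 0 ≤ K) : LocLip φ s K := by
  have hc : ContinuousAt (fun r => α * φ r / r) s :=
    (continuousAt_const.mul (h.continuousOn.continuousAt (Icc_mem_nhds hs.1 hs.2))).div
      continuousAt_id (hR₁.trans hs.1).ne'
  obtain ⟨δ₁, hδ₁, h₁⟩ := Metric.eventually_nhds_iff.1 (hc.eventually_lt continuousAt_const hK)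
  obtain ⟨δ, hδ, hδlt⟩ := exists_between (lt_min hδ₁ (lt_min (sub_pos.2 hs.1) (sub_pos.2 hs.2)))
  simp only [lt_min_iff] at hδlt
  obtain ⟨hδ1, hδ2, hδ3⟩ := hδlt
  refine ⟨δ, hδ, fun y hy z hz => ?_⟩
  have hyI : y ∈ Icc (s - δ) (s + δ) := Ioo_subset_Icc_self hy
  have hzI : z ∈ Icc (s - δ) (s + δ) := Ioo_subset_Icc_self hz
  rcases h.affine_or_lipschitz (a := s - δ) (b := s + δ) (by linarith) (by linarith)
    (by linarith) with h2 | h2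
  · -- an affine function with an interior minimum is constant
    have ha := hmin (s - δ) ⟨by linarith, by linarith⟩
    have hb := hmin (s + δ) ⟨by linarith, by linarith⟩
    rw [h2 s ⟨by linarith, by linarith⟩] at ha hb
    rw [h2 (s + δ) ⟨by linarith, le_rfl⟩] at hb
    simp only [chord] at ha hb
    have hsl : slope φ (s - δ) (s + δ) = 0 := by
      apply le_antisymm
      · by_contra hcon
        nlinarith [not_le.1 hcon]
      · by_contra hcon
        nlinarith [not_le.1 hcon]
    rw [h2 y hyI, h2 z hzI, abs_chord_sub, hsl, abs_zero, zero_mul]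
    positivity
  · refine (h2 y hyI z hzI).trans ?_
    have h3 : max (α * φ (s - δ) / (s - δ)) (α * φ (s + δ) / (s + δ)) ≤ K := by
      refine max_le (h₁ ?_).le (h₁ ?_).le
      · rw [Real.dist_eq, abs_lt]; constructor <;> linarith
      · rw [Real.dist_eq, abs_lt]; constructor <;> linarith
    gcongr

/-- The classification when the minimum of `φ` is attained inside the interval. -/
theorem classify_of_interior_min (h : RadialConditions α R₁ R₂ φ) (hα : 0 < α) (hR₁ : 0 < R₁)
    (hs : s ∈ Ioo R₁ R₂) (hmin : ∀ r ∈ Icc R₁ R₂, φ s ≤ φ r) :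
    IsTightPower α R₁ R₂ φ ∨ GluePowers α R₁ s R₂ φ ∨
      (α ∈ Ioo (0 : ℝ) 1 ∧ GluePowerIncreasing α R₁ s R₂ φ) := by
  have hsI := Ioo_subset_Icc_self hs
  have hs0 : 0 < s := hR₁.trans hs.1
  have hleL := h.le_sub_left hR₁ hsI hmin
  have hleR := h.le_sub_right hR₁ hsI hmin
  obtain ⟨A, hA, m₁, k₁, hm₁, hk₁, -⟩ := h.exists_power_affine hα hR₁ hsI hmin
  obtain ⟨B, hB, m₂, k₂, hm₂, hk₂, -⟩ := h.exists_affine_power hR₁ hsI hmin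
  have hA0 : 0 < A := hR₁.trans_le hA.1
  have hB0 : 0 < B := hs0.trans_le hB.1
  have hφs := h.nonneg s hsI
  set g := α * φ s / s with hg
  have hg0 : 0 ≤ g := by positivity
  -- the one-sided slopes at the minimum are `g` up to sign
  have hm₂g : s < B → m₂ = g := by
    intro hsB
    apply le_antisymm
    · by_contra hcon
      obtain ⟨K, hK1, hK2⟩ := exists_between (not_le.1 hcon)
      obtain ⟨δ, hδ, hL⟩ := h.locLip_of_interior_min hR₁ hs hmin hK1 (hg0.trans hK1.le)
      obtain ⟨y, hy1, hy2⟩ := exists_between (lt_min hsB (show s < s + δ by linarith))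
      rw [lt_min_iff] at hy2
      have h1 := (le_abs_self _).trans (hL y ⟨by linarith, hy2.2⟩ s ⟨by linarith, by linarith⟩)
      rw [hm₂ y ⟨hy1.le, hy2.1.le⟩, abs_of_pos (sub_pos.2 hy1), add_sub_cancel_left] at h1
      exact absurd (le_of_mul_le_mul_right h1 (sub_pos.2 hy1)) (not_le.2 hK2)
    · have h1 := hleR s B le_rfl hsB hB.2
      rw [hm₂ B ⟨hsB.le, le_rfl⟩, add_sub_cancel_left] at h1
      exact le_of_mul_le_mul_right h1 (sub_pos.2 hsB)
  have hm₁g : A < s → -m₁ = g := by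
    intro hAs
    have e : ∀ y ∈ Icc A s, φ y - φ s = -m₁ * (s - y) := by
      intro y hy
      rw [hm₁ y hy]; ring
    apply le_antisymm
    · by_contra hcon
      obtain ⟨K, hK1, hK2⟩ := exists_between (not_le.1 hcon)
      obtain ⟨δ, hδ, hL⟩ := h.locLip_of_interior_min hR₁ hs hmin hK1 (hg0.trans hK1.le)
      obtain ⟨y, hy1, hy2⟩ := exists_between (max_lt hAs (show s - δ < s by linarith))
      rw [max_lt_iff] at hy1
      have h1 := (le_abs_self _).trans (hL y ⟨hy1.2, by linarith⟩ s ⟨by linarith, by linarith⟩)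
      rw [e y ⟨hy1.1.le, hy2.le⟩, abs_sub_comm, abs_of_pos (sub_pos.2 hy2)] at h1
      exact absurd (le_of_mul_le_mul_right h1 (sub_pos.2 hy2)) (not_le.2 hK2)
    · have h1 := hleL A s hA.1 hAs le_rfl
      rw [e A ⟨le_rfl, hAs.le⟩] at h1
      exact le_of_mul_le_mul_right h1 (sub_pos.2 hAs)
  rcases hφs.lt_or_eq with hpos | hzero
  · right
    -- an affine part on the left would have the stretch `g`, less than the tangential stretch
    have hAs : A = s := by
      by_contra hne
      have hAs : A < s := lt_of_le_of_ne hA.2 hne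
      obtain ⟨y, hy1, hy2⟩ := exists_between hAs
      have h1 := hleL A y hA.1 hy1 hy2.le
      have e : φ A - φ y = g * (y - A) := by
        rw [hm₁ A ⟨le_rfl, hAs.le⟩, hm₁ y ⟨hy1.le, hy2.le⟩, ← hm₁g hAs]; ring
      rw [e] at h1
      have h2 := le_of_mul_le_mul_right h1 (sub_pos.2 hy1)
      have h3 : φ s ≤ φ y := hmin y ⟨hA.1.trans hy1.le, hy2.le.trans hs.2.le⟩
      have hy0 : 0 < y := hA0.trans hy1
      have h4 : g < α * φ y / y := by
        rw [hg, div_lt_div_iff₀ hs0 hy0]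
        have h5 : 0 < α * φ s := by positivity
        have h6 : α * φ s ≤ α * φ y := by gcongr
        nlinarith
      exact absurd h2 (not_le.2 h4)
    rw [hAs] at hk₁
    have hφs₁ := hk₁ s ⟨hs.1.le, le_rfl⟩
    have hk₁0 : 0 < k₁ := by
      rw [hφs₁] at hpos
      exact pos_of_mul_pos_left hpos (by positivity)
    have hk₂0 : 0 < k₂ := by
      have h1 := hpos.trans_le (hmin B ⟨hs.1.le.trans hB.1, hB.2⟩)
      rw [hk₂ B ⟨le_rfl, hB.2⟩] at h1
      exact pos_of_mul_pos_left h1 (by positivity)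
    have hcB := h.convexOn.subset (Icc_subset_Icc_left (hs.1.le.trans hB.1)) (convex_Icc B R₂)
    rcases hB.1.lt_or_eq with hsB | rfl
    · have hm := hm₂g hsB
      have hgs : α * φ s = g * s := by rw [hg]; field_simp
      have hgpos : 0 < g := by positivity
      have hα1 : α ≤ 1 := by
        obtain ⟨x, hx1, hx2⟩ := exists_between hsB
        have h1 := hleR x B hx1.le hx2 hB.2
        have e : φ B - φ x = g * (B - x) := by
          rw [hm₂ B ⟨hsB.le, le_rfl⟩, hm₂ x ⟨hx1.le, hx2.le⟩, hm]; ring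
        rw [e] at h1
        have h2 := le_of_mul_le_mul_right h1 (sub_pos.2 hx2)
        rw [div_le_iff₀ (hs0.trans hx1), hm₂ x ⟨hx1.le, hx2.le⟩, hm, mul_add, hgs] at h2
        have h3 : α * (g * (x - s)) ≤ 1 * (g * (x - s)) := by linarith
        exact le_of_mul_le_mul_right h3 (mul_pos hgpos (sub_pos.2 hx1))
      rcases hα1.lt_or_eq with hα1 | hα1
      · right
        rcases hB.2.lt_or_eq with hBR | rfl
        · exact absurd (hk₂.one_le hB0 hBR hk₂0 hα hcB) (not_le.2 hα1)
        · refine ⟨⟨hα, hα1⟩, k₁, m₂, φ s - m₂ * s, hk₁0, hm ▸ hgpos, hk₁,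
            fun r hr => by rw [hm₂ r hr]; ring, ?_⟩
          rw [hm, hg, show -(α * φ s / s) = -α * φ s / s by ring]
          exact hasDerivAt_power hs0.ne' hφs₁
      · -- for `α = 1` the affine part lies on a line through the origin
        left
        have hline : ∀ r ∈ Icc s B, φ r = g * r := by
          intro r hr
          rw [hm₂ r hr, hm]
          rw [hα1, one_mul] at hgs
          linarith
        refine ⟨hα1.ge, k₁, g, hk₁0, hgpos, hk₁, fun r hr => ?_⟩
        rw [hα1, Real.rpow_one]
        rcases le_total r B with h1 | h1
        · exact hline r ⟨hr.1, h1⟩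
        · have h2 := hk₂ B ⟨le_rfl, hB.2⟩
          rw [hline B ⟨hsB.le, le_rfl⟩, hα1, Real.rpow_one] at h2
          rw [hk₂ r ⟨h1, hr.2⟩, hα1, Real.rpow_one, ← mul_right_cancel₀ hB0.ne' h2]
    · exact Or.inl ⟨hk₂.one_le hs0 hs.2 hk₂0 hα hcB, k₁, k₂, hk₁0, hk₂0, hk₁, hk₂⟩
  · left
    have hgz : g = 0 := by rw [hg, ← hzero]; simp
    have hzA : ∀ r ∈ Icc A s, φ r = 0 := by
      intro r hr
      rcases hA.2.lt_or_eq with h1 | h1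
      · rw [hm₁ r hr, ← neg_neg m₁, hm₁g h1, hgz, ← hzero]; simp
      · rw [le_antisymm hr.2 (h1.symm.trans_le hr.1), ← hzero]
    have hzB : ∀ r ∈ Icc s B, φ r = 0 := by
      intro r hr
      rcases hB.1.lt_or_eq with h1 | h1
      · rw [hm₂ r hr, hm₂g h1, hgz, ← hzero]; simp
      · rw [le_antisymm (hr.2.trans_eq h1.symm) hr.1, ← hzero]
    have hk₁z : k₁ = 0 := by
      have h1 := hk₁ A ⟨hA.1, le_rfl⟩
      rw [hzA A ⟨le_rfl, hA.2⟩] at h1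
      exact (mul_eq_zero.1 h1.symm).resolve_right (by positivity)
    have hk₂z : k₂ = 0 := by
      have h1 := hk₂ B ⟨le_rfl, hB.2⟩
      rw [hzB B ⟨hB.1, le_rfl⟩] at h1
      exact (mul_eq_zero.1 h1.symm).resolve_right (by positivity)
    refine isTightPower_of_eq_zero fun r hr => ?_
    rcases le_total r A with h1 | h1
    · rw [hk₁ r ⟨hr.1, h1⟩, hk₁z, zero_mul]
    rcases le_total r s with h2 | h2
    · exact hzA r ⟨h1, h2⟩
    rcases le_total r B with h3 | h3
    · exact hzB r ⟨h2, h3⟩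
    · rw [hk₂ r ⟨h3, hr.2⟩, hk₂z, zero_mul]

end RadialConditions

theorem isTight_of_eq_zero (hα : 0 < α) (hR₁ : 0 < R₁) (hR : R₁ < R₂)
    (h : ∀ r ∈ Icc R₁ R₂, φ r = 0) : IsTight α R₁ R₂ (radialMap α φ) := by
  have hφ : ∀ r ∈ Icc R₁ R₂, 0 ≤ φ r := fun r hr => (h r hr).ge
  refine IsTightProfile.isTight (A := R₁) (B := R₂) (k₁ := 1) (m := 0) (c := 0) (k₂ := 1) ?_
    hα hR₁ hφ
  refine ⟨le_rfl, hR.le, le_rfl, fun h => absurd h (lt_irrefl _), fun h => absurd h (lt_irrefl _),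
    fun _ r hr => by rw [h r hr]; ring, fun _ r hr => by rw [h r (Ioo_subset_Icc_self hr)]; simp,
    fun h => absurd h (lt_irrefl _), fun _ h => absurd h (lt_irrefl _),
    fun h => absurd h (lt_irrefl _), fun h => absurd h (lt_irrefl _),
    fun h => absurd h (lt_irrefl _)⟩

theorem IsPrincipalAffine.isTight (hα : 0 < α) (hR₁ : 0 < R₁) (hR : R₁ < R₂)
    (hφ : ∀ r ∈ Icc R₁ R₂, 0 ≤ φ r) (h : IsPrincipalAffine α R₁ R₂ φ) :
    IsTight α R₁ R₂ (radialMap α φ) := by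
  obtain ⟨k, k₀, hk, hlt⟩ := h
  refine IsTightProfile.isTight (A := R₁) (B := R₂) (k₁ := 1) (m := k) (c := k₀) (k₂ := 1) ?_
    hα hR₁ hφ
  refine ⟨le_rfl, hR.le, le_rfl, fun h => absurd h (lt_irrefl _), fun h => absurd h (lt_irrefl _),
    fun _ => hk, fun _ r hr => ?_,
    fun h => absurd h (lt_irrefl _), fun _ h => absurd h (lt_irrefl _),
    fun h => absurd h (lt_irrefl _), fun h => absurd h (lt_irrefl _),
    fun h => absurd h (lt_irrefl _)⟩
  rw [hk r (Ioo_subset_Icc_self hr)]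
  exact (hlt r hr).le

theorem IsTightPower.isTight (hα : 0 < α) (hR₁ : 0 < R₁) (hR : R₁ < R₂)
    (hφ : ∀ r ∈ Icc R₁ R₂, 0 ≤ φ r) (h : IsTightPower α R₁ R₂ φ) :
    IsTight α R₁ R₂ (radialMap α φ) := by
  obtain ⟨k, β, hβ, hkβ, hk⟩ := h
  have hk0 : 0 ≤ k := by
    have h1 := hφ R₁ ⟨le_rfl, hR.le⟩
    rw [hk R₁ ⟨le_rfl, hR.le⟩] at h1
    exact nonneg_of_mul_nonneg_left h1 (by positivity)
  rcases hk0.lt_or_eq with hk0 | hk0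
  · have hβ' := hkβ.resolve_left hk0.ne'
    rcases hβ with rfl | rfl
    · have hα1 : 1 ≤ β := by
        by_contra hc
        exact hβ' ⟨hα, not_le.1 hc⟩
      refine IsTightProfile.isTight (A := R₁) (B := R₁) (k₁ := 1) (m := 0) (c := 0) (k₂ := k) ?_
        hα hR₁ hφ
      exact ⟨le_rfl, le_rfl, hR.le, fun h => absurd h (lt_irrefl _),
        fun h => absurd h (lt_irrefl _), fun h => absurd h (lt_irrefl _),
        fun h => absurd h (lt_irrefl _), fun h => absurd h (lt_irrefl _),
        fun h => absurd h (lt_irrefl _), fun _ => hα1, fun _ => hk0, fun _ => hk⟩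
    · refine IsTightProfile.isTight (A := R₂) (B := R₂) (k₁ := k) (m := 0) (c := 0) (k₂ := 1) ?_
        hα hR₁ hφ
      exact ⟨hR.le, le_rfl, le_rfl, fun _ => hk0, fun _ => hk, fun h => absurd h (lt_irrefl _),
        fun h => absurd h (lt_irrefl _), fun _ h => absurd h (lt_irrefl _),
        fun h => absurd h (lt_irrefl _), fun h => absurd h (lt_irrefl _),
        fun h => absurd h (lt_irrefl _), fun h => absurd h (lt_irrefl _)⟩
  · exact isTight_of_eq_zero hα hR₁ hR fun r hr => by rw [hk r hr, ← hk0, zero_mul]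

theorem GluePowers.isTight {R : ℝ} (hα : 0 < α) (hR₁ : 0 < R₁) (hR : R ∈ Ioo R₁ R₂)
    (hφ : ∀ r ∈ Icc R₁ R₂, 0 ≤ φ r) (h : GluePowers α R₁ R R₂ φ) :
    IsTight α R₁ R₂ (radialMap α φ) := by
  obtain ⟨hα1, k₁, k₂, hk₁0, hk₂0, hk₁, hk₂⟩ := h
  refine IsTightProfile.isTight (A := R) (B := R) (k₁ := k₁) (m := 0) (c := 0) (k₂ := k₂) ?_
    hα hR₁ hφ
  exact ⟨hR.1.le, le_rfl, hR.2.le, fun _ => hk₁0, fun _ => hk₁, fun h => absurd h (lt_irrefl _),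
    fun h => absurd h (lt_irrefl _), fun _ h => absurd h (lt_irrefl _),
    fun h => absurd h (lt_irrefl _), fun _ => hα1, fun _ => hk₂0, fun _ => hk₂⟩

/-- Gluing `k₁ r ^ (-α)` to an affine function with the same or the opposite slope gives a tight map
as soon as the affine part is dominated by its slope. -/
theorem isTight_of_power_affine {R k₁ m c : ℝ} (hα : 0 < α) (hR₁ : 0 < R₁) (hR : R ∈ Ioo R₁ R₂)
    (hφ : ∀ r ∈ Icc R₁ R₂, 0 ≤ φ r) (hk₁0 : 0 < k₁) (hk₁ : PowerOn φ R₁ R k₁ (-α))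
    (haff : AffineOn φ R R₂ m c) (hm : |m| = α * φ R / R)
    (hle : ∀ r ∈ Ioo R R₂, α * φ r / r ≤ |m|) : IsTight α R₁ R₂ (radialMap α φ) := by
  refine IsTightProfile.isTight (A := R) (B := R₂) (k₁ := k₁) (m := m) (c := c) (k₂ := 1) ?_
    hα hR₁ hφ
  exact ⟨hR.1.le, hR.2.le, le_rfl, fun _ => hk₁0, fun _ => hk₁, fun _ => haff, fun _ => hle,
    fun _ _ => hm, fun _ h => absurd h (lt_irrefl _), fun h => absurd h (lt_irrefl _),
    fun h => absurd h (lt_irrefl _), fun h => absurd h (lt_irrefl _)⟩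

theorem GluePowerDecreasing.isTight {R : ℝ} (hα : 0 < α) (hR₁ : 0 < R₁) (hR : R ∈ Ioo R₁ R₂)
    (hφ : ∀ r ∈ Icc R₁ R₂, 0 ≤ φ r) (h : GluePowerDecreasing α R₁ R R₂ φ) :
    IsTight α R₁ R₂ (radialMap α φ) := by
  obtain ⟨k₁, m, c, hk₁0, hm0, hk₁, haff, hd⟩ := h
  have hR0 : 0 < R := hR₁.trans hR.1
  have hm : m = -α * φ R / R :=
    hd.unique (hasDerivAt_power hR0.ne' (hk₁ R ⟨hR.1.le, le_rfl⟩))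
  have hm' : |m| = α * φ R / R := by rw [abs_of_neg hm0, hm]; ring
  refine isTight_of_power_affine hα hR₁ hR hφ hk₁0 hk₁ haff hm' fun r hr => ?_
  have h1 : φ r ≤ φ R := by
    rw [haff r (Ioo_subset_Icc_self hr), haff R ⟨le_rfl, hR.2.le⟩]
    nlinarith [hr.1]
  have h2 := hφ R ⟨hR.1.le, hR.2.le⟩
  rw [hm']
  gcongr
  exact hr.1.le

theorem GluePowerIncreasing.isTight {R : ℝ} (hα : α ∈ Ioo (0 : ℝ) 1) (hR₁ : 0 < R₁)
    (hR : R ∈ Ioo R₁ R₂) (hφ : ∀ r ∈ Icc R₁ R₂, 0 ≤ φ r) (h : GluePowerIncreasing α R₁ R R₂ φ) :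
    IsTight α R₁ R₂ (radialMap α φ) := by
  obtain ⟨k₁, m, c, hk₁0, hm0, hk₁, haff, hd⟩ := h
  have hR0 : 0 < R := hR₁.trans hR.1
  have hm : -m = -α * φ R / R :=
    hd.unique (hasDerivAt_power hR0.ne' (hk₁ R ⟨hR.1.le, le_rfl⟩))
  have hm' : m = α * φ R / R := by rw [← neg_neg m, hm]; ring
  refine isTight_of_power_affine hα.1 hR₁ hR hφ hk₁0 hk₁ haff (by rw [abs_of_pos hm0, hm'])
    fun r hr => ?_
  rw [abs_of_pos hm0, div_le_iff₀ (hR0.trans hr.1)]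
  have h1 : φ r = φ R + m * (r - R) := by
    rw [haff r (Ioo_subset_Icc_self hr), haff R ⟨le_rfl, hR.2.le⟩]; ring
  have h2 : α * φ R = m * R := by rw [hm']; field_simp
  have h3 : α * (m * (r - R)) ≤ 1 * (m * (r - R)) := by
    have := mul_pos hm0 (sub_pos.2 hr.1)
    have := hα.2.le
    gcongr
  rw [h1, mul_add, h2]
  linarith

theorem GlueIncreasingPower.isTight {R : ℝ} (hα1 : 1 ≤ α) (hR₁ : 0 < R₁) (hR : R ∈ Ioo R₁ R₂)
    (hφ : ∀ r ∈ Icc R₁ R₂, 0 ≤ φ r) (h : GlueIncreasingPower α R₁ R R₂ φ) :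
    IsTight α R₁ R₂ (radialMap α φ) := by
  obtain ⟨k₂, m, c, hk₂0, hm0, haff, hk₂, hd⟩ := h
  have hR0 : 0 < R := hR₁.trans hR.1
  have hα : 0 < α := one_pos.trans_le hα1
  have hm : m = α * φ R / R :=
    hd.unique (hasDerivAt_power hR0.ne' (hk₂ R ⟨le_rfl, hR.2.le⟩))
  refine IsTightProfile.isTight (A := R₁) (B := R) (k₁ := 1) (m := m) (c := c) (k₂ := k₂) ?_
    hα hR₁ hφ
  refine ⟨le_rfl, hR.1.le, hR.2.le, fun h => absurd h (lt_irrefl _),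
    fun h => absurd h (lt_irrefl _), fun _ => haff, fun _ r hr => ?_,
    fun h => absurd h (lt_irrefl _), fun _ _ => by rw [abs_of_pos hm0, hm], fun _ => hα1,
    fun _ => hk₂0, fun _ => hk₂⟩
  rw [abs_of_pos hm0, div_le_iff₀ (hR₁.trans hr.1)]
  have h1 : φ r = φ R - m * (R - r) := by
    rw [haff r (Ioo_subset_Icc_self hr), haff R ⟨hR.1.le, le_rfl⟩]; ring
  have h2 : α * φ R = m * R := by rw [hm]; field_simp
  have h3 : 1 * (m * (R - r)) ≤ α * (m * (R - r)) := by
    have := mul_pos hm0 (sub_pos.2 hr.2)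
    gcongr
  rw [h1, mul_sub, h2]
  linarith

end RadialTight

theorem mainTheorem7 (α R₁ R₂ : ℝ) (hα : 0 < α) (hR₁ : 0 < R₁) (hR : R₁ < R₂)
    (φ : ℝ → ℝ) (hφ : ∀ r ∈ Set.Icc R₁ R₂, 0 ≤ φ r) :
    RadialTight.IsTight α R₁ R₂ (RadialTight.radialMap α φ) ↔
      ((RadialTight.IsPrincipalAffine α R₁ R₂ φ ∨ RadialTight.IsTightPower α R₁ R₂ φ) ∨
        (¬ (RadialTight.IsPrincipalAffine α R₁ R₂ φ ∨ RadialTight.IsTightPower α R₁ R₂ φ) ∧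
          ∃ R ∈ Set.Ioo R₁ R₂,
            RadialTight.GluePowers α R₁ R R₂ φ ∨
            (1 ≤ α ∧ RadialTight.GluePowerDecreasing α R₁ R R₂ φ) ∨
            (1 ≤ α ∧ RadialTight.GlueIncreasingPower α R₁ R R₂ φ) ∨
            (α ∈ Set.Ioo (0 : ℝ) 1 ∧ RadialTight.GluePowerIncreasing α R₁ R R₂ φ) ∨
            (α ∈ Set.Ioo (0 : ℝ) 1 ∧ RadialTight.GluePowerDecreasing α R₁ R R₂ φ))) := by
  constructor
  · intro ht
    rw [or_iff_not_imp_left]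
    intro hnot
    refine ⟨hnot, ?_⟩
    have h := ht.radialConditions hα hR₁ hφ
    obtain ⟨s, hs, hmin⟩ := isCompact_Icc.exists_isMinOn (Set.nonempty_Icc.2 hR.le) h.continuousOn
    have hmin' : ∀ r ∈ Set.Icc R₁ R₂, φ s ≤ φ r := fun r hr => hmin hr
    rcases hs.1.eq_or_lt with rfl | hs1
    · rcases h.classify_of_min_left hα hR₁ hR hmin' with h1 | ⟨R, hRI, h1⟩
      · exact absurd h1 hnot
      · exact ⟨R, hRI, Or.inr (Or.inr (Or.inl h1))⟩
    rcases hs.2.eq_or_lt with rfl | hs2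
    · rcases h.classify_of_min_right hα hR₁ hR hmin' with h1 | ⟨R, hRI, h1⟩
      · exact absurd h1 hnot
      · refine ⟨R, hRI, ?_⟩
        rcases le_or_gt 1 α with hα1 | hα1
        · exact Or.inr (Or.inl ⟨hα1, h1⟩)
        · exact Or.inr (Or.inr (Or.inr (Or.inr ⟨⟨hα, hα1⟩, h1⟩)))
    · rcases h.classify_of_interior_min hα hR₁ ⟨hs1, hs2⟩ hmin' with h1 | h1 | h1
      · exact absurd (Or.inr h1) hnot
      · exact ⟨s, ⟨hs1, hs2⟩, Or.inl h1⟩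
      · exact ⟨s, ⟨hs1, hs2⟩, Or.inr (Or.inr (Or.inr (Or.inl h1)))⟩
  · rintro ((h | h) | ⟨-, R, hRI, h | ⟨-, h⟩ | ⟨hα1, h⟩ | ⟨hα1, h⟩ | ⟨-, h⟩⟩)
    · exact h.isTight hα hR₁ hR hφ
    · exact h.isTight hα hR₁ hR hφ
    · exact h.isTight hα hR₁ hRI hφ
    · exact h.isTight hα hR₁ hRI hφ
    · exact h.isTight hα1 hR₁ hRI hφ
    · exact h.isTight hα1 hR₁ hRI hφ
    · exact h.isTight hα hR₁ hRI hφ
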